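/- **Setting.** Lattices are generated by $n\ge 1$ linearly independent vectors $\mathbf B=(\vec b_1,\dots,\vec b_n)$ in $\mathbb Q^m$ ($n$ is the rank, or dimension, of the lattice). Lengths of inputs are bit lengths in a standard binary representation, and running time is bit complexity. $\lambda_1(\mathcal L)$ is the length of a shortest nonzero vector of $\mathcal L$. A basis of $\mathcal L$ is an HKZ basis if $\|\vec b_1\|=\lambda_1(\mathcal L)$, its Gram–Schmidt coefficients satisfy $|\mu_{i,j}|\le 1/2$ for $j<i$, and the projections of $\vec b_2,\dots,\vec b_n$ orthogonally to $\vec b_1$ form (recursively) an HKZ basis of the projected lattice. An algorithm with preprocessing consists of a preprocessing map (without resource bounds), which sends a basis $\mathbf B$ to an advice string, and a query algorithm, which is given the advice and a rational target $\vec t$. It runs in polynomial time if the length of the advice is polynomial in the length of $\mathbf B$ and the query algorithm runs in time polynomial in the lengths of $\mathbf B$ and $\vec t$. For $\gamma=\gamma(n)$, it solves $\mathrm{CVPP}_\gamma$ if, for every lattice $\mathcal L\subset\mathbb Q^m$ of rank $n$ and every $\vec t\in\mathbb Q^m$, the query algorithm returns some $\vec y\in\mathcal L$ with $\|\vec t-\vec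 y\|\le\gamma(n)\,\mathrm{dist}(\vec t,\mathcal L)$. It solves $\mathrm{CVPP}_\gamma^{\phi}$ if this holds for all rational $\vec t\in\mathrm{span}(\mathcal L)$ with $\mathrm{dist}(\vec t,\mathcal L)<\phi(\mathcal L)$; in this problem queries are targets in $\mathrm{span}(\mathcal L)$, and on those with $\mathrm{dist}(\vec t,\mathcal L)\ge\phi(\mathcal L)$ any output is acceptable (but the time bound still holds). **Theorem.** Let $\alpha$, $g$, $h$ be functions of the integer $n\ge1$ such that $0<\alpha(n)\le 1/2$ is non-increasing, $g(n)\ge 1$ is real-valued and non-decreasing, and $0\le h(n)<n$ is integer-valued and non-decreasing with $g(n)^{h(n)-1}\le\sqrt n$ for all $n$. Let $$\gamma(n)=\frac{g(n)^{h(n)}}{2\alpha(n)},\qquad \gamma'(n)=\frac{g(n)\sqrt n}{2\alpha(n)},\qquad \phi(\mathcal L)=\alpha(n)\,\lambda_1(\mathcal L)\ \text{ for every lattice }\mathcal L\text{ of rank }n .$$ Then for every polynomial-time algorithm $A$ that solves $\mathrm{CVPP}_\gamma^{\phi}$ there is a polynomial-time algorithm $A'$ that solves $\mathrm{CVPP}_{\gamma'}$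 and whose advice, for each input lattice $\mathcal L$ of rank $n$, consists only of an HKZ basis of $\mathcal L$ and of the advice strings of $A$ for a finite collection (with repetitions allowed) of lattices $\mathcal L_k$ with $\sum_k\dim\mathcal L_k\le n\,(h(n)+1)$. -/

import Mathlib

namespace CVPP

/-! ### Model of computation

Programs of a sequential while-language that work on trees with integer leaves, under the
logarithmic cost criterion: every elementary operation is charged the total bit length of its
argument and of its result.  Up to polynomial factors this is Turing machine time. -/

/-- Data: binary trees whose leaves are integers written in binary. -/
inductive Data : Type
  | int (z : ℤ) : Data
  | pair (a b : Data) : Data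

/-- Bit length of a datum (one extra unit for the sign of a leaf and for every inner node). -/
def Data.size : Data → ℕ
  | .int z => z.natAbs.size + 1
  | .pair a b => a.size + b.size + 1

/-- Elementary operations. -/
inductive Op : Type
  | id
  | const (d : Data)
  | fst
  | snd
  | isPair
  | add
  | sub
  | mul
  | div
  | le

/-- Apply an integer operation to a pair of leaves (on any other argument the result is `0`). -/
def Data.onInts (f : ℤ → ℤ → ℤ) : Data → Data
  | .pair (.int a) (.int b) => .int (f a b)
  | _ => .int 0

/-- Meaning of the elementary operations. An operation that does not apply returns `0`. -/
def Op.eval : Op → Data → Data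
  | .id, x => x
  | .const d, _ => d
  | .fst, .pair a _ => a
  | .fst, .int _ => .int 0
  | .snd, .pair _ b => b
  | .snd, .int _ => .int 0
  | .isPair, .pair _ _ => .int 1
  | .isPair, .int _ => .int 0
  | .add, x => x.onInts (fun a b => a + b)
  | .sub, x => x.onInts (fun a b => a - b)
  | .mul, x => x.onInts (fun a b => a * b)
  | .div, x => x.onInts (fun a b => a / b)
  | .le, x => x.onInts (fun a b => if a ≤ b then 1 else 0)

/-- Programs: each one computes a partial function from data to data.
`comp f g` first runs `g`, then `f`; `pair f g` runs both on the input and pairs the results;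
`cond c f g` runs `f` or `g` according to whether the result of `c` is nonzero;
`loop c f` is the loop "while the result of `c` is nonzero, replace the state by that of `f`". -/
inductive Prog : Type
  | op (o : Op)
  | comp (f g : Prog)
  | pair (f g : Prog)
  | cond (c f g : Prog)
  | loop (c f : Prog)

/-- `Run p x y k`: the program `p`, started on `x`, halts with result `y` after time `k`. -/
inductive Run : Prog → Data → Data → ℕ → Prop
  | op (o : Op) (x : Data) :
      Run (.op o) x (o.eval x) (x.size + (o.eval x).size + 1)
  | comp {f g : Prog} {x y z : Data} {k l : ℕ} :
      Run g x y k → Run f y z l → Run (.comp f g) x z (k + l + 1)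
  | pair {f g : Prog} {x y z : Data} {k l : ℕ} :
      Run f x y k → Run g x z l → Run (.pair f g) x (.pair y z) (k + l + 1)
  | cond_true {c f g : Prog} {x b y : Data} {k l : ℕ} :
      Run c x b k → b ≠ .int 0 → Run f x y l → Run (.cond c f g) x y (k + l + 1)
  | cond_false {c f g : Prog} {x y : Data} {k l : ℕ} :
      Run c x (.int 0) k → Run g x y l → Run (.cond c f g) x y (k + l + 1)
  | loop_stop {c f : Prog} {x : Data} {k : ℕ} :
      Run c x (.int 0) k → Run (.loop c f) x x (k + 1)
  | loop_step {c f : Prog} {x b y z : Data} {k l m : ℕ} :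
      Run c x b k → b ≠ .int 0 → Run f x y l → Run (.loop c f) y z m →
      Run (.loop c f) x z (k + l + m + 1)

/-! ### Encodings -/

/-- A list of data as one datum. -/
def encList : List Data → Data
  | [] => .int 0
  | a :: l => .pair a (encList l)

/-- A rational number as its reduced numerator and denominator. -/
def encRat (q : ℚ) : Data := .pair (.int q.num) (.int q.den)

/-- A rational vector as the list of its coordinates. -/
def encVec {m : ℕ} (v : Fin m → ℚ) : Data := encList ((List.ofFn v).map encRat)

/-! ### Lattices -/

/-- A rational vector as a point of Euclidean space. -/
noncomputable def toReal {m : ℕ} (v : Fin m → ℚ) : EuclideanSpace ℝ (Fin m) :=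
  WithLp.toLp 2 (fun i => (v i : ℝ))

/-- A basis of a (nonzero) rational lattice: `rank` linearly independent vectors in `ℚ ^ dim`. -/
structure LatticeBasis where
  rank : ℕ
  dim : ℕ
  vec : Fin rank → Fin dim → ℚ
  rank_pos : 1 ≤ rank
  indep : LinearIndependent ℝ (fun i => toReal (vec i))

/-- The basis as a list of rational vectors. -/
def LatticeBasis.enc (B : LatticeBasis) : Data :=
  encList (List.ofFn (fun i => encVec (B.vec i)))

/-- The lattice generated by the basis. -/
noncomputable def LatticeBasis.lattice (B : LatticeBasis) :
    Submodule ℤ (EuclideanSpace ℝ (Fin B.dim)) :=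
  Submodule.span ℤ (Set.range (fun i => toReal (B.vec i)))

/-- The linear span of the lattice. -/
noncomputable def LatticeBasis.space (B : LatticeBasis) :
    Submodule ℝ (EuclideanSpace ℝ (Fin B.dim)) :=
  Submodule.span ℝ (Set.range (fun i => toReal (B.vec i)))

/-- Length of a shortest nonzero vector. -/
noncomputable def lambda1 {E : Type*} [NormedAddCommGroup E] (L : Submodule ℤ E) : ℝ :=
  sInf {r : ℝ | ∃ x ∈ L, x ≠ 0 ∧ ‖x‖ = r}

/-- Distance of a rational target to the lattice. -/
noncomputable def LatticeBasis.distTo (B : LatticeBasis) (t : Fin B.dim → ℚ) : ℝ :=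
  Metric.infDist (toReal t) (B.lattice : Set (EuclideanSpace ℝ (Fin B.dim)))

/-- Gram-Schmidt coefficient `⟪b i, b̃ j⟫ / ‖b̃ j‖ ^ 2`. -/
noncomputable def gsCoeff {E : Type*} [NormedAddCommGroup E] [InnerProductSpace ℝ E] {n : ℕ}
    (b : Fin n → E) (i j : Fin n) : ℝ :=
  inner ℝ (b i) (InnerProductSpace.gramSchmidt ℝ b j) /
    ‖InnerProductSpace.gramSchmidt ℝ b j‖ ^ 2

/-- Hermite-Korkin-Zolotarev reducedness of a family of linearly independent vectors, as a
basis of the lattice that it generates. -/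
noncomputable def IsHKZ {E : Type*} [NormedAddCommGroup E] [InnerProductSpace ℝ E] :
    (n : ℕ) → (Fin n → E) → Prop
  | 0, _ => True
  | n + 1, b =>
      ‖b 0‖ = lambda1 (Submodule.span ℤ (Set.range b)) ∧
      (∀ i j : Fin (n + 1), j < i → |gsCoeff b i j| ≤ 1 / 2) ∧
      IsHKZ n (fun i : Fin n => (Submodule.span ℝ {b 0})ᗮ.starProjection (b i.succ))

/-! ### The closest vector problem with preprocessing -/

/-- An algorithm with preprocessing for lattice problems. The preprocessing maps a basis to an
advice string and is not subject to any resource bound; the query phase is a program, which is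
given the advice and the target. -/
structure PreprocAlg where
  preprocess : LatticeBasis → Data
  query : Prog

/-- What the query phase is started on. -/
def PreprocAlg.queryInput (A : PreprocAlg) (B : LatticeBasis) (t : Fin B.dim → ℚ) : Data :=
  .pair (A.preprocess B) (encVec t)

/-- Polynomial time, for the queries in `Adm`: the length of the advice is polynomial in that of
the basis, and the running time of the query phase in those of the basis and of the target. -/
def PreprocAlg.PolyTime (A : PreprocAlg)
    (Adm : (B : LatticeBasis) → (Fin B.dim → ℚ) → Prop) : Prop :=
  ∃ p : Polynomial ℕ,
    (∀ B : LatticeBasis, (A.preprocess B).size ≤ p.eval B.enc.size) ∧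
    ∀ (B : LatticeBasis) (t : Fin B.dim → ℚ), Adm B t →
      ∃ (y : Data) (k : ℕ), Run A.query (A.queryInput B t) y k ∧
        k ≤ p.eval (B.enc.size + (encVec t).size)

/-- On every query in `Adm`, the algorithm returns a lattice vector whose distance to the target
is at most `γ n` times that of the lattice, `n` being the rank of the lattice. -/
def PreprocAlg.Solves (A : PreprocAlg) (γ : ℕ → ℝ)
    (Adm : (B : LatticeBasis) → (Fin B.dim → ℚ) → Prop) : Prop :=
  ∀ (B : LatticeBasis) (t : Fin B.dim → ℚ), Adm B t →
    ∃ (v : Fin B.dim → ℚ) (k : ℕ), Run A.query (A.queryInput B t) (encVec v) k ∧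
      toReal v ∈ B.lattice ∧ ‖toReal t - toReal v‖ ≤ γ B.rank * B.distTo t

/-- A polynomial-time algorithm for `γ`-approximate CVPP: all targets in the ambient space. -/
def PreprocAlg.PolyTimeSolvesCVPP (A : PreprocAlg) (γ : ℕ → ℝ) : Prop :=
  A.PolyTime (fun _ _ => True) ∧ A.Solves γ (fun _ _ => True)

/-- A polynomial-time algorithm for `γ`-approximate CVPP with the promise that the distance of
the target is less than `φ`. The lattice is thought of as embedded in its linear span: queries
are targets in the span. On those that violate the promise the algorithm still has to halt in
time, but any output is acceptable. -/
def PreprocAlg.PolyTimeSolvesPromiseCVPP (A : PreprocAlg) (γ : ℕ → ℝ) (φ : LatticeBasis → ℝ) :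
    Prop :=
  A.PolyTime (fun B t => toReal t ∈ B.space) ∧
  A.Solves γ (fun B t => toReal t ∈ B.space ∧ B.distTo t < φ B)

/-- The advice that `A'` computes for a lattice of rank `n` consists only of an HKZ basis of the
lattice and of the advice strings of `A` for a collection of lattices whose dimensions sum to at
most `bound n`. -/
def PreprocAlg.UsesOnly (A' A : PreprocAlg) (bound : ℕ → ℕ) : Prop :=
  ∀ B : LatticeBasis,
    ∃ (C : Fin B.rank → Fin B.dim → ℚ) (Ls : List LatticeBasis),
      LinearIndependent ℝ (fun i => toReal (C i)) ∧
      Submodule.span ℤ (Set.range (fun i => toReal (C i))) = B.lattice ∧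
      IsHKZ B.rank (fun i => toReal (C i)) ∧
      (Ls.map LatticeBasis.rank).sum ≤ bound B.rank ∧
      A'.preprocess B =
        .pair (encList (List.ofFn (fun i => encVec (C i)))) (encList (Ls.map A.preprocess))

end CVPP

/-!
# From the closest vector problem with a distance promise to the general problem

Let `b` be an HKZ basis of a lattice of rank `n`, with Gram-Schmidt vectors `u`, and write `G` for
`g n` and `h` for `h n`.  A block starts at the index `0` and at every index whose Gram-Schmidt
vector is more than `G` times as long as the one at the previous start (`leader`).  Hence each `u l`
is at most `G` times as long as the one at the start of its block, and going `r` starts further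
lengthens the Gram-Schmidt vector at the start by a factor of at least `G ^ r`.  For a start `i` let
`e i` be the `(h + 1)`-st start after it, or `n`.  The advice consists of the basis and of the
advice of the given algorithm for the lattices `L i` generated by the projections, orthogonal to the
first `i` basis vectors, of the vectors `b k` with `i ≤ k < e i`.  Their ranks sum to at most
`n * (h + 1) - h`, by telescoping (`sum_blocks`).

For a target `t`, nearest-plane rounding yields a residual `S n` (`t` minus a lattice vector).  In
descending order, the residual `S i` for a start `i` is obtained from `S (e i)`: the given algorithm
is run on `L i` and the projection of `S (e i)`, its answer is lifted to the lattice, and the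
coordinates below `i` are rounded.  The output is `t` minus the shortest residual.  To see that it
is close enough (`IsGS.exists_short_residual`), let `c` be a lattice vector closest to `t`, and `d`
the length of the projection of `t - c` to the span of the lattice.

* If `α n * ‖u i‖ ≤ d` for all starts `i`, then every `u l` has length at most `G * d / α n`, and
  `S n` is short because all its coefficients are at most `1 / 2`.
* Otherwise let `i` be the first start with `d < α n * ‖u i‖`.  At a start `k` with
  `‖u k‖ ≥ G ^ h * ‖u i‖` the promise holds, if the residual `S (e k)` is right, that is, equal to
  `t - c` up to the first `e k` basis vectors.  The answer is then within `‖u k‖ / 2` of the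
  target, as is the projection of the right vector, so the two are equal, the minimum of `L k` being
  `‖u k‖`: also `S k` is right.  By induction `S (e i)` is right.  The promise holds at `i` too, and
  `g ^ (h - 1) ≤ √n` bounds the error within the block, while the coordinates below `i` are rounded
  and belong to short Gram-Schmidt vectors.

The query algorithm cannot compute `g` and `h`.  The starts are told to it by the signs of the basis
vectors, which do not matter for the HKZ property (`exists_signed_isHKZ`), and `h` by the number of
advice strings that are left over after those of the blocks; they belong to copies of the lattice of
integers, for which the bound `n * (h + 1)` leaves exactly enough room.

Running times are treated by a calculus of families of data that one program computes in polynomial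
time (`PT`); loops are described by the sequences of their states, so that it remains to bound the
sizes of the states.  Cramer's rule bounds the Gram-Schmidt vectors (`IsGS.exists_bound`), the
minimality of HKZ bases bounds the basis (`exists_gsBound_of_isHKZ`), and the residuals do not grow,
whatever the given algorithm answers, since each coordinate of a residual is affected by the answer
for at most one block before it is rounded (`abs_coef_residual_le`).
-/

namespace CVPP

/-! ### Running times and sizes -/

theorem Run.size_le {p : Prog} {x y : Data} {k : ℕ} (h : Run p x y k) :
    x.size ≤ k ∧ y.size ≤ k := by
  induction h with
  | op o x => omega
  | comp _ _ h1 h2 => omega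
  | pair _ _ h1 h2 => simp only [Data.size]; omega
  | cond_true _ _ _ h1 h2 => omega
  | cond_false _ _ h1 h2 => omega
  | loop_stop _ h1 => omega
  | loop_step _ _ _ _ h1 h2 h3 => omega

/-- Programs are deterministic. -/
theorem Run.unique {p : Prog} {x y : Data} {k : ℕ} (h : Run p x y k) :
    ∀ {y' : Data} {k' : ℕ}, Run p x y' k' → y = y' := by
  induction h with
  | op o x => intro y' k' h'; cases h'; rfl
  | comp _ _ h1 h2 =>
    intro y' k' h'
    cases h' with
    | comp a b => obtain rfl := h1 a; exact h2 b
  | pair _ _ h1 h2 =>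
    intro y' k' h'
    cases h' with
    | pair a b => rw [h1 a, h2 b]
  | cond_true _ hb _ h1 h2 =>
    intro y' k' h'
    cases h' with
    | cond_true a _ b => exact h2 b
    | cond_false a b => exact absurd (h1 a) hb
  | cond_false _ _ h1 h2 =>
    intro y' k' h'
    cases h' with
    | cond_true a hb b => exact absurd (h1 a).symm hb
    | cond_false a b => exact h2 b
  | loop_stop _ h1 =>
    intro y' k' h'
    cases h' with
    | loop_stop a => rfl
    | loop_step a hb _ _ => exact absurd (h1 a).symm hb
  | loop_step _ hb _ _ h1 h2 h3 =>
    intro y' k' h'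
    cases h' with
    | loop_stop a => exact absurd (h1 a) hb
    | loop_step a _ b c => obtain rfl := h2 b; exact h3 c

/-! ### Polynomially bounded families -/

/-- The family `k` of natural numbers is bounded by a polynomial in the size measure `s`. -/
def PB {ι : Type} (s k : ι → ℕ) : Prop :=
  ∃ q : Polynomial ℕ, ∀ i, k i ≤ q.eval (s i)

theorem eval_mono (q : Polynomial ℕ) {x y : ℕ} (h : x ≤ y) : q.eval x ≤ q.eval y := by
  rw [Polynomial.eval_eq_sum_range, Polynomial.eval_eq_sum_range]
  exact Finset.sum_le_sum fun i _ => by gcongr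

section PB
variable {ι κ : Type} {s k l : ι → ℕ}

theorem PB.mono (hk : PB s k) (h : ∀ i, l i ≤ k i) : PB s l := by
  obtain ⟨q, hq⟩ := hk
  exact ⟨q, fun i => (h i).trans (hq i)⟩

theorem PB.const (c : ℕ) : PB s (fun _ => c) := ⟨Polynomial.C c, fun i => by simp⟩

theorem PB.self : PB s s := ⟨Polynomial.X, fun i => by simp⟩

theorem PB.add (hk : PB s k) (hl : PB s l) : PB s (fun i => k i + l i) := by
  obtain ⟨q, hq⟩ := hk
  obtain ⟨r, hr⟩ := hl
  exact ⟨q + r, fun i => by simpa using add_le_add (hq i) (hr i)⟩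

theorem PB.mul (hk : PB s k) (hl : PB s l) : PB s (fun i => k i * l i) := by
  obtain ⟨q, hq⟩ := hk
  obtain ⟨r, hr⟩ := hl
  exact ⟨q * r, fun i => by simpa using Nat.mul_le_mul (hq i) (hr i)⟩

theorem PB.poly (hk : PB s k) (p : Polynomial ℕ) : PB s (fun i => p.eval (k i)) := by
  obtain ⟨q, hq⟩ := hk
  exact ⟨p.comp q, fun i => by simpa using eval_mono p (hq i)⟩

theorem PB.trans (hk : PB s k) (hl : PB k l) : PB s l := by
  obtain ⟨p, hp⟩ := hl
  exact (hk.poly p).mono hp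

theorem PB.reindex (hk : PB s k) (φ : κ → ι) : PB (fun j => s (φ j)) (fun j => k (φ j)) := by
  obtain ⟨q, hq⟩ := hk
  exact ⟨q, fun j => hq (φ j)⟩

end PB

/-! ### Families computed in polynomial time -/

/-- One program takes `a i` to `b i`, for every index `i`, in time polynomial in `s i`. -/
def PT {ι : Type} (s : ι → ℕ) (a b : ι → Data) : Prop :=
  ∃ (p : Prog) (K : ι → ℕ), PB s K ∧ ∀ i, ∃ k ≤ K i, Run p (a i) (b i) k

section PT
variable {ι κ : Type} {s : ι → ℕ} {a b c d : ι → Data}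

theorem PT.size_left (h : PT s a b) : PB s (fun i => (a i).size) := by
  obtain ⟨p, K, hK, h⟩ := h
  refine hK.mono fun i => ?_
  obtain ⟨k, hk, hr⟩ := h i
  exact hr.size_le.1.trans hk

theorem PT.size_right (h : PT s a b) : PB s (fun i => (b i).size) := by
  obtain ⟨p, K, hK, h⟩ := h
  refine hK.mono fun i => ?_
  obtain ⟨k, hk, hr⟩ := h i
  exact hr.size_le.2.trans hk

/-- The identity is charged the size of its argument, which therefore has to be bounded. -/
theorem PT.refl (h : PB s (fun i => (a i).size)) : PT s a a :=
  ⟨.op .id, _, (h.add h).add (PB.const 1), fun i => ⟨_, le_rfl, Run.op .id (a i)⟩⟩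

theorem PT.congr (h : PT s a b) (hbc : ∀ i, b i = c i) : PT s a c := by
  obtain rfl : b = c := funext hbc
  exact h

theorem PT.trans (h : PT s a b) (h' : PT s b c) : PT s a c := by
  obtain ⟨p, K, hK, h⟩ := h
  obtain ⟨p', K', hK', h'⟩ := h'
  refine ⟨.comp p' p, _, (hK.add hK').add (PB.const 1), fun i => ?_⟩
  obtain ⟨k, hk, hr⟩ := h i
  obtain ⟨k', hk', hr'⟩ := h' i
  exact ⟨_, by omega, hr.comp hr'⟩

theorem PT.pair (h : PT s a b) (h' : PT s a c) : PT s a (fun i => .pair (b i) (c i)) := by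
  obtain ⟨p, K, hK, h⟩ := h
  obtain ⟨p', K', hK', h'⟩ := h'
  refine ⟨.pair p p', _, (hK.add hK').add (PB.const 1), fun i => ?_⟩
  obtain ⟨k, hk, hr⟩ := h i
  obtain ⟨k', hk', hr'⟩ := h' i
  exact ⟨_, by omega, hr.pair hr'⟩

theorem PT.reindex (h : PT s a b) (φ : κ → ι) :
    PT (fun j => s (φ j)) (fun j => a (φ j)) (fun j => b (φ j)) := by
  obtain ⟨p, K, hK, h⟩ := h
  exact ⟨p, _, hK.reindex φ, fun j => h (φ j)⟩

theorem Data.size_pos (d : Data) : 1 ≤ d.size := by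
  cases d <;> simp [Data.size]

theorem onInts_size (f : ℤ → ℤ → ℤ)
    (hf : ∀ a b : ℤ, (f a b).natAbs.size ≤ a.natAbs.size + b.natAbs.size + 1) (x : Data) :
    (x.onInts f).size ≤ 2 * x.size := by
  unfold Data.onInts
  split
  · rename_i a b
    have := hf a b
    simp only [Data.size]
    omega
  · have := x.size_pos
    simp [Data.size]
    omega

theorem natAbs_add_size (a b : ℤ) :
    (a + b).natAbs.size ≤ a.natAbs.size + b.natAbs.size + 1 := by
  rw [Nat.size_le]
  have h1 := Nat.lt_size_self a.natAbs
  have h2 := Nat.lt_size_self b.natAbs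
  have h3 := Int.natAbs_add_le a b
  have h4 : 2 ^ a.natAbs.size ≤ 2 ^ (a.natAbs.size + b.natAbs.size) :=
    Nat.pow_le_pow_right (by norm_num) (by omega)
  have h5 : 2 ^ b.natAbs.size ≤ 2 ^ (a.natAbs.size + b.natAbs.size) :=
    Nat.pow_le_pow_right (by norm_num) (by omega)
  rw [pow_succ]
  omega

theorem size_mul_le (a b : ℕ) : (a * b).size ≤ a.size + b.size := by
  rw [Nat.size_le, pow_add]
  exact Nat.mul_lt_mul'' (Nat.lt_size_self a) (Nat.lt_size_self b)

theorem natAbs_div_size (a b : ℤ) :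
    (a / b).natAbs.size ≤ a.natAbs.size + b.natAbs.size + 1 := by
  have h : (a / b).natAbs ≤ a.natAbs + 1 := by
    have h1 := Int.natAbs_ediv_le_natAbs a b
    omega
  have h2 := natAbs_add_size (a.natAbs : ℤ) 1
  have h3 := Nat.size_le_size h
  have h4 : ((a.natAbs : ℤ) + 1).natAbs = a.natAbs + 1 := by omega
  rw [h4] at h2
  have h5 := Int.natAbs_ediv_le_natAbs a b
  have h6 := Nat.size_le_size h5
  omega

/-- An elementary operation at most doubles the size, up to an additive constant. -/
theorem Op.eval_size (o : Op) : ∃ C, ∀ x, (o.eval x).size ≤ 2 * x.size + C := by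
  cases o with
  | id => exact ⟨0, fun x => by simp only [Op.eval]; omega⟩
  | const d => exact ⟨d.size, fun x => by simp only [Op.eval]; omega⟩
  | fst => exact ⟨0, fun x => by cases x <;> simp only [Op.eval, Data.size] <;> simp <;> omega⟩
  | snd => exact ⟨0, fun x => by cases x <;> simp only [Op.eval, Data.size] <;> simp <;> omega⟩
  | isPair => exact ⟨2, fun x => by cases x <;> simp [Op.eval, Data.size]⟩
  | add => exact ⟨0, fun x => onInts_size _ natAbs_add_size x⟩
  | sub => exact ⟨0, fun x => onInts_size _ (fun a b => by
      have := natAbs_add_size a (-b)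
      rwa [Int.natAbs_neg, ← sub_eq_add_neg] at this) x⟩
  | mul => exact ⟨0, fun x => onInts_size _ (fun a b => by
      rw [Int.natAbs_mul]
      have := size_mul_le a.natAbs b.natAbs
      omega) x⟩
  | div => exact ⟨0, fun x => onInts_size _ natAbs_div_size x⟩
  | le => exact ⟨0, fun x => onInts_size _ (fun a b => by split <;> simp) x⟩

theorem PT.op (o : Op) (h : PT s a b) : PT s a (fun i => o.eval (b i)) := by
  refine h.trans ?_
  have hb := h.size_right
  obtain ⟨C, hC⟩ := o.eval_size
  refine ⟨.op o, _, (hb.add (((PB.const 2).mul hb).add (PB.const C))).add (PB.const 1),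
    fun i => ⟨_, ?_, Run.op o (b i)⟩⟩
  have := hC (b i)
  omega

theorem PT.const (h : PB s (fun i => (a i).size)) (d : Data) : PT s a (fun _ => d) :=
  (PT.refl h).op (.const d)

theorem PT.fst (h : PT s a (fun i => .pair (b i) (c i))) : PT s a b := h.op .fst

theorem PT.snd (h : PT s a (fun i => .pair (b i) (c i))) : PT s a c := h.op .snd

/-- Case distinction; each branch has to work on its own part of the index set only. -/
theorem PT.cond (hc : PT s a c)
    (h1 : PT (fun i : {i // c i ≠ .int 0} => s i) (fun i => a i) (fun i => b i))
    (h0 : PT (fun i : {i // c i = .int 0} => s i) (fun i => a i) (fun i => b i)) :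
    PT s a b := by
  obtain ⟨p, K, hK, h⟩ := hc
  obtain ⟨p1, K1, ⟨q1, hq1⟩, h1⟩ := h1
  obtain ⟨p0, K0, ⟨q0, hq0⟩, h0⟩ := h0
  refine ⟨.cond p p1 p0, _, ((hK.add (PB.self.poly q1)).add (PB.self.poly q0)).add (PB.const 1),
    fun i => ?_⟩
  obtain ⟨k, hk, hr⟩ := h i
  by_cases hi : c i = .int 0
  · obtain ⟨k', hk', hr'⟩ := h0 ⟨i, hi⟩
    rw [hi] at hr
    refine ⟨_, ?_, hr.cond_false hr'⟩
    have := hq0 ⟨i, hi⟩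
    dsimp only at *
    omega
  · obtain ⟨k', hk', hr'⟩ := h1 ⟨i, hi⟩
    refine ⟨_, ?_, hr.cond_true hi hr'⟩
    have := hq1 ⟨i, hi⟩
    dsimp only at *
    omega

/-- A truth value as a datum. -/
def encBool (b : Bool) : Data := .int (if b then 1 else 0)

theorem encBool_ne {b : Bool} : encBool b ≠ .int 0 ↔ b = true := by
  cases b <;> simp [encBool]

theorem encBool_eq {b : Bool} : encBool b = .int 0 ↔ b = false := by
  cases b <;> simp [encBool]

theorem PT.condBool {t : ι → Bool} (hc : PT s a (fun i => encBool (t i)))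
    (h1 : PT (fun i : {i // t i = true} => s i) (fun i => a i) (fun i => b i))
    (h0 : PT (fun i : {i // t i = false} => s i) (fun i => a i) (fun i => b i)) :
    PT s a b :=
  PT.cond hc (h1.reindex fun i : {i // encBool (t i) ≠ .int 0} => ⟨i.1, encBool_ne.1 i.2⟩)
    (h0.reindex fun i : {i // encBool (t i) = .int 0} => ⟨i.1, encBool_eq.1 i.2⟩)

theorem PT.ite {t : ι → Bool} (hc : PT s a (fun i => encBool (t i)))
    (h1 : PT s a b) (h0 : PT s a c) : PT s a (fun i => if t i then b i else c i) :=
  PT.condBool hc ((h1.reindex _).congr fun i => by simp [i.2])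
    ((h0.reindex _).congr fun i => by simp [i.2])

/-- A while loop, described by the sequence `St i 0, …, St i (N i)` of its states. -/
theorem PT.loop {N : ι → ℕ} {St t : ι → ℕ → Data} (hN : PB s N)
    (ht : PT (fun k : Σ i, Fin (N i + 1) => s k.1) (fun k => St k.1 k.2) (fun k => t k.1 k.2))
    (ht1 : ∀ i, ∀ j < N i, t i j ≠ .int 0) (ht0 : ∀ i, t i (N i) = .int 0)
    (hf : PT (fun k : Σ i, Fin (N i) => s k.1) (fun k => St k.1 k.2)
      (fun k => St k.1 (k.2 + 1))) :
    PT s (fun i => St i 0) (fun i => St i (N i)) := by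
  obtain ⟨p, K, ⟨q, hq⟩, h⟩ := ht
  obtain ⟨p', K', ⟨q', hq'⟩, h'⟩ := hf
  -- Induction on the number `m` of the remaining rounds.
  have key : ∀ i m j, j + m = N i → ∃ k ≤ (m + 1) * (q.eval (s i) + q'.eval (s i) + 1),
      Run (.loop p p') (St i j) (St i (N i)) k := by
    intro i m
    induction m with
    | zero =>
      intro j hj
      obtain rfl : j = N i := by omega
      obtain ⟨k, hk, hr⟩ := h ⟨i, ⟨N i, by omega⟩⟩
      have := hq ⟨i, ⟨N i, by omega⟩⟩
      dsimp only at *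
      rw [ht0] at hr
      exact ⟨_, by omega, Run.loop_stop hr⟩
    | succ m ih =>
      intro j hj
      obtain ⟨k, hk, hr⟩ := h ⟨i, ⟨j, by omega⟩⟩
      have := hq ⟨i, ⟨j, by omega⟩⟩
      obtain ⟨k', hk', hr'⟩ := h' ⟨i, ⟨j, by omega⟩⟩
      have := hq' ⟨i, ⟨j, by omega⟩⟩
      obtain ⟨k'', hk'', hr''⟩ := ih (j + 1) (by omega)
      dsimp only at *
      refine ⟨_, ?_, Run.loop_step hr (ht1 i j (by omega)) hr' hr''⟩
      rw [add_mul _ 1]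
      omega
  refine ⟨.loop p p', _, (hN.add (PB.const 1)).mul
    (((PB.self.poly q).add (PB.self.poly q')).add (PB.const 1)), fun i => ?_⟩
  exact key i (N i) 0 (by omega)

end PT

/-! ### Lists -/

theorem encList_size (l : List Data) : (encList l).size = (l.map Data.size).sum + l.length + 1 := by
  induction l with
  | nil => simp [encList, Data.size]
  | cons x l ih => simp [encList, Data.size, ih]; omega

theorem length_le_encList_size (l : List Data) : l.length ≤ (encList l).size := by
  rw [encList_size]; omega

theorem size_le_encList_size {l : List Data} {x : Data} (hx : x ∈ l) :
    x.size ≤ (encList l).size := by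
  rw [encList_size]
  have := List.single_le_sum (l := l.map Data.size) (by simp) x.size (List.mem_map_of_mem hx)
  omega

theorem encList_size_le (l : List Data) (C : ℕ) (h : ∀ x ∈ l, x.size ≤ C) :
    (encList l).size ≤ l.length * (C + 1) + 1 := by
  rw [encList_size]
  have := List.sum_le_card_nsmul (l.map Data.size) C (by simpa using h)
  simp at this
  rw [mul_add]
  omega

theorem encList_size_sublist {l l' : List Data} (h : l.Sublist l') :
    (encList l).size ≤ (encList l').size := by
  rw [encList_size, encList_size]
  have h1 := List.Sublist.sum_le_sum (h.map Data.size) (by simp)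
  have h2 := h.length_le
  omega

section Fold
variable {ι κ : Type} {s : ι → ℕ} {a b c d : ι → Data}

/-- A fold over an encoded list, described by the sequence of its states. The step may use
everything that is computable from the input `a` of the whole computation. -/
theorem PT.fold {l : ι → List Data} {St : ι → ℕ → Data}
    (hl : PT s a (fun i => encList (l i))) (h0 : PT s a (fun i => St i 0))
    {K : ι → ℕ} (hK : PB s K) (hsz : ∀ i, ∀ j ≤ (l i).length, (St i j).size ≤ K i)
    (hstep : ∀ a' : (Σ i, Fin (l i).length) → Data,
      (∀ c, PT s a c → PT (fun k : Σ i, Fin (l i).length => s k.1) a' (fun k => c k.1)) →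
      PT (fun k => s k.1) a' (fun k => (l k.1)[k.2]) →
      PT (fun k => s k.1) a' (fun k => St k.1 k.2) →
      PT (fun k => s k.1) a' (fun k => St k.1 (k.2 + 1))) :
    PT s a (fun i => St i (l i).length) := by
  have ha := hl.size_left
  have hls := hl.size_right
  -- The state of the loop: the input, the rest of the list, and the state of the fold.
  let T : ι → ℕ → Data := fun i j => .pair (a i) (.pair (encList ((l i).drop j)) (St i j))
  have hT : ∀ (κ : Type) (φ : κ → ι) (j : κ → ℕ), (∀ k, j k ≤ (l (φ k)).length) →
      PT (fun k => s (φ k)) (fun k => T (φ k) (j k)) (fun k => T (φ k) (j k)) := by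
    intro κ φ j hj
    refine PT.refl (((((ha.add hls).add hK).add (PB.const 2)).reindex φ).mono fun k => ?_)
    have h1 := encList_size_sublist (List.drop_sublist (j k) (l (φ k)))
    have h2 := hsz (φ k) (j k) (hj k)
    simp only [T, Data.size]
    omega
  have main : PT s (fun i => T i 0) (fun i => T i (l i).length) := by
    refine PT.loop (t := fun i j => encBool (decide (j < (l i).length)))
      (hls.mono fun i => length_le_encList_size (l i)) ?_ ?_ ?_ ?_
    · have h := hT (Σ i, Fin ((l i).length + 1)) (fun k => k.1) (fun k => k.2) (fun k => by omega)
      refine (h.snd.fst.op .isPair).congr fun k => ?_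
      obtain ⟨i, j, hj⟩ := k
      rcases Nat.lt_or_ge j (l i).length with h | h
      · change Op.isPair.eval (encList ((l i).drop j)) = encBool (decide (j < (l i).length))
        rw [List.drop_eq_getElem_cons h]
        simp [encList, Op.eval, encBool, h]
      · simp [List.drop_eq_nil_of_le h, encList, Op.eval, encBool, h]
    · intro i j hj
      simp [encBool, hj]
    · intro i
      simp [encBool]
    · have h := hT (Σ i, Fin (l i).length) (fun k => k.1) (fun k => k.2) (fun k => by omega)
      have hr : PT (fun k : Σ i, Fin (l i).length => s k.1) (fun k => T k.1 k.2)
          (fun k => .pair ((l k.1)[k.2]) (encList ((l k.1).drop (k.2 + 1)))) :=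
        h.snd.fst.congr fun k => by
          obtain ⟨i, j, hj⟩ := k
          change encList ((l i).drop j) = _
          rw [List.drop_eq_getElem_cons hj]
          simp [encList]
      exact h.fst.pair (hr.snd.pair
        (hstep _ (fun c hc => h.fst.trans (hc.reindex _)) hr.fst h.snd.snd))
  have hin : PT s a (fun i => T i 0) := (PT.refl ha).pair (PT.pair (by simpa using hl) h0)
  exact (hin.trans main).snd.snd

theorem PT.reverse {l : ι → List Data} (hl : PT s a (fun i => encList (l i))) :
    PT s a (fun i => encList (l i).reverse) := by
  have h := PT.fold (St := fun i j => encList ((l i).take j).reverse) hl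
    (by simpa using PT.const hl.size_left (encList [])) hl.size_right (fun i j _ => by
      refine le_trans (le_of_eq ?_) (encList_size_sublist (List.take_sublist j (l i)))
      simp only [encList_size, List.map_reverse, List.sum_reverse, List.length_reverse])
    (fun a' _ he hs => (he.pair hs).congr fun k => by
      obtain ⟨i, j, hj⟩ := k
      change Data.pair (l i)[j] _ = encList ((l i).take (j + 1)).reverse
      rw [List.take_add_one, List.getElem?_eq_getElem hj, Option.toList_some,
        List.reverse_append]
      rfl)
  exact h.congr fun i => by simp

/-- A fold over a list that carries a state and outputs one datum in each step. -/
theorem PT.mapAccum {l : ι → List Data} {St : ι → ℕ → Data} {O : ι → ℕ → Data}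
    (hl : PT s a (fun i => encList (l i))) (h0 : PT s a (fun i => St i 0))
    {K : ι → ℕ} (hK : PB s K) (hsz : ∀ i, ∀ j ≤ (l i).length, (St i j).size ≤ K i)
    (hstep : ∀ a' : (Σ i, Fin (l i).length) → Data,
      (∀ c, PT s a c → PT (fun k : Σ i, Fin (l i).length => s k.1) a' (fun k => c k.1)) →
      PT (fun k => s k.1) a' (fun k => (l k.1)[k.2]) →
      PT (fun k => s k.1) a' (fun k => St k.1 k.2) →
      PT (fun k => s k.1) a' (fun k => .pair (St k.1 (k.2 + 1)) (O k.1 k.2))) :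
    PT s a (fun i => encList ((List.range (l i).length).map (O i))) := by
  have ha := hl.size_left
  have hls := hl.size_right
  -- The outputs have polynomial size, as each step runs in polynomial time.
  obtain ⟨Q, hQ⟩ : ∃ Q : Polynomial ℕ, ∀ i, ∀ j < (l i).length, (O i j).size ≤ Q.eval (s i) := by
    have h : PT (fun k : Σ i, Fin (l i).length => s k.1)
        (fun k => .pair (a k.1) (.pair ((l k.1)[k.2]) (St k.1 k.2)))
        (fun k => .pair (a k.1) (.pair ((l k.1)[k.2]) (St k.1 k.2))) := by
      refine PT.refl (((((ha.add hls).add hK).add (PB.const 2)).reindex _).mono fun k => ?_)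
      have h1 := size_le_encList_size (List.getElem_mem k.2.2)
      have h2 := hsz k.1 k.2 (by omega)
      simp only [Data.size, Fin.getElem_fin]
      omega
    obtain ⟨Q, hQ⟩ := (hstep _ (fun c hc => h.fst.trans (hc.reindex _))
      h.snd.fst h.snd.snd).snd.size_right
    exact ⟨Q, fun i j hj => hQ ⟨i, j, hj⟩⟩
  -- The outputs are collected in reverse order.
  have h := PT.fold (St := fun i j => .pair (St i j) (encList ((List.range j).map (O i)).reverse))
    hl (h0.pair (by simpa using PT.const ha (encList [])))
    (hK.add ((hls.mul ((PB.self.poly Q).add (PB.const 1))).add (PB.const 2))) (fun i j hj => by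
      have h1 := hsz i j hj
      have h2 : (encList ((List.range j).map (O i)).reverse).size
          ≤ j * (Q.eval (s i) + 1) + 1 := by
        refine (encList_size_le _ (Q.eval (s i)) ?_).trans (by simp)
        intro x hx
        simp only [List.mem_reverse, List.mem_map, List.mem_range] at hx
        obtain ⟨r, hr, rfl⟩ := hx
        exact hQ i r (by omega)
      have h3 : j * (Q.eval (s i) + 1) ≤ (encList (l i)).size * (Q.eval (s i) + 1) :=
        Nat.mul_le_mul_right _ (hj.trans (length_le_encList_size _))
      simp only [Data.size]
      omega)
    (fun a' ht he hs => by
      have h := hstep a' ht he hs.fst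
      exact (h.fst.pair (h.snd.pair hs.snd)).congr fun k => by
        simp [List.range_succ, encList])
  exact h.snd.reverse.congr fun i => by simp

end Fold

end CVPP

namespace CVPP

/-! ### Arithmetic programs -/

section Arith
variable {ι : Type} {s : ι → ℕ} {a d : ι → Data} {x y : ι → ℤ} {p q : ι → ℚ} {t u : ι → Bool}

theorem PT.intAdd (hx : PT s a (fun i => .int (x i))) (hy : PT s a (fun i => .int (y i))) :
    PT s a (fun i => .int (x i + y i)) := (hx.pair hy).op .add

theorem PT.intSub (hx : PT s a (fun i => .int (x i))) (hy : PT s a (fun i => .int (y i))) :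
    PT s a (fun i => .int (x i - y i)) := (hx.pair hy).op .sub

theorem PT.intMul (hx : PT s a (fun i => .int (x i))) (hy : PT s a (fun i => .int (y i))) :
    PT s a (fun i => .int (x i * y i)) := (hx.pair hy).op .mul

theorem PT.intDiv (hx : PT s a (fun i => .int (x i))) (hy : PT s a (fun i => .int (y i))) :
    PT s a (fun i => .int (x i / y i)) := (hx.pair hy).op .div

theorem PT.intLe (hx : PT s a (fun i => .int (x i))) (hy : PT s a (fun i => .int (y i))) :
    PT s a (fun i => encBool (decide (x i ≤ y i))) :=
  ((hx.pair hy).op .le).congr fun i => by simp [Op.eval, Data.onInts, encBool]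

theorem PT.boolNot (ht : PT s a (fun i => encBool (t i))) :
    PT s a (fun i => encBool (!t i)) :=
  (PT.intSub (x := fun _ => 1) (PT.const ht.size_left _) ht).congr fun i => by
    cases t i <;> simp [encBool]

theorem PT.boolAnd (ht : PT s a (fun i => encBool (t i))) (hu : PT s a (fun i => encBool (u i))) :
    PT s a (fun i => encBool (t i && u i)) :=
  (PT.intMul ht hu).congr fun i => by
    cases t i <;> cases u i <;> simp [encBool]

theorem PT.intLt (hx : PT s a (fun i => .int (x i))) (hy : PT s a (fun i => .int (y i))) :
    PT s a (fun i => encBool (decide (x i < y i))) :=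
  (PT.intLe hy hx).boolNot.congr fun i => by simp [← decide_not]

theorem PT.intAbs (hx : PT s a (fun i => .int (x i))) :
    PT s a (fun i => .int (x i).natAbs) := by
  have h0 : PT s a (fun _ => .int 0) := PT.const hx.size_left _
  refine (PT.ite (PT.intLe h0 hx) hx (PT.intSub h0 hx)).congr fun i => ?_
  by_cases h : 0 ≤ x i
  · simp [h, abs_of_nonneg h]
  · simp [h, abs_of_neg (not_le.1 h)]

/-- One step of the Euclidean algorithm. -/
def euclid (z : ℕ × ℕ) : ℕ × ℕ := (z.2, z.1 % z.2)

/-- The Euclidean algorithm makes at most two steps per bit of the second argument, since the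
remainder at least halves in two steps. -/
theorem euclid_steps (n : ℕ) : ∀ m : ℕ, ∃ N ≤ 2 * n.size,
    (∀ j < N, (euclid^[j] (m, n)).2 ≠ 0) ∧ euclid^[N] (m, n) = (m.gcd n, 0) := by
  induction n using Nat.strong_induction_on with
  | _ n ih =>
    intro m
    rcases Nat.eq_zero_or_pos n with rfl | hn
    · exact ⟨0, by simp, by simp, by simp⟩
    have hs : 1 ≤ n.size := Nat.size_pos.2 hn
    by_cases hz : m % n = 0
    · refine ⟨1, by omega, fun j hj => ?_, ?_⟩
      · obtain rfl : j = 0 := by omega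
        simpa using hn.ne'
      · simp [euclid, hz, Nat.gcd_eq_right (Nat.dvd_of_mod_eq_zero hz)]
    · have h1 : m % n < n := Nat.mod_lt _ hn
      have h2 : n % (m % n) < m % n := Nat.mod_lt _ (by omega)
      have h3 : n % (m % n) + m % n ≤ n := by
        have := Nat.mod_add_div n (m % n)
        have h4 : 1 ≤ n / (m % n) := (Nat.one_le_div_iff (by omega)).2 h1.le
        nlinarith
      obtain ⟨N, hN, hN1, hN2⟩ := ih (n % (m % n)) (by omega) (m % n)
      have h4 : (n % (m % n)).size + 1 ≤ n.size := by
        have h5 := Nat.lt_size_self n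
        have h6 : (n % (m % n)).size ≤ n.size - 1 := by
          rw [Nat.size_le]
          obtain ⟨k, hk⟩ : ∃ k, n.size = k + 1 := ⟨n.size - 1, by omega⟩
          rw [hk, pow_succ] at h5
          rw [hk, Nat.add_sub_cancel]
          omega
        omega
      refine ⟨N + 2, by omega, fun j hj => ?_, ?_⟩
      · match j with
        | 0 => simpa using hn.ne'
        | 1 => simpa [euclid] using hz
        | j + 2 => simpa [Function.iterate_succ, euclid] using hN1 j (by omega)
      · have : euclid^[N + 2] (m, n) = euclid^[N] (m % n, n % (m % n)) := by
          simp [Function.iterate_succ, euclid]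
        rw [this, hN2, Nat.gcd_comm (m % n), ← Nat.gcd_rec, ← Nat.gcd_rec, Nat.gcd_comm]

theorem euclid_le (m n j : ℕ) :
    (euclid^[j] (m, n)).1 ≤ m + n ∧ (euclid^[j] (m, n)).2 ≤ m + n := by
  induction j with
  | zero => simp
  | succ j ih =>
    rw [Function.iterate_succ_apply']
    exact ⟨ih.2, (Nat.mod_le _ _).trans ih.1⟩

theorem PT.gcd (hx : PT s a (fun i => .int (x i))) (hy : PT s a (fun i => .int (y i))) :
    PT s a (fun i => .int (Int.gcd (x i) (y i))) := by
  choose N hN hN1 hN2 using fun i => euclid_steps (y i).natAbs (x i).natAbs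
  let St : ι → ℕ → Data := fun i j =>
    .pair (.int (euclid^[j] ((x i).natAbs, (y i).natAbs)).1)
      (.int (euclid^[j] ((x i).natAbs, (y i).natAbs)).2)
  have hxs := hx.size_right
  have hys := hy.size_right
  have hsz : ∀ i j, (St i j).size ≤ 2 * ((Data.int (x i)).size + (Data.int (y i)).size) + 3 := by
    intro i j
    obtain ⟨h1, h2⟩ := euclid_le (x i).natAbs (y i).natAbs j
    have h3 := Nat.size_le_size h1
    have h4 := Nat.size_le_size h2
    have h5 := natAbs_add_size (x i).natAbs (y i).natAbs
    have h6 : (((x i).natAbs : ℤ) + (y i).natAbs).natAbs = (x i).natAbs + (y i).natAbs := by omega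
    rw [h6] at h5
    simp only [Int.natAbs_natCast] at h5
    simp only [St, Data.size, Int.natAbs_natCast]
    omega
  have hS : ∀ (κ : Type) (φ : κ → ι) (j : κ → ℕ),
      PT (fun k => s (φ k)) (fun k => St (φ k) (j k)) (fun k => St (φ k) (j k)) := by
    intro κ φ j
    exact PT.refl (((((PB.const 2).mul (hxs.add hys)).add (PB.const 3)).reindex φ).mono
      fun k => hsz (φ k) (j k))
  have main : PT s (fun i => St i 0) (fun i => St i (N i)) := by
    refine PT.loop (t := fun i j => .int (euclid^[j] ((x i).natAbs, (y i).natAbs)).2)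
      (((PB.const 2).mul hys).mono fun i => ?_) ?_ ?_ ?_ ?_
    · have := hN i
      simp only [Data.size]
      omega
    · exact (hS _ _ _).snd
    · intro i j hj h
      exact hN1 i j hj (by simpa using h)
    · intro i
      simp [hN2]
    · have h := hS (Σ i, Fin (N i)) (fun k => k.1) (fun k => k.2)
      refine (h.snd.pair (PT.intSub h.fst (PT.intMul h.snd (PT.intDiv h.fst h.snd)))).congr
        fun k => ?_
      simp only [St, Function.iterate_succ_apply', euclid]
      rw [← Int.emod_def]
      norm_cast
  exact ((hx.intAbs.pair hy.intAbs).trans main).fst.congr fun i => by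
    simp [hN2, Int.gcd]

theorem encRat_intDiv {m n : ℤ} (hn : 0 < n) :
    encRat ((m : ℚ) / n) = .pair (.int (m / Int.gcd m n)) (.int (n / Int.gcd m n)) := by
  have hg : (Int.gcd m n : ℤ) ≠ 0 := by
    simp [Int.gcd_eq_zero_iff]
    omega
  have hgp : (0 : ℤ) < Int.gcd m n := by positivity
  obtain ⟨k, hk⟩ := Int.gcd_dvd_left m n
  obtain ⟨l, hl⟩ := Int.gcd_dvd_right m n
  set G : ℤ := (Int.gcd m n : ℤ) with hG
  have hl0 : 0 < l := by
    rw [hl] at hn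
    exact pos_of_mul_pos_right hn hgp.le
  have e1 : m / G = k := by rw [hk]; exact Int.mul_ediv_cancel_left _ hg
  have e2 : n / G = l := by rw [hl]; exact Int.mul_ediv_cancel_left _ hg
  have hcop : Nat.Coprime k.natAbs l.natAbs := by
    have h := Int.gcd_ediv_gcd_ediv_gcd (i := m) (j := n) (Nat.pos_of_ne_zero (by simpa [hG] using hg))
    rw [← hG, e1, e2] at h
    exact h
  have hq : (m : ℚ) / n = (k : ℚ) / l := by
    rw [hk, hl]
    push_cast
    have : (G : ℚ) ≠ 0 := by exact_mod_cast hg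
    rw [mul_div_mul_left _ _ this]
  rw [e1, e2, hq, encRat, Rat.num_div_eq_of_coprime hl0 hcop, Rat.den_div_eq_of_coprime hl0 hcop]

theorem PT.intRatio (hx : PT s a (fun i => .int (x i))) (hy : PT s a (fun i => .int (y i)))
    (hpos : ∀ i, 0 < y i) : PT s a (fun i => encRat ((x i : ℚ) / y i)) :=
  ((PT.intDiv hx (PT.gcd hx hy)).pair (PT.intDiv hy (PT.gcd hx hy))).congr fun i =>
    (encRat_intDiv (hpos i)).symm

theorem PT.num (hp : PT s a (fun i => encRat (p i))) : PT s a (fun i => .int (p i).num) := hp.fst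

theorem PT.den (hp : PT s a (fun i => encRat (p i))) : PT s a (fun i => .int (p i).den) := hp.snd

theorem PT.ratAdd (hp : PT s a (fun i => encRat (p i))) (hq : PT s a (fun i => encRat (q i))) :
    PT s a (fun i => encRat (p i + q i)) := by
  refine (PT.intRatio (PT.intAdd (PT.intMul hp.num hq.den) (PT.intMul hq.num hp.den))
    (PT.intMul hp.den hq.den) fun i => by positivity).congr fun i => ?_
  have h1 : ((p i).den : ℚ) ≠ 0 := by positivity
  have h2 : ((q i).den : ℚ) ≠ 0 := by positivity
  congr 1
  conv_rhs => rw [← Rat.num_div_den (p i), ← Rat.num_div_den (q i)]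
  push_cast
  field_simp

theorem PT.ratMul (hp : PT s a (fun i => encRat (p i))) (hq : PT s a (fun i => encRat (q i))) :
    PT s a (fun i => encRat (p i * q i)) := by
  refine (PT.intRatio (PT.intMul hp.num hq.num)
    (PT.intMul hp.den hq.den) fun i => by positivity).congr fun i => ?_
  congr 1
  conv_rhs => rw [← Rat.num_div_den (p i), ← Rat.num_div_den (q i)]
  push_cast
  rw [div_mul_div_comm]

theorem PT.ratConst (h : PB s (fun i => (a i).size)) (r : ℚ) : PT s a (fun _ => encRat r) :=
  PT.const h _

theorem PT.ratNeg (hp : PT s a (fun i => encRat (p i))) : PT s a (fun i => encRat (-p i)) :=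
  (PT.ratMul (PT.ratConst hp.size_left (-1)) hp).congr fun i => by simp

theorem PT.ratLe (hp : PT s a (fun i => encRat (p i))) (hq : PT s a (fun i => encRat (q i))) :
    PT s a (fun i => encBool (decide (p i ≤ q i))) :=
  (PT.intLe (PT.intMul hp.num hq.den) (PT.intMul hq.num hp.den)).congr fun i => by
    congr 1
    rw [decide_eq_decide, Rat.le_iff]

theorem PT.ratLt (hp : PT s a (fun i => encRat (p i))) (hq : PT s a (fun i => encRat (q i))) :
    PT s a (fun i => encBool (decide (p i < q i))) :=
  (PT.ratLe hq hp).boolNot.congr fun i => by simp [← decide_not]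

/-- The quotient by a nonnegative number, with the convention `x / 0 = 0`. -/
theorem PT.ratDiv (hp : PT s a (fun i => encRat (p i))) (hq : PT s a (fun i => encRat (q i)))
    (hpos : ∀ i, 0 ≤ q i) : PT s a (fun i => encRat (p i / q i)) := by
  have h1 : PT s a (fun i => encBool (decide (1 ≤ (q i).num))) :=
    PT.intLe (PT.const hp.size_left _) hq.num
  refine PT.condBool h1 ?_ ?_
  · refine ((PT.intRatio ((PT.intMul hp.num hq.den).reindex _) ((PT.intMul hp.den hq.num).reindex _)
      fun i => ?_)).congr fun i => ?_
    · have := i.2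
      simp only [decide_eq_true_eq] at this
      have h2 : 0 < (p i).den := (p i).den_pos
      positivity
    · congr 1
      conv_rhs => rw [← Rat.num_div_den (p i), ← Rat.num_div_den (q i)]
      push_cast
      rw [div_div_div_eq]
  · refine ((PT.ratConst hp.size_left 0).reindex _).congr fun i => ?_
    have := i.2
    simp only [decide_eq_false_iff_not, not_le] at this
    have h2 : (q i).num = 0 := le_antisymm (by omega) (Rat.num_nonneg.2 (hpos i))
    rw [Rat.num_eq_zero.1 h2]
    simp

/-- A nearest integer. -/
def nearest (r : ℚ) : ℤ := ⌊r + 1 / 2⌋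

theorem PT.nearest (hp : PT s a (fun i => encRat (p i))) :
    PT s a (fun i => encRat (nearest (p i))) := by
  have h := PT.ratAdd hp (PT.ratConst hp.size_left (1 / 2))
  refine ((PT.intDiv h.num h.den).pair (PT.const hp.size_left (.int 1))).congr fun i => ?_
  have : ⌊p i + 1 / 2⌋ = (p i + 1 / 2).num / ((p i + 1 / 2).den : ℤ) := by
    rw [← Rat.floor_def]
    rfl
  rw [CVPP.nearest, this]
  simp [encRat]

/-- The integer stored in a datum, `0` if it is not a leaf. -/
def decInt : Data → ℤ
  | .int z => z
  | .pair _ _ => 0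

/-- The rational number that an arbitrary datum stands for. -/
def decRat (x : Data) : ℚ :=
  if 0 < decInt (Op.snd.eval x) then (decInt (Op.fst.eval x) : ℚ) / decInt (Op.snd.eval x) else 0

theorem decRat_encRat (r : ℚ) : decRat (encRat r) = r := by
  have : (0 : ℤ) < r.den := by exact_mod_cast r.den_pos
  simp [decRat, encRat, Op.eval, decInt, Rat.num_div_den]

theorem PT.decInt (hd : PT s a d) : PT s a (fun i => .int (decInt (d i))) := by
  have h : PT s a (fun i => encBool (match d i with | .int _ => false | .pair _ _ => true)) :=
    (hd.op .isPair).congr fun i => by cases d i <;> simp [Op.eval, encBool]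
  refine (PT.ite h (PT.const hd.size_left (.int 0)) hd).congr fun i => ?_
  cases h : d i <;> simp [CVPP.decInt]

theorem PT.decRat (hd : PT s a d) : PT s a (fun i => encRat (decRat (d i))) := by
  have h1 := (hd.op .fst).decInt
  have h2 := (hd.op .snd).decInt
  have h0 : PT s a (fun _ => .int 0) := PT.const hd.size_left _
  refine PT.condBool (PT.intLt h0 h2) ?_ ?_
  · refine (PT.intRatio (h1.reindex _) (h2.reindex _) fun i => ?_).congr fun i => ?_
    · simpa using i.2
    · have := i.2
      simp only [decide_eq_true_eq] at this
      simp [CVPP.decRat, this]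
  · refine ((PT.ratConst hd.size_left 0).reindex _).congr fun i => ?_
    have := i.2
    simp only [decide_eq_false_iff_not] at this
    simp [CVPP.decRat, this]

end Arith

end CVPP

namespace CVPP

/-! ### Sizes of rational vectors -/

/-- `D` is a denominator of `x`. -/
def IsDen (D : ℕ) (x : ℚ) : Prop := ∃ z : ℤ, (D : ℚ) * x = z

section IsDen
variable {D D' : ℕ} {x y : ℚ}

theorem IsDen.add (hx : IsDen D x) (hy : IsDen D y) : IsDen D (x + y) := by
  obtain ⟨z, hz⟩ := hx
  obtain ⟨w, hw⟩ := hy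
  exact ⟨z + w, by push_cast; rw [mul_add, hz, hw]⟩

theorem IsDen.intMul (hx : IsDen D x) (c : ℤ) : IsDen D (c * x) := by
  obtain ⟨z, hz⟩ := hx
  exact ⟨c * z, by push_cast; rw [← hz]; ring⟩

theorem IsDen.neg (hx : IsDen D x) : IsDen D (-x) := by
  simpa using hx.intMul (-1)

theorem IsDen.sub (hx : IsDen D x) (hy : IsDen D y) : IsDen D (x - y) := by
  rw [sub_eq_add_neg]; exact hx.add hy.neg

theorem IsDen.zero : IsDen D 0 := ⟨0, by simp⟩

theorem IsDen.sum {α : Type*} {t : Finset α} {f : α → ℚ} (h : ∀ i ∈ t, IsDen D (f i)) :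
    IsDen D (∑ i ∈ t, f i) := by
  classical
  induction t using Finset.induction_on with
  | empty => simpa using IsDen.zero
  | insert i t hi ih =>
    rw [Finset.sum_insert hi]
    exact (h i (Finset.mem_insert_self _ _)).add
      (ih fun j hj => h j (Finset.mem_insert_of_mem hj))

theorem IsDen.mul (hx : IsDen D x) (hy : IsDen D' y) : IsDen (D * D') (x * y) := by
  obtain ⟨z, hz⟩ := hx
  obtain ⟨w, hw⟩ := hy
  exact ⟨z * w, by push_cast; rw [← hz, ← hw]; ring⟩

theorem IsDen.of_dvd (hx : IsDen D x) (h : D ∣ D') : IsDen D' x := by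
  obtain ⟨z, hz⟩ := hx
  obtain ⟨k, rfl⟩ := h
  exact ⟨k * z, by push_cast; rw [← hz]; ring⟩

theorem isDen_den (x : ℚ) : IsDen x.den x := ⟨x.num, Rat.den_mul_eq_num x⟩

theorem IsDen.den_dvd (hx : IsDen D x) (hD : 0 < D) : x.den ∣ D := by
  obtain ⟨z, hz⟩ := hx
  have hD' : (D : ℚ) ≠ 0 := by positivity
  have h : x = Rat.divInt z (D : ℤ) := by
    rw [Rat.divInt_eq_div, ← hz]
    push_cast
    field_simp
  rw [h]
  exact_mod_cast Rat.den_dvd z (D : ℤ)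

end IsDen

theorem encRat_size (x : ℚ) : (encRat x).size = x.num.natAbs.size + x.den.size + 3 := by
  simp [encRat, Data.size]; omega

theorem encRat_size_le {D M : ℕ} {x : ℚ} (hD : 0 < D) (hx : IsDen D x) (hM : |x| ≤ M) :
    (encRat x).size ≤ 2 * D.size + M.size + 3 := by
  have h1 : x.den ≤ D := Nat.le_of_dvd hD (hx.den_dvd hD)
  have h2 : x.num.natAbs ≤ M * D := by
    have h3 : (x.num : ℚ) = x.den * x := (Rat.den_mul_eq_num x).symm
    have h4 : ((x.num.natAbs : ℕ) : ℚ) = x.den * |x| := by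
      rw [Nat.cast_natAbs, Int.cast_abs, h3, abs_mul, Nat.abs_cast]
    have h5 : ((x.num.natAbs : ℕ) : ℚ) ≤ ((M * D : ℕ) : ℚ) := by
      rw [h4, mul_comm]
      push_cast
      exact mul_le_mul hM (by exact_mod_cast h1) (by positivity) (by positivity)
    exact_mod_cast h5
  have h3 := Nat.size_le_size h1
  have h4 := (Nat.size_le_size h2).trans (size_mul_le M D)
  rw [encRat_size]
  omega

theorem den_le_two_pow (x : ℚ) : x.den ≤ 2 ^ (encRat x).size := by
  refine (Nat.lt_size_self x.den).le.trans (Nat.pow_le_pow_right (by norm_num) ?_)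
  rw [encRat_size]; omega

theorem abs_le_two_pow (x : ℚ) : |x| ≤ 2 ^ (encRat x).size := by
  have h1 : x.num.natAbs ≤ 2 ^ (encRat x).size := by
    refine (Nat.lt_size_self _).le.trans (Nat.pow_le_pow_right (by norm_num) ?_)
    rw [encRat_size]; omega
  have h2 : |x| ≤ x.num.natAbs := by
    have h3 : ((x.num.natAbs : ℕ) : ℚ) = x.den * |x| := by
      have : (x.num : ℚ) = x.den * x := (Rat.den_mul_eq_num x).symm
      rw [Nat.cast_natAbs, Int.cast_abs, this, abs_mul, Nat.abs_cast]
    rw [h3]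
    exact le_mul_of_one_le_left (abs_nonneg x) (by exact_mod_cast x.den_pos)
  exact h2.trans (by exact_mod_cast h1)

theorem encVec_eq {m : ℕ} (v : Fin m → ℚ) :
    encVec v = encList (List.ofFn fun k => encRat (v k)) := by
  rw [encVec, List.map_ofFn]; rfl

theorem encVec_size {m : ℕ} (v : Fin m → ℚ) :
    (encVec v).size = ∑ k, (encRat (v k)).size + m + 1 := by
  rw [encVec_eq, encList_size, List.map_ofFn, List.sum_ofFn, List.length_ofFn]; rfl

theorem encRat_size_le_encVec {m : ℕ} (v : Fin m → ℚ) (k : Fin m) :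
    (encRat (v k)).size ≤ (encVec v).size := by
  rw [encVec_size]
  have := Finset.single_le_sum (f := fun k => (encRat (v k)).size) (fun _ _ => Nat.zero_le _)
    (Finset.mem_univ k)
  omega

theorem dim_le_encVec_size {m : ℕ} (v : Fin m → ℚ) : m ≤ (encVec v).size := by
  rw [encVec_size]; omega

theorem encVec_size_le {m D M : ℕ} {v : Fin m → ℚ} (hD : 0 < D) (hv : ∀ k, IsDen D (v k))
    (hM : ∀ k, |v k| ≤ M) : (encVec v).size ≤ m * (2 * D.size + M.size + 4) + 1 := by
  rw [encVec_eq]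
  refine (encList_size_le _ (2 * D.size + M.size + 3) ?_).trans (by simp)
  intro x hx
  obtain ⟨k, rfl⟩ := (List.mem_ofFn' _ _).1 hx
  exact encRat_size_le hD (hv k) (hM k)

/-- A common denominator of the coordinates of a vector. -/
def vecDen {m : ℕ} (v : Fin m → ℚ) : ℕ := ∏ k, (v k).den

theorem vecDen_pos {m : ℕ} (v : Fin m → ℚ) : 0 < vecDen v :=
  Finset.prod_pos fun k _ => (v k).den_pos

theorem isDen_vecDen {m : ℕ} (v : Fin m → ℚ) (k : Fin m) : IsDen (vecDen v) (v k) :=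
  (isDen_den _).of_dvd (Finset.dvd_prod_of_mem _ (Finset.mem_univ k))

theorem vecDen_le {m : ℕ} (v : Fin m → ℚ) : vecDen v ≤ 2 ^ (encVec v).size := by
  calc vecDen v ≤ ∏ k, 2 ^ (encRat (v k)).size :=
        Finset.prod_le_prod' fun k _ => den_le_two_pow _
    _ = 2 ^ (∑ k, (encRat (v k)).size) := Finset.prod_pow_eq_pow_sum _ _ _
    _ ≤ _ := Nat.pow_le_pow_right (by norm_num) (by rw [encVec_size]; omega)

theorem abs_vec_le {m : ℕ} (v : Fin m → ℚ) (k : Fin m) : |v k| ≤ 2 ^ (encVec v).size :=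
  (abs_le_two_pow _).trans (pow_le_pow_right₀ (by norm_num) (encRat_size_le_encVec v k))

/-! ### Programs for rational vectors -/

theorem encList_ofFn_drop {m : ℕ} (f : Fin m → Data) {j : ℕ} (hj : j < m) :
    encList ((List.ofFn f).drop j) = .pair (f ⟨j, hj⟩) (encList ((List.ofFn f).drop (j + 1))) := by
  rw [List.drop_eq_getElem_cons (by simpa using hj)]
  simp [encList]

theorem encList_range_map {m : ℕ} (f : Fin m → Data) (z : Data) :
    (List.range m).map (fun j => if h : j < m then f ⟨j, h⟩ else z) = List.ofFn f := by
  apply List.ext_getElem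
  · simp
  · intro j h1 h2
    simp at h1
    simp [h1]

section VecProg
variable {ι : Type} {s : ι → ℕ} {a d : ι → Data} {m : ι → ℕ} {u v : ∀ i, Fin (m i) → ℚ}
  {c : ι → ℚ}

theorem PT.dot (hu : PT s a (fun i => encVec (u i))) (hv : PT s a (fun i => encVec (v i))) :
    PT s a (fun i => encRat (u i ⬝ᵥ v i)) := by
  let P : ι → ℕ → ℚ := fun i j => ∑ k : Fin (m i) with k.1 < j, u i k * v i k
  have hP : ∀ i j, (encRat (P i j)).size ≤
      2 * ((encVec (u i)).size + (encVec (v i)).size + 1) +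
      (((encVec (u i)).size + (encVec (u i)).size + (encVec (v i)).size) + 1) + 3 := by
    intro i j
    set U := (encVec (u i)).size
    set V := (encVec (v i)).size
    have h1 : IsDen (vecDen (u i) * vecDen (v i)) (P i j) :=
      IsDen.sum fun k _ => (isDen_vecDen _ k).mul (isDen_vecDen _ k)
    have h2 : |P i j| ≤ ((2 ^ (U + U + V) : ℕ) : ℚ) := by
      calc |P i j| ≤ ∑ k : Fin (m i) with k.1 < j, |u i k * v i k| :=
            Finset.abs_sum_le_sum_abs _ _
        _ ≤ ∑ k : Fin (m i) with k.1 < j, (2 ^ U * 2 ^ V : ℚ) := by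
            refine Finset.sum_le_sum fun k _ => ?_
            rw [abs_mul]
            exact mul_le_mul (abs_vec_le _ k) (abs_vec_le _ k) (abs_nonneg _) (by positivity)
        _ ≤ 2 ^ U * (2 ^ U * 2 ^ V) := by
            rw [Finset.sum_const, nsmul_eq_mul]
            refine mul_le_mul_of_nonneg_right ?_ (by positivity)
            have h3 := Finset.card_filter_le (Finset.univ : Finset (Fin (m i))) (fun k => k.1 < j)
            have h4 : (Finset.univ.filter fun k : Fin (m i) => k.1 < j).card ≤ 2 ^ U := by
              refine (h3.trans ?_).trans Nat.lt_two_pow_self.le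
              simpa using dim_le_encVec_size (u i)
            exact_mod_cast h4
        _ = _ := by push_cast; ring
    have h3 := encRat_size_le (Nat.mul_pos (vecDen_pos _) (vecDen_pos _)) h1 h2
    have h4 := size_mul_le (vecDen (u i)) (vecDen (v i))
    have h5 : (vecDen (u i) * vecDen (v i)).size ≤ U + V + 1 := by
      refine (Nat.size_le_size (Nat.mul_le_mul (vecDen_le (u i)) (vecDen_le (v i)))).trans ?_
      rw [← pow_add, Nat.size_pow]
    rw [Nat.size_pow] at h3
    omega
  have hus := hu.size_right
  have hvs := hv.size_right
  have h := PT.fold (l := fun i => List.ofFn fun k => encRat (u i k))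
    (St := fun i j => .pair (encList ((List.ofFn fun k => encRat (v i k)).drop j)) (encRat (P i j)))
    (hu.congr fun i => encVec_eq _)
    ((hv.pair (PT.ratConst hu.size_left 0)).congr fun i => by simp [encVec_eq, P])
    (K := fun i => (encVec (v i)).size + (2 * ((encVec (u i)).size + (encVec (v i)).size + 1) +
      (((encVec (u i)).size + (encVec (u i)).size + (encVec (v i)).size) + 1) + 3) + 1)
    ((hvs.add ((((PB.const 2).mul ((hus.add hvs).add (PB.const 1))).add
      (((hus.add hus).add hvs).add (PB.const 1))).add (PB.const 3))).add (PB.const 1))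
    (fun i j _ => by
      have h1 := encList_size_sublist (List.drop_sublist j (List.ofFn fun k => encRat (v i k)))
      rw [← encVec_eq] at h1
      have h2 := hP i j
      simp only [Data.size]
      omega)
    (fun a' _ he hs => by
      have hv' := hs.fst.congr (c := fun k => .pair (encRat (v k.1 ⟨k.2, by simpa using k.2.2⟩))
        (encList ((List.ofFn fun r => encRat (v k.1 r)).drop (k.2 + 1))))
        (fun k => encList_ofFn_drop _ (by simpa using k.2.2))
      have he' := he.congr (c := fun k => encRat (u k.1 ⟨k.2, by simpa using k.2.2⟩))
        (fun k => by simp)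
      refine (hv'.snd.pair (PT.ratAdd hs.snd (PT.ratMul he' hv'.fst))).congr fun k => ?_
      congr 2
      obtain ⟨i, j, hj⟩ := k
      have hj' : j < m i := by simpa using hj
      have : (Finset.univ.filter fun r : Fin (m i) => r.1 < j + 1) =
          insert ⟨j, hj'⟩ (Finset.univ.filter fun r : Fin (m i) => r.1 < j) := by
        ext r
        simp only [Finset.mem_filter, Finset.mem_univ, true_and, Finset.mem_insert, Fin.ext_iff]
        omega
      simp only [P]
      rw [this, Finset.sum_insert (by simp), add_comm])
  refine h.snd.congr fun i => ?_
  congr 1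
  simp only [P, List.length_ofFn, dotProduct]
  refine Finset.sum_congr ?_ fun _ _ => rfl
  ext k
  simp

theorem PT.axpy (hc : PT s a (fun i => encRat (c i))) (hu : PT s a (fun i => encVec (u i)))
    (hv : PT s a (fun i => encVec (v i))) : PT s a (fun i => encVec (u i + c i • v i)) := by
  have hus := hu.size_right
  have hvs := hv.size_right
  have h := PT.mapAccum (l := fun i => List.ofFn fun k => encRat (u i k))
    (St := fun i j => encList ((List.ofFn fun k => encRat (v i k)).drop j))
    (O := fun i j => if h : j < m i then encRat (u i ⟨j, h⟩ + c i * v i ⟨j, h⟩) else .int 0)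
    (hu.congr fun i => encVec_eq _) (hv.congr fun i => by simp [encVec_eq]) hvs
    (fun i j _ => by
      have h1 := encList_size_sublist (List.drop_sublist j (List.ofFn fun k => encRat (v i k)))
      rwa [← encVec_eq] at h1)
    (fun a' ht he hs => by
      have hv' := hs.congr (c := fun k => .pair (encRat (v k.1 ⟨k.2, by simpa using k.2.2⟩))
        (encList ((List.ofFn fun r => encRat (v k.1 r)).drop (k.2 + 1))))
        (fun k => encList_ofFn_drop _ (by simpa using k.2.2))
      have he' := he.congr (c := fun k => encRat (u k.1 ⟨k.2, by simpa using k.2.2⟩))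
        (fun k => by simp)
      refine (hv'.snd.pair (PT.ratAdd he' (PT.ratMul (ht _ hc) hv'.fst))).congr fun k => ?_
      have hj : (k.2 : ℕ) < m k.1 := by simpa using k.2.2
      simp only [hj, dite_true])
  refine h.congr fun i => ?_
  rw [List.length_ofFn, encVec_eq]
  exact congrArg encList (encList_range_map (fun k => encRat (u i k + c i * v i k)) (.int 0))

theorem PT.vecAdd (hu : PT s a (fun i => encVec (u i))) (hv : PT s a (fun i => encVec (v i))) :
    PT s a (fun i => encVec (u i + v i)) :=
  (PT.axpy (PT.ratConst hu.size_left 1) hu hv).congr fun i => by simp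

theorem PT.vecSub (hu : PT s a (fun i => encVec (u i))) (hv : PT s a (fun i => encVec (v i))) :
    PT s a (fun i => encVec (u i - v i)) :=
  (PT.axpy (PT.ratConst hu.size_left (-1)) hu hv).congr fun i => by
    rw [neg_smul, one_smul, sub_eq_add_neg]

theorem PT.vecZero (hu : PT s a (fun i => encVec (u i))) :
    PT s a (fun i => encVec (0 : Fin (m i) → ℚ)) :=
  (PT.vecSub hu hu).congr fun i => by simp

/-- The vector of dimension `m` that an arbitrary datum stands for. -/
def decVec (m : ℕ) (x : Data) : Fin m → ℚ := fun k => decRat (Op.fst.eval (Op.snd.eval^[k] x))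

theorem decVec_encVec {m : ℕ} (v : Fin m → ℚ) : decVec m (encVec v) = v := by
  have h : ∀ j ≤ m, Op.snd.eval^[j] (encVec v) =
      encList ((List.ofFn fun k => encRat (v k)).drop j) := by
    intro j
    induction j with
    | zero => simp [encVec_eq]
    | succ j ih =>
      intro hj
      rw [Function.iterate_succ_apply', ih (by omega), encList_ofFn_drop _ (by omega)]
      rfl
  funext k
  rw [decVec, h k k.2.le, encList_ofFn_drop _ k.2]
  exact decRat_encRat _

theorem snd_iterate_size (x : Data) (j : ℕ) : (Op.snd.eval^[j] x).size ≤ x.size := by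
  induction j with
  | zero => rfl
  | succ j ih =>
    rw [Function.iterate_succ_apply']
    refine le_trans ?_ ih
    cases Op.snd.eval^[j] x <;> simp only [Op.eval, Data.size]
    · simp
    · omega

theorem PT.decVec (hu : PT s a (fun i => encVec (u i))) (hd : PT s a d) :
    PT s a (fun i => encVec (decVec (m i) (d i))) := by
  have h := PT.mapAccum (l := fun i => List.ofFn fun k => encRat (u i k))
    (St := fun i j => Op.snd.eval^[j] (d i))
    (O := fun i j => encRat (CVPP.decRat (Op.fst.eval (Op.snd.eval^[j] (d i)))))
    (hu.congr fun i => encVec_eq _) hd hd.size_right (fun i j _ => snd_iterate_size _ _)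
    (fun a' ht he hs => by
      refine ((hs.op .snd).pair (hs.op .fst).decRat).congr fun k => ?_
      rw [Function.iterate_succ_apply'])
  refine h.congr fun i => ?_
  rw [List.length_ofFn, encVec_eq, ← encList_range_map _ (.int 0)]
  congr 1
  refine List.map_congr_left fun j hj => ?_
  rw [dif_pos (List.mem_range.1 hj)]
  rfl

end VecProg

end CVPP

namespace CVPP

open Submodule InnerProductSpace

/-! ### Discreteness of lattices -/

section Lattice
variable {E : Type} [NormedAddCommGroup E] [InnerProductSpace ℝ E] {n : ℕ}

/-- A lattice has only finitely many points in a ball. -/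
theorem finite_lattice_ball {b : Fin n → E} (hb : LinearIndependent ℝ b) (t : E) (R : ℝ) :
    {x : E | x ∈ span ℤ (Set.range b) ∧ ‖t - x‖ ≤ R}.Finite := by
  obtain ⟨K, hK, hanti⟩ := (LinearMap.injective_iff_antilipschitz
    (Fintype.linearCombination ℝ b)).1 hb.fintypeLinearCombination_injective
  have hbound : ∀ z : Fin n → ℝ, ‖z‖ ≤ K * ‖∑ i, z i • b i‖ := by
    intro z
    have := hanti.le_mul_dist z 0
    simpa [Fintype.linearCombination_apply] using this
  set C : ℤ := ⌈(K : ℝ) * (R + ‖t‖)⌉ with hC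
  have hfin : (Set.Icc (fun _ => -C : Fin n → ℤ) (fun _ => C)).Finite := Set.finite_Icc _ _
  refine (hfin.image fun z : Fin n → ℤ => ∑ i, z i • b i).subset ?_
  rintro x ⟨hx, hxt⟩
  obtain ⟨z, rfl⟩ := (mem_span_range_iff_exists_fun ℤ).1 hx
  refine ⟨z, ?_, rfl⟩
  have hz : ∀ i, |z i| ≤ C := by
    intro i
    have h1 := hbound (fun i => (z i : ℝ))
    have h2 : ‖∑ i, (z i : ℝ) • b i‖ ≤ R + ‖t‖ := by
      have h3 : ∑ i, (z i : ℝ) • b i = t - (t - ∑ i, z i • b i) := by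
        rw [sub_sub_cancel]
        exact Finset.sum_congr rfl fun i _ => Int.cast_smul_eq_zsmul ℝ _ _
      rw [h3]
      exact (norm_sub_le _ _).trans (by linarith)
    have h3 : ‖(z i : ℝ)‖ ≤ (K : ℝ) * (R + ‖t‖) :=
      ((norm_le_pi_norm (fun i => (z i : ℝ)) i).trans h1).trans
        (mul_le_mul_of_nonneg_left h2 K.2)
    have h4 : ((|z i| : ℤ) : ℝ) ≤ C := by
      rw [Int.cast_abs, ← Real.norm_eq_abs]
      exact h3.trans (Int.le_ceil _)
    exact_mod_cast h4
  exact ⟨fun i => (abs_le.1 (hz i)).1, fun i => (abs_le.1 (hz i)).2⟩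

/-- Every nonempty set of lattice points has a point nearest to `t`. -/
theorem exists_nearest_mem {b : Fin n → E} (hb : LinearIndependent ℝ b) (t : E) {S : Set E}
    (hS : S ⊆ span ℤ (Set.range b)) (hne : S.Nonempty) :
    ∃ x ∈ S, ∀ y ∈ S, ‖t - x‖ ≤ ‖t - y‖ := by
  obtain ⟨x₀, hx₀⟩ := hne
  have hfin : {x | x ∈ S ∧ ‖t - x‖ ≤ ‖t - x₀‖}.Finite :=
    (finite_lattice_ball hb t ‖t - x₀‖).subset fun x hx => ⟨hS hx.1, hx.2⟩
  obtain ⟨x, hx, hmin⟩ := hfin.exists_minimalFor (fun x => ‖t - x‖) _ ⟨x₀, hx₀, le_rfl⟩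
  refine ⟨x, hx.1, fun y hy => ?_⟩
  rcases le_total ‖t - y‖ ‖t - x₀‖ with h | h
  · rcases le_total ‖t - x‖ ‖t - y‖ with h' | h'
    · exact h'
    · exact hmin ⟨hy, h⟩ h'
  · exact hx.2.trans h

theorem exists_closest {b : Fin n → E} (hb : LinearIndependent ℝ b) (t : E) :
    ∃ x ∈ span ℤ (Set.range b),
      ‖t - x‖ = Metric.infDist t (span ℤ (Set.range b) : Set E) := by
  obtain ⟨x, hx, hmin⟩ := exists_nearest_mem hb t (S := span ℤ (Set.range b)) le_rfl
    ⟨0, zero_mem _⟩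
  refine ⟨x, hx, le_antisymm ?_ ?_⟩
  · refine (Metric.le_infDist ⟨0, zero_mem _⟩).2 fun y hy => ?_
    rw [dist_eq_norm]
    exact hmin y hy
  · rw [← dist_eq_norm]
    exact Metric.infDist_le_dist_of_mem hx

omit [InnerProductSpace ℝ E] in
theorem lambda1_le {L : Submodule ℤ E} {x : E} (hx : x ∈ L) (h0 : x ≠ 0) : lambda1 L ≤ ‖x‖ :=
  csInf_le ⟨0, by rintro r ⟨y, _, _, rfl⟩; exact norm_nonneg y⟩ ⟨x, hx, h0, rfl⟩

omit [InnerProductSpace ℝ E] in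
theorem le_lambda1 {L : Submodule ℤ E} {r : ℝ} (hne : ∃ x ∈ L, x ≠ 0)
    (h : ∀ x ∈ L, x ≠ 0 → r ≤ ‖x‖) : r ≤ lambda1 L := by
  obtain ⟨x, hx, h0⟩ := hne
  exact le_csInf ⟨_, x, hx, h0, rfl⟩ (by rintro _ ⟨y, hy, hy0, rfl⟩; exact h y hy hy0)

theorem exists_shortest {b : Fin (n + 1) → E} (hb : LinearIndependent ℝ b) :
    ∃ v ∈ span ℤ (Set.range b), v ≠ 0 ∧ ‖v‖ = lambda1 (span ℤ (Set.range b)) := by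
  have hne : ∃ x ∈ span ℤ (Set.range b), x ≠ 0 := ⟨b 0, subset_span ⟨0, rfl⟩, hb.ne_zero 0⟩
  obtain ⟨v, hv, hmin⟩ := exists_nearest_mem hb 0
    (S := {x | x ∈ span ℤ (Set.range b) ∧ x ≠ 0}) (fun x hx => hx.1) hne
  refine ⟨v, hv.1, hv.2, le_antisymm (le_lambda1 hne fun x hx h0 => ?_) (lambda1_le hv.1 hv.2)⟩
  simpa using hmin x ⟨hx, h0⟩

/-! ### Gram-Schmidt vectors -/

theorem mem_span_image {ι : Type*} {f : ι → E} {s : Set ι} {i : ι} (hi : i ∈ s) :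
    f i ∈ span ℝ (f '' s) := subset_span ⟨i, hi, rfl⟩

/-- The Gram-Schmidt vector is characterised by lying in the right coset and being orthogonal
to the previous vectors. -/
theorem gramSchmidt_unique {f : Fin n → E} {j : Fin n} {w : E}
    (h1 : f j - w ∈ span ℝ (f '' Set.Iio j)) (h2 : ∀ i < j, inner ℝ (f i) w = 0) :
    w = gramSchmidt ℝ f j := by
  have h3 : f j - gramSchmidt ℝ f j ∈ span ℝ (f '' Set.Iio j) := by
    rw [gramSchmidt_def, sub_sub_cancel, ← span_gramSchmidt_Iio ℝ f j]
    refine sum_mem fun i hi => ?_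
    rw [starProjection_singleton]
    exact smul_mem _ _ (mem_span_image (Finset.mem_Iio.1 hi))
  have h4 : w - gramSchmidt ℝ f j ∈ span ℝ (f '' Set.Iio j) := by
    have := sub_mem h3 h1
    rwa [sub_sub_sub_cancel_left] at this
  have h5 : ∀ x ∈ span ℝ (f '' Set.Iio j), inner ℝ x (w - gramSchmidt ℝ f j) = 0 := by
    intro x hx
    induction hx using span_induction with
    | mem x hx =>
      obtain ⟨i, hi, rfl⟩ := hx
      rw [inner_sub_right, h2 i hi, real_inner_comm, gramSchmidt_inv_triangular ℝ f hi, sub_zero]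
    | zero => simp
    | add x y _ _ hx hy => rw [inner_add_left, hx, hy, add_zero]
    | smul c x _ hx => rw [real_inner_smul_left, hx, mul_zero]
  have h6 := h5 _ h4
  rw [inner_self_eq_zero] at h6
  exact sub_eq_zero.1 h6

theorem gramSchmidt_sub_mem (f : Fin n → E) (j : Fin n) :
    f j - gramSchmidt ℝ f j ∈ span ℝ (f '' Set.Iio j) := by
  rw [gramSchmidt_def, sub_sub_cancel, ← span_gramSchmidt_Iio ℝ f j]
  refine sum_mem fun i hi => ?_
  rw [starProjection_singleton]
  exact smul_mem _ _ (mem_span_image (Finset.mem_Iio.1 hi))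

/-- Projection orthogonally to `v`. -/
noncomputable def projAway (v : E) : E →L[ℝ] E := (span ℝ {v})ᗮ.starProjection

theorem projAway_apply (v x : E) : projAway v x = x - (inner ℝ v x / ‖v‖ ^ 2) • v := by
  rw [projAway, starProjection_orthogonal_val, starProjection_singleton]
  simp

theorem inner_projAway (v x : E) : inner ℝ v (projAway v x) = 0 := by
  have h : projAway v x ∈ (span ℝ {v})ᗮ := starProjection_apply_mem _ _
  exact mem_orthogonal_singleton_iff_inner_right.1 h

theorem projAway_self (v : E) : projAway v v = 0 := by
  rw [projAway, starProjection_orthogonal_val,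
    starProjection_eq_self_iff.2 (mem_span_singleton_self v), sub_self]

theorem gramSchmidt_succ (c : Fin (n + 1) → E) (j : Fin n) :
    gramSchmidt ℝ c j.succ = gramSchmidt ℝ (fun i => projAway (c 0) (c i.succ)) j := by
  set P := projAway (c 0)
  set w := gramSchmidt ℝ (fun i : Fin n => P (c i.succ)) j with hw
  have h0 : c 0 ∈ span ℝ (c '' Set.Iio j.succ) := mem_span_image (Fin.succ_pos j)
  have hd : ∀ i : Fin n, c i.succ - P (c i.succ) ∈ span ℝ (c '' Set.Iio j.succ) := by
    intro i
    rw [projAway_apply, sub_sub_cancel]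
    exact smul_mem _ _ h0
  have hwperp : inner ℝ (c 0) w = 0 := by
    have hmem : w ∈ span ℝ (Set.range fun i : Fin n => P (c i.succ)) := by
      refine span_mono ?_ (gramSchmidt_mem_span ℝ (fun i : Fin n => P (c i.succ)) (le_refl j))
      exact Set.image_subset_range _ _
    clear_value w
    clear hw
    induction hmem using span_induction with
    | mem x hx =>
      obtain ⟨i, rfl⟩ := hx
      exact inner_projAway _ _
    | zero => simp
    | add x y _ _ hx hy => rw [inner_add_right, hx, hy, add_zero]
    | smul r x _ hx => rw [real_inner_smul_right, hx, mul_zero]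
  refine (gramSchmidt_unique ?_ ?_).symm
  · have h1 := gramSchmidt_sub_mem (fun i : Fin n => P (c i.succ)) j
    rw [← hw] at h1
    have h2 : span ℝ ((fun i : Fin n => P (c i.succ)) '' Set.Iio j) ≤
        span ℝ (c '' Set.Iio j.succ) := by
      rw [span_le]
      rintro _ ⟨i, hi, rfl⟩
      have := sub_mem (mem_span_image (f := c) (s := Set.Iio j.succ)
        (Fin.succ_lt_succ_iff.2 (show i < j from hi))) (hd i)
      simpa using this
    have := add_mem (hd j) (h2 h1)
    simpa using this
  · intro i hi
    induction i using Fin.cases with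
    | zero => exact hwperp
    | succ i =>
      have h1 : inner ℝ (P (c i.succ)) w = 0 := by
        rw [real_inner_comm]
        exact gramSchmidt_inv_triangular ℝ _ (Fin.succ_lt_succ_iff.1 hi)
      rw [projAway_apply, inner_sub_left, real_inner_smul_left, hwperp, mul_zero, sub_zero] at h1
      exact h1

theorem gramSchmidt_fin_zero (c : Fin (n + 1) → E) : gramSchmidt ℝ c 0 = c 0 :=
  gramSchmidt_bot ℝ c

theorem gsCoeff_succ (c : Fin (n + 1) → E) (i j : Fin n) :
    gsCoeff c i.succ j.succ = gsCoeff (fun i => projAway (c 0) (c i.succ)) i j := by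
  have h : inner ℝ (c 0) (gramSchmidt ℝ c j.succ) = 0 := by
    rw [real_inner_comm, ← gramSchmidt_fin_zero c]
    exact gramSchmidt_orthogonal ℝ c (Fin.succ_ne_zero j)
  rw [gsCoeff, gsCoeff, projAway_apply (c 0) (c i.succ), ← gramSchmidt_succ, inner_sub_left,
    real_inner_smul_left, h, mul_zero, sub_zero]

theorem isHKZ_succ {c : Fin (n + 1) → E} : IsHKZ (n + 1) c ↔
    ‖c 0‖ = lambda1 (span ℤ (Set.range c)) ∧
      (∀ i j : Fin (n + 1), j < i → |gsCoeff c i j| ≤ 1 / 2) ∧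
      IsHKZ n (fun i : Fin n => projAway (c 0) (c i.succ)) := Iff.rfl

/-! ### Existence of HKZ bases -/

/-- The lattice obtained by projecting orthogonally to a primitive vector has a basis with one
vector less. -/
theorem exists_basis_projAway {b : Fin (n + 1) → E} (hb : LinearIndependent ℝ b) {v : E}
    (hv : v ∈ span ℤ (Set.range b)) (h0 : v ≠ 0)
    (hprim : ∀ x ∈ span ℤ (Set.range b), projAway v x = 0 → x ∈ span ℤ {v}) :
    ∃ c : Fin n → E, LinearIndependent ℝ c ∧
      span ℤ (Set.range c) =
        (span ℤ (Set.range b)).map ((projAway v).toLinearMap.restrictScalars ℤ) := by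
  set L := span ℤ (Set.range b)
  set P : E →ₗ[ℤ] E := (projAway v).toLinearMap.restrictScalars ℤ with hP
  have hPv : P v = 0 := projAway_self v
  have : Module.Finite ℤ L := Module.Finite.span_of_finite ℤ (Set.finite_range b)
  have htf : Module.IsTorsionFree ℤ E := Module.IsTorsionFree.trans ℝ
  have hbZ : LinearIndependent ℤ b := hb.restrict_scalars (fun x y h => by simpa using h)
  have hL : Module.finrank ℤ L = n + 1 := by
    simpa using finrank_span_eq_card hbZ
  set f : L →ₗ[ℤ] E := P.domRestrict L
  have hrange : LinearMap.range f = L.map P := LinearMap.range_domRestrict L P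
  have hker : (LinearMap.ker f).map L.subtype = span ℤ {v} := by
    ext x
    constructor
    · rintro ⟨y, hy, rfl⟩
      exact hprim y y.2 hy
    · intro hx
      obtain ⟨k, rfl⟩ := mem_span_singleton.1 hx
      refine ⟨⟨k • v, L.smul_mem k hv⟩, ?_, rfl⟩
      change P (k • v) = 0
      rw [map_zsmul, hPv, smul_zero]
  have hker1 : Module.finrank ℤ (LinearMap.ker f) = 1 := by
    have e := (Submodule.equivMapOfInjective L.subtype L.injective_subtype
      (LinearMap.ker f)).finrank_eq
    have hvZ : LinearIndependent ℤ (fun _ : Unit => v) :=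
      (LinearIndependent.of_subsingleton () h0 : LinearIndependent ℤ (fun _ : Unit => v))
    have h1 := finrank_span_eq_card hvZ
    rw [Set.range_const, Fintype.card_unit] at h1
    rw [e, hker, h1]
  have hfin : Module.finrank ℤ (L.map P) = n := by
    have h1 := Submodule.finrank_quotient_add_finrank (LinearMap.ker f)
    have h2 := f.quotKerEquivRange.finrank_eq
    rw [h2, hker1, hL, hrange] at h1
    omega
  have : Module.Finite ℤ (L.map P) := Module.Finite.map L P
  have : Module.Free ℤ (L.map P) := Module.free_of_finite_type_torsion_free'
  let β := Module.finBasisOfFinrankEq ℤ (L.map P) hfin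
  have hspan : span ℤ (Set.range fun i => (β i : E)) = L.map P := by
    have h1 : Set.range (fun i => (β i : E)) = (L.map P).subtype '' Set.range β := by
      rw [← Set.range_comp]; rfl
    rw [h1, ← map_span, β.span_eq, Submodule.map_top, Submodule.range_subtype]
  refine ⟨fun i => (β i : E), ?_, hspan⟩
  -- Together with `v` the new family spans a space of dimension `n + 1`.
  have hle : span ℝ (Set.range b) ≤
      span ℝ (Set.range fun i => (β i : E)) ⊔ span ℝ {v} := by
    rw [span_le]
    rintro _ ⟨i, rfl⟩
    have h1 : P (b i) ∈ span ℤ (Set.range fun i => (β i : E)) := by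
      rw [hspan]
      exact mem_map_of_mem (subset_span ⟨i, rfl⟩)
    have h2 : P (b i) ∈ span ℝ (Set.range fun i => (β i : E)) :=
      span_le_restrictScalars ℤ ℝ _ h1
    have h3 : b i - P (b i) ∈ span ℝ {v} := by
      change b i - projAway v (b i) ∈ _
      rw [projAway_apply, sub_sub_cancel]
      exact smul_mem _ _ (mem_span_singleton_self v)
    exact mem_sup.2 ⟨_, h2, _, h3, by abel⟩
  have : FiniteDimensional ℝ (span ℝ (Set.range fun i => (β i : E))) :=
    FiniteDimensional.span_of_finite ℝ (Set.finite_range _)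
  have h1 := Submodule.finrank_mono hle
  have h2 := Submodule.finrank_add_le_finrank_add_finrank
    (span ℝ (Set.range fun i => (β i : E))) (span ℝ {v})
  rw [finrank_span_eq_card hb, Fintype.card_fin] at h1
  rw [finrank_span_singleton h0] at h2
  have h3 := finrank_range_le_card (R := ℝ) (fun i => (β i : E))
  rw [Fintype.card_fin] at h3
  rw [linearIndependent_iff_card_eq_finrank_span, Fintype.card_fin]
  change Module.finrank ℝ (span ℝ (Set.range fun i => (β i : E))) ≤ n at h3
  change n = Module.finrank ℝ (span ℝ (Set.range fun i => (β i : E)))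
  omega

/-- A family that generates the same lattice as a linearly independent family of the same length
is linearly independent. -/
theorem linearIndependent_of_span_eq {b c : Fin n → E} (hb : LinearIndependent ℝ b)
    (h : span ℤ (Set.range c) = span ℤ (Set.range b)) : LinearIndependent ℝ c := by
  have h1 : span ℝ (Set.range c) = span ℝ (Set.range b) := by
    rw [← span_span_of_tower ℤ ℝ (Set.range c), h, span_span_of_tower]
  rw [linearIndependent_iff_card_eq_finrank_span] at hb ⊢
  rw [hb, Set.finrank, Set.finrank, h1]

/-- Every lattice has an HKZ basis. -/
theorem exists_isHKZ (n : ℕ) : ∀ b : Fin n → E, LinearIndependent ℝ b →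
    ∃ c : Fin n → E, span ℤ (Set.range c) = span ℤ (Set.range b) ∧ IsHKZ n c := by
  induction n with
  | zero => exact fun b hb => ⟨b, rfl, trivial⟩
  | succ n ih =>
    intro b hb
    obtain ⟨v, hv, h0, hmin⟩ := exists_shortest hb
    set L := span ℤ (Set.range b) with hL
    -- Rounding the coefficient along `v` makes any lattice vector size-reduced.
    have hround : ∀ x : E, x ∈ L → ∃ y ∈ L, projAway v y = projAway v x ∧
        |inner ℝ v y / ‖v‖ ^ 2| ≤ 1 / 2 := by
      intro x hx
      set k := round (inner ℝ v x / ‖v‖ ^ 2)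
      refine ⟨x - k • v, sub_mem hx (L.smul_mem k hv), ?_, ?_⟩
      · rw [map_sub, map_zsmul, projAway_self, smul_zero, sub_zero]
      · have h1 : ‖v‖ ^ 2 ≠ 0 := by positivity
        have h2 : inner ℝ v (x - k • v) / ‖v‖ ^ 2 = inner ℝ v x / ‖v‖ ^ 2 - k := by
          rw [inner_sub_right, ← Int.cast_smul_eq_zsmul ℝ, real_inner_smul_right,
            real_inner_self_eq_norm_sq]
          field_simp
        rw [h2]
        exact abs_sub_round _
    -- A shortest vector is primitive.
    have hprim : ∀ x ∈ L, projAway v x = 0 → x ∈ span ℤ {v} := by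
      intro x hx hx0
      obtain ⟨y, hy, hy1, hy2⟩ := hround x hx
      set k := round (inner ℝ v x / ‖v‖ ^ 2) with hk
      set μ := inner ℝ v x / ‖v‖ ^ 2 with hμ
      have hxv : x = μ • v := by
        rw [projAway_apply] at hx0
        exact sub_eq_zero.1 hx0
      have hz : x - k • v = 0 := by
        by_contra hne
        have h1 := lambda1_le (sub_mem hx (L.smul_mem k hv)) hne
        rw [← hmin] at h1
        have h2 : x - k • v = (μ - k) • v := by
          rw [sub_smul, ← hxv, Int.cast_smul_eq_zsmul]
        rw [h2, norm_smul, Real.norm_eq_abs] at h1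
        have h3 : |μ - k| ≤ 1 / 2 := abs_sub_round _
        have h4 : 0 < ‖v‖ := norm_pos_iff.2 h0
        nlinarith
      rw [sub_eq_zero.1 hz]
      exact mem_span_singleton.2 ⟨k, rfl⟩
    -- An HKZ basis of the projected lattice is lifted to size-reduced vectors of the lattice.
    obtain ⟨b', hb', hspan'⟩ := exists_basis_projAway hb hv h0 hprim
    obtain ⟨c', hc', hkz'⟩ := ih b' hb'
    have hlift : ∀ i, ∃ y ∈ L, projAway v y = c' i ∧ |inner ℝ v y / ‖v‖ ^ 2| ≤ 1 / 2 := by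
      intro i
      have h1 : c' i ∈ span ℤ (Set.range b') := by
        rw [← hc']
        exact subset_span ⟨i, rfl⟩
      rw [hspan'] at h1
      obtain ⟨x, hx, hxc⟩ := h1
      obtain ⟨y, hy, hy1, hy2⟩ := hround x hx
      exact ⟨y, hy, hy1.trans hxc, hy2⟩
    choose y hyL hyc hymu using hlift
    set c : Fin (n + 1) → E := Fin.cons v y with hc
    have hspan : span ℤ (Set.range c) = L := by
      apply le_antisymm
      · rw [span_le]
        rintro _ ⟨i, rfl⟩
        induction i using Fin.cases with
        | zero => exact hv
        | succ i => exact hyL i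
      · intro x hx
        have h1 : projAway v x ∈ span ℤ (Set.range c') := by
          rw [hc', hspan']
          exact mem_map_of_mem (f := (projAway v).toLinearMap.restrictScalars ℤ) hx
        obtain ⟨z, hz⟩ := (mem_span_range_iff_exists_fun ℤ).1 h1
        have h2 : x - ∑ i, z i • y i ∈ span ℤ {v} := by
          refine hprim _ (sub_mem hx (sum_mem fun i _ => L.smul_mem _ (hyL i))) ?_
          rw [map_sub, map_sum, ← hz]
          simp only [map_zsmul, hyc, sub_self]
        have h3 : span ℤ {v} ≤ span ℤ (Set.range c) :=
          span_mono (Set.singleton_subset_iff.2 ⟨0, rfl⟩)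
        have h4 : ∑ i, z i • y i ∈ span ℤ (Set.range c) :=
          sum_mem fun i _ => smul_mem _ _ (subset_span ⟨i.succ, rfl⟩)
        simpa using add_mem (h3 h2) h4
    refine ⟨c, hspan, isHKZ_succ.2 ⟨?_, ?_, ?_⟩⟩
    · rw [hspan]; exact hmin
    · intro i j hij
      induction i using Fin.cases with
      | zero => exact absurd hij (Fin.not_lt_zero j)
      | succ i =>
        induction j using Fin.cases with
        | zero =>
          rw [gsCoeff, gramSchmidt_fin_zero, real_inner_comm]
          exact hymu i
        | succ j =>
          rw [gsCoeff_succ]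
          have h1 : (fun i : Fin n => projAway (c 0) (c i.succ)) = c' := funext hyc
          rw [h1]
          cases n with
          | zero => exact i.elim0
          | succ n => exact (isHKZ_succ.1 hkz').2.1 i j (Fin.succ_lt_succ_iff.1 hij)
    · have h1 : (fun i : Fin n => projAway (c 0) (c i.succ)) = c' := funext hyc
      rw [h1]
      exact hkz'

/-! ### Properties of HKZ bases -/

theorem IsHKZ.abs_gsCoeff_le {c : Fin n → E} (h : IsHKZ n c) {i j : Fin n} (hij : j < i) :
    |gsCoeff c i j| ≤ 1 / 2 := by
  cases n with
  | zero => exact i.elim0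
  | succ n => exact (isHKZ_succ.1 h).2.1 i j hij

/-- Changing signs in a family changes the signs of its Gram-Schmidt vectors. -/
theorem gramSchmidt_units_smul (ε : Fin n → ℤˣ) (c : Fin n → E) (j : Fin n) :
    gramSchmidt ℝ (fun i => ε i • c i) j = ε j • gramSchmidt ℝ c j := by
  have hs : span ℝ ((fun i => ε i • c i) '' Set.Iio j) = span ℝ (c '' Set.Iio j) := by
    apply le_antisymm
    · rw [span_le]
      rintro _ ⟨i, hi, rfl⟩
      rcases Int.units_eq_one_or (ε i) with h | h
      · simpa [h] using mem_span_image (f := c) hi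
      · simpa [h] using mem_span_image (f := c) hi
    · rw [span_le]
      rintro _ ⟨i, hi, rfl⟩
      have := mem_span_image (f := fun i => ε i • c i) hi
      rcases Int.units_eq_one_or (ε i) with h | h
      · simpa [h] using this
      · simpa [h] using this
  refine (gramSchmidt_unique ?_ ?_).symm
  · rw [hs, ← smul_sub]
    have := gramSchmidt_sub_mem c j
    rcases Int.units_eq_one_or (ε j) with h | h
    · simpa [h] using this
    · rw [h, Units.neg_smul, one_smul]
      exact neg_mem this
  · intro i hi
    have : inner ℝ (c i) (gramSchmidt ℝ c j) = 0 := by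
      rw [real_inner_comm]
      exact gramSchmidt_inv_triangular ℝ c hi
    rcases Int.units_eq_one_or (ε i) with h | h <;> rcases Int.units_eq_one_or (ε j) with h' | h' <;>
      simp [h, h', this]

omit [InnerProductSpace ℝ E] in
theorem span_units_smul (ε : Fin n → ℤˣ) (c : Fin n → E) :
    span ℤ (Set.range fun i => ε i • c i) = span ℤ (Set.range c) := by
  apply le_antisymm
  · rw [span_le]
    rintro _ ⟨i, rfl⟩
    have : c i ∈ span ℤ (Set.range c) := subset_span ⟨i, rfl⟩
    rcases Int.units_eq_one_or (ε i) with h | h <;> simpa [h] using this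
  · rw [span_le]
    rintro _ ⟨i, rfl⟩
    have : ε i • c i ∈ span ℤ (Set.range fun i => ε i • c i) := subset_span ⟨i, rfl⟩
    rcases Int.units_eq_one_or (ε i) with h | h <;> simpa [h] using this

theorem projAway_units_smul (ε : ℤˣ) (v : E) : projAway (ε • v) = projAway v := by
  rcases Int.units_eq_one_or ε with h | h
  · simp [h]
  · ext x
    simp [h, projAway_apply, neg_div]

/-- Changing the signs of its vectors does not affect that a basis is an HKZ basis. -/
theorem IsHKZ.units_smul : ∀ {n : ℕ} {c : Fin n → E} (_ : IsHKZ n c) (ε : Fin n → ℤˣ),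
    IsHKZ n (fun i => ε i • c i) := by
  intro n
  induction n with
  | zero => exact fun _ _ => trivial
  | succ n ih =>
    intro c h ε
    obtain ⟨h1, h2, h3⟩ := isHKZ_succ.1 h
    refine isHKZ_succ.2 ⟨?_, ?_, ?_⟩
    · rw [span_units_smul, ← h1]
      rcases Int.units_eq_one_or (ε 0) with h | h <;> simp [h]
    · intro i j hij
      refine le_trans (le_of_eq ?_) (h2 i j hij)
      rw [gsCoeff, gsCoeff, gramSchmidt_units_smul]
      rcases Int.units_eq_one_or (ε i) with h | h <;>
        rcases Int.units_eq_one_or (ε j) with h' | h' <;> simp [h, h', neg_div]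
    · have h4 := ih h3 (fun i => ε i.succ)
      convert h4 using 2 with i
      rw [projAway_units_smul]
      rcases Int.units_eq_one_or (ε i.succ) with h | h <;> simp [h]

/-- In an HKZ basis the `i`-th Gram-Schmidt vector is a shortest nonzero vector of the lattice
projected orthogonally to the previous ones. -/
theorem IsHKZ.norm_gramSchmidt_le : ∀ {n : ℕ} {c : Fin n → E} (_ : IsHKZ n c) (i : Fin n) {x : E}
    (_ : x ∈ span ℤ (Set.range c)) {w : E} (_ : x - w ∈ span ℝ (c '' Set.Iio i))
    (_ : ∀ k < i, inner ℝ (c k) w = 0), w ≠ 0 → ‖gramSchmidt ℝ c i‖ ≤ ‖w‖ := by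
  intro n
  induction n with
  | zero => exact fun _ i => i.elim0
  | succ n ih =>
    intro c h i x hx w hw1 hw2 hw0
    obtain ⟨h1, h2, h3⟩ := isHKZ_succ.1 h
    induction i using Fin.cases with
    | zero =>
      have : Set.Iio (0 : Fin (n + 1)) = ∅ := by ext k; simp
      rw [this, Set.image_empty, span_empty, mem_bot, sub_eq_zero] at hw1
      rw [gramSchmidt_fin_zero, h1, ← hw1]
      exact lambda1_le hx (hw1 ▸ hw0)
    | succ i =>
      rw [gramSchmidt_succ]
      have hw : projAway (c 0) w = w := by
        rw [projAway_apply, hw2 0 (Fin.succ_pos i), zero_div, zero_smul, sub_zero]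
      refine ih h3 i (x := projAway (c 0) x) ?_ ?_ ?_ hw0
      · obtain ⟨z, rfl⟩ := (mem_span_range_iff_exists_fun ℤ).1 hx
        rw [map_sum, Fin.sum_univ_succ, map_zsmul, projAway_self, smul_zero, zero_add]
        exact sum_mem fun k _ => by
          rw [map_zsmul]; exact smul_mem _ _ (subset_span ⟨k, rfl⟩)
      · rw [← hw, ← map_sub]
        have h4 : ∀ y ∈ span ℝ (c '' Set.Iio i.succ), projAway (c 0) y ∈
            span ℝ ((fun k : Fin n => projAway (c 0) (c k.succ)) '' Set.Iio i) := by
          intro y hy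
          induction hy using span_induction with
          | mem y hy =>
            obtain ⟨k, hk, rfl⟩ := hy
            induction k using Fin.cases with
            | zero => rw [projAway_self]; exact zero_mem _
            | succ k =>
              exact mem_span_image (f := fun k : Fin n => projAway (c 0) (c k.succ))
                (Fin.succ_lt_succ_iff.1 hk)
          | zero => rw [map_zero]; exact zero_mem _
          | add y z _ _ hy hz => rw [map_add]; exact add_mem hy hz
          | smul r y _ hy => rw [map_smul]; exact smul_mem _ _ hy
        exact h4 _ hw1
      · intro k hk
        rw [projAway_apply, inner_sub_left, real_inner_smul_left, hw2 0 (Fin.succ_pos i),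
          hw2 k.succ (Fin.succ_lt_succ_iff.2 hk), mul_zero, sub_zero]

end Lattice

end CVPP

namespace CVPP

open Finset

/-! ### Orthogonal systems and integral combinations -/

section Plane
variable {m : ℕ}

/-- Coefficient of `x` along `u j`. -/
def coef (u : ℕ → Fin m → ℚ) (j : ℕ) (x : Fin m → ℚ) : ℚ := (x ⬝ᵥ u j) / (u j ⬝ᵥ u j)

/-- Orthogonal projection to the span of the vectors `u j` for `lo ≤ j < hi`. -/
def proj (u : ℕ → Fin m → ℚ) (lo hi : ℕ) : (Fin m → ℚ) →ₗ[ℚ] (Fin m → ℚ) where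
  toFun x := ∑ l ∈ Ico lo hi, coef u l x • u l
  map_add' x y := by
    rw [← sum_add_distrib]
    exact sum_congr rfl fun l _ => by rw [coef, add_dotProduct, add_div, add_smul]; rfl
  map_smul' c x := by
    rw [RingHom.id_apply, smul_sum]
    exact sum_congr rfl fun l _ => by
      rw [coef, smul_dotProduct, smul_eq_mul, mul_div_assoc, mul_smul]; rfl

theorem proj_apply (u : ℕ → Fin m → ℚ) (lo hi : ℕ) (x : Fin m → ℚ) :
    proj u lo hi x = ∑ l ∈ Ico lo hi, coef u l x • u l := rfl

/-- Nearest-plane rounding: for `j` from `hi - 1` down to `lo`, the multiple of `b j` is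
subtracted that makes the coefficient along `u j` at most `1 / 2`. -/
def reduce (b u : ℕ → Fin m → ℚ) (lo : ℕ) : ℕ → (Fin m → ℚ) → (Fin m → ℚ)
  | 0, r => r
  | k + 1, r => if lo ≤ k then reduce b u lo k (r - (nearest (coef u k r) : ℚ) • b k) else r

/-- Integral combination of the vectors `b j` for `lo ≤ j < hi`. -/
def comb (b : ℕ → Fin m → ℚ) (lo hi : ℕ) (z : ℕ → ℤ) : Fin m → ℚ :=
  ∑ k ∈ Ico lo hi, (z k : ℚ) • b k

/-- The first `n` vectors of `u` are the Gram-Schmidt orthogonalisation of those of `b`, which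
are linearly independent. -/
structure IsGS (n : ℕ) (b u : ℕ → Fin m → ℚ) : Prop where
  pos : ∀ j < n, 0 < u j ⬝ᵥ u j
  orth : ∀ j < n, ∀ k < n, j ≠ k → u j ⬝ᵥ u k = 0
  expand : ∀ j < n, b j = u j + ∑ k ∈ range j, coef u k (b j) • u k

variable {b u : ℕ → Fin m → ℚ} {n lo hi : ℕ}

theorem comb_add (z w : ℕ → ℤ) : comb b lo hi z + comb b lo hi w = comb b lo hi (z + w) := by
  rw [comb, comb, comb, ← sum_add_distrib]
  exact sum_congr rfl fun k _ => by simp [add_smul]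

theorem comb_sub (z w : ℕ → ℤ) : comb b lo hi z - comb b lo hi w = comb b lo hi (z - w) := by
  rw [comb, comb, comb, ← sum_sub_distrib]
  exact sum_congr rfl fun k _ => by simp [sub_smul]

theorem comb_split {mid : ℕ} (h1 : lo ≤ mid) (h2 : mid ≤ hi) (z : ℕ → ℤ) :
    comb b lo mid z + comb b mid hi z = comb b lo hi z :=
  sum_Ico_consecutive _ h1 h2

theorem comb_zero_right : comb b lo hi 0 = 0 := by simp [comb]

/-- A combination over a part of the index range is one over the whole range. -/
theorem comb_extend {lo' hi' : ℕ} (h1 : lo' ≤ lo) (h2 : hi ≤ hi') (z : ℕ → ℤ) :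
    ∃ w, comb b lo hi z = comb b lo' hi' w := by
  refine ⟨fun k => if lo ≤ k ∧ k < hi then z k else 0, ?_⟩
  rw [comb, comb]
  have h3 : Ico lo hi ⊆ Ico lo' hi' := Ico_subset_Ico h1 h2
  rw [← sum_subset h3 (fun k _ hk => ?_)]
  · refine sum_congr rfl fun k hk => ?_
    rw [if_pos (mem_Ico.1 hk)]
  · rw [mem_Ico] at hk
    rw [if_neg hk]
    simp

theorem coef_comb (j : ℕ) (z : ℕ → ℤ) :
    coef u j (comb b lo hi z) = ∑ k ∈ Ico lo hi, (z k : ℚ) * coef u j (b k) := by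
  rw [coef, comb, sum_dotProduct, sum_div]
  exact sum_congr rfl fun k _ => by rw [smul_dotProduct, smul_eq_mul, mul_div_assoc, coef]

theorem coef_sub (j : ℕ) (x y : Fin m → ℚ) : coef u j (x - y) = coef u j x - coef u j y := by
  rw [coef, sub_dotProduct, sub_div]; rfl

theorem coef_add (j : ℕ) (x y : Fin m → ℚ) : coef u j (x + y) = coef u j x + coef u j y := by
  rw [coef, add_dotProduct, add_div]; rfl

theorem coef_smul (j : ℕ) (c : ℚ) (x : Fin m → ℚ) : coef u j (c • x) = c * coef u j x := by
  rw [coef, smul_dotProduct, smul_eq_mul, mul_div_assoc]; rfl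

section GS
variable (H : IsGS n b u)
include H

theorem IsGS.coef_self {j : ℕ} (hj : j < n) : coef u j (u j) = 1 :=
  div_self (H.pos j hj).ne'

theorem IsGS.coef_ne {j k : ℕ} (hj : j < n) (hk : k < n) (hjk : j ≠ k) : coef u j (u k) = 0 := by
  rw [coef, H.orth k hk j hj hjk.symm, zero_div]

theorem IsGS.coef_sum {j : ℕ} (hj : j < n) {t : Finset ℕ} (ht : ∀ k ∈ t, k < n) (c : ℕ → ℚ) :
    coef u j (∑ k ∈ t, c k • u k) = if j ∈ t then c j else 0 := by
  have : coef u j (∑ k ∈ t, c k • u k) = ∑ k ∈ t, c k * coef u j (u k) := by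
    rw [coef, sum_dotProduct, sum_div]
    exact sum_congr rfl fun k _ => by rw [smul_dotProduct, smul_eq_mul, mul_div_assoc, coef]
  rw [this]
  split_ifs with h
  · rw [sum_eq_single_of_mem j h fun k hk hkj => by rw [H.coef_ne hj (ht k hk) hkj.symm, mul_zero],
      H.coef_self hj, mul_one]
  · exact sum_eq_zero fun k hk => by
      rw [H.coef_ne hj (ht k hk) (fun e => h (e ▸ hk)), mul_zero]

theorem IsGS.coef_basis_self {j : ℕ} (hj : j < n) : coef u j (b j) = 1 := by
  rw [H.expand j hj, coef_add, H.coef_self hj, H.coef_sum hj (fun k hk => by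
    have := mem_range.1 hk; omega)]
  simp

theorem IsGS.coef_basis_lt {j k : ℕ} (hk : k < n) (hjk : j < k) : coef u k (b j) = 0 := by
  rw [H.expand j (by omega), coef_add, H.coef_ne hk (by omega) (by omega),
    H.coef_sum hk (fun i hi => by have := mem_range.1 hi; omega)]
  rw [if_neg (by simp; omega), zero_add]

theorem IsGS.coef_proj (hhi : hi ≤ n) {j : ℕ} (hj : j < n) (x : Fin m → ℚ) :
    coef u j (proj u lo hi x) = if lo ≤ j ∧ j < hi then coef u j x else 0 := by
  rw [proj_apply, H.coef_sum hj (fun k hk => by have := (mem_Ico.1 hk).2; omega)]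
  simp only [mem_Ico]

theorem IsGS.coef_comb_ge {j : ℕ} (hj : j < n) (hhi : hi ≤ j) (z : ℕ → ℤ) :
    coef u j (comb b lo hi z) = 0 := by
  rw [coef_comb]
  exact sum_eq_zero fun k hk => by
    rw [H.coef_basis_lt hj (by have := (mem_Ico.1 hk).2; omega), mul_zero]

theorem IsGS.proj_comb_eq_zero (hhi : hi ≤ n) (z : ℕ → ℤ) : proj u lo hi (comb b 0 lo z) = 0 := by
  rw [proj_apply]
  exact sum_eq_zero fun j hj => by
    have := mem_Ico.1 hj
    rw [H.coef_comb_ge (by omega) this.1, zero_smul]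

theorem IsGS.dot_smul {j : ℕ} (hj : j < n) (x : Fin m → ℚ) :
    x ⬝ᵥ u j = coef u j x * (u j ⬝ᵥ u j) := by
  rw [coef, div_mul_cancel₀ _ (H.pos j hj).ne']

theorem IsGS.dot_proj (hhi : hi ≤ n) (x y : Fin m → ℚ) :
    x ⬝ᵥ proj u lo hi y = ∑ l ∈ Ico lo hi, coef u l x * coef u l y * (u l ⬝ᵥ u l) := by
  rw [proj_apply, dotProduct_sum]
  refine sum_congr rfl fun l hl => ?_
  rw [dotProduct_smul, H.dot_smul (by have := (mem_Ico.1 hl).2; omega), smul_eq_mul]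
  ring

theorem IsGS.sq_proj (hhi : hi ≤ n) (x : Fin m → ℚ) :
    proj u lo hi x ⬝ᵥ proj u lo hi x = ∑ l ∈ Ico lo hi, coef u l x ^ 2 * (u l ⬝ᵥ u l) := by
  rw [H.dot_proj hhi]
  refine sum_congr rfl fun l hl => ?_
  have := mem_Ico.1 hl
  rw [H.coef_proj hhi (by omega), if_pos this, sq]

/-- Pythagoras. -/
theorem IsGS.sq_eq (hhi : hi ≤ n) (x : Fin m → ℚ) :
    x ⬝ᵥ x = ∑ l ∈ Ico lo hi, coef u l x ^ 2 * (u l ⬝ᵥ u l) +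
      (x - proj u lo hi x) ⬝ᵥ (x - proj u lo hi x) := by
  rw [sub_dotProduct, dotProduct_sub, dotProduct_sub, H.sq_proj hhi,
    dotProduct_comm (proj u lo hi x) x, H.dot_proj hhi]
  simp only [← sq]
  ring

theorem IsGS.proj_basis {j : ℕ} (hj : j < hi) (hhi : hi ≤ n) : proj u 0 hi (b j) = b j := by
  conv_rhs => rw [H.expand j (by omega)]
  rw [proj_apply, ← sum_Ico_consecutive _ (Nat.zero_le (j + 1)) (show j + 1 ≤ hi by omega),
    sum_Ico_succ_top (Nat.zero_le j), H.coef_basis_self (by omega), one_smul, add_comm (_ + _),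
    sum_eq_zero (s := Ico (j + 1) hi), zero_add, add_comm, Nat.Ico_zero_eq_range]
  intro k hk
  have := mem_Ico.1 hk
  rw [H.coef_basis_lt (by omega) (by omega), zero_smul]

theorem IsGS.proj_comb_self {e : ℕ} (he : e ≤ hi) (hhi : hi ≤ n) (z : ℕ → ℤ) :
    proj u 0 hi (comb b lo e z) = comb b lo e z := by
  rw [comb, map_sum]
  refine sum_congr rfl fun k hk => ?_
  have := mem_Ico.1 hk
  rw [map_smul, H.proj_basis (by omega) hhi]

/-! ### Nearest-plane rounding -/

omit H in
theorem nearest_intCast (z : ℤ) : nearest (z : ℚ) = z := by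
  rw [nearest, Int.floor_intCast_add]
  norm_num

omit H in
theorem abs_sub_nearest (r : ℚ) : |r - nearest r| ≤ 1 / 2 := by
  have h1 := Int.floor_le (r + 1 / 2)
  have h2 := Int.lt_floor_add_one (r + 1 / 2)
  rw [nearest, abs_le]
  constructor <;> linarith

omit H in
theorem reduce_of_le (h : hi ≤ lo) (r : Fin m → ℚ) : reduce b u lo hi r = r := by
  cases hi with
  | zero => rfl
  | succ k => rw [reduce, if_neg (by omega)]

omit H in
theorem reduce_eq_sub_comb (r : Fin m → ℚ) : ∃ z, reduce b u lo hi r = r - comb b lo hi z := by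
  induction hi generalizing r with
  | zero => exact ⟨0, by simp [reduce, comb_zero_right]⟩
  | succ k ih =>
    rw [reduce]
    split_ifs with h
    · obtain ⟨z, hz⟩ := ih (r - (nearest (coef u k r) : ℚ) • b k)
      refine ⟨fun j => if j = k then nearest (coef u k r) else z j, ?_⟩
      rw [hz, comb, comb, sum_Ico_succ_top h, if_pos rfl]
      have : ∑ j ∈ Ico lo k, (z j : ℚ) • b j =
          ∑ j ∈ Ico lo k, ((if j = k then nearest (coef u k r) else z j : ℤ) : ℚ) • b j := by
        refine sum_congr rfl fun j hj => ?_
        rw [if_neg (by have := (mem_Ico.1 hj).2; omega)]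
      rw [this]
      abel
    · exact ⟨0, by rw [comb_zero_right, sub_zero]⟩

theorem IsGS.coef_reduce_ge {j : ℕ} (hj : j < n) (hhi : hi ≤ j) (r : Fin m → ℚ) :
    coef u j (reduce b u lo hi r) = coef u j r := by
  obtain ⟨z, hz⟩ := reduce_eq_sub_comb (b := b) (u := u) (lo := lo) (hi := hi) r
  rw [hz, coef_sub, H.coef_comb_ge hj hhi, sub_zero]

/-- The rounded coefficients are at most `1 / 2`: the later steps do not affect them any more. -/
theorem IsGS.abs_coef_reduce (hhi : hi ≤ n) {j : ℕ} (h1 : lo ≤ j) (h2 : j < hi)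
    (r : Fin m → ℚ) : |coef u j (reduce b u lo hi r)| ≤ 1 / 2 := by
  induction hi generalizing r with
  | zero => omega
  | succ k ih =>
    rw [reduce, if_pos (by omega)]
    rcases Nat.lt_or_ge j k with h | h
    · exact ih (by omega) h _
    · obtain rfl : j = k := by omega
      rw [H.coef_reduce_ge (by omega) le_rfl, coef_sub, coef_smul, H.coef_basis_self (by omega),
        mul_one]
      exact abs_sub_nearest _

/-- Rounding recovers the coefficients of a lattice vector from its projection. -/
theorem IsGS.reduce_exact (hhi : hi ≤ n) {r : Fin m → ℚ} {z : ℕ → ℤ}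
    (h : ∀ j, lo ≤ j → j < hi → coef u j r = coef u j (comb b lo hi z)) :
    reduce b u lo hi r = r - comb b lo hi z := by
  induction hi generalizing r with
  | zero => simp [reduce, comb]
  | succ k ih =>
    rw [reduce]
    split_ifs with hk
    · have h1 : comb b lo (k + 1) z = comb b lo k z + (z k : ℚ) • b k := by
        rw [comb, sum_Ico_succ_top hk]; rfl
      have h2 : coef u k r = z k := by
        rw [h k hk (by omega), h1, coef_add, H.coef_comb_ge (by omega) le_rfl, coef_smul,
          H.coef_basis_self (by omega), zero_add, mul_one]
      rw [h2, nearest_intCast, ih (by omega), h1]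
      · abel
      · intro j hj1 hj2
        rw [coef_sub, h j hj1 (by omega), h1, coef_add, add_sub_cancel_right]
    · rw [comb, Ico_eq_empty (by omega), sum_empty, sub_zero]

/-- Combinations of the vectors of a block are determined by their projections. -/
theorem IsGS.comb_eq_zero (hhi : hi ≤ n) {z : ℕ → ℤ} (h : proj u lo hi (comb b lo hi z) = 0) :
    comb b lo hi z = 0 := by
  have h0 : ∀ j, coef u j (0 : Fin m → ℚ) = 0 := fun j => by simp [coef]
  have h1 := H.reduce_exact (r := 0) (z := z) hhi fun j hj1 hj2 => by
    have h2 := H.coef_proj (lo := lo) hhi (show j < n by omega) (comb b lo hi z)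
    rw [h, if_pos ⟨hj1, hj2⟩] at h2
    exact h2
  have h2 := H.reduce_exact (r := 0) (z := 0) (lo := lo) hhi fun j hj1 hj2 => by
    rw [comb_zero_right]
  rw [h2, comb_zero_right] at h1
  simpa using h1.symm

end GS

/-! ### Norms -/

/-- Euclidean norm of a rational vector. -/
noncomputable def nrm (x : Fin m → ℚ) : ℝ := ‖toReal x‖

theorem nrm_nonneg (x : Fin m → ℚ) : 0 ≤ nrm x := norm_nonneg _

theorem inner_toReal (x y : Fin m → ℚ) : inner ℝ (toReal x) (toReal y) = ((x ⬝ᵥ y : ℚ) : ℝ) := by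
  simp [toReal, PiLp.inner_apply, dotProduct, mul_comm]

theorem nrm_sq (x : Fin m → ℚ) : nrm x ^ 2 = ((x ⬝ᵥ x : ℚ) : ℝ) := by
  rw [nrm, ← real_inner_self_eq_norm_sq, inner_toReal]

theorem toReal_add (x y : Fin m → ℚ) : toReal (x + y) = toReal x + toReal y := by
  ext i; simp [toReal]

theorem toReal_sub (x y : Fin m → ℚ) : toReal (x - y) = toReal x - toReal y := by
  ext i; simp [toReal]

theorem toReal_smul (c : ℚ) (x : Fin m → ℚ) : toReal (c • x) = (c : ℝ) • toReal x := by
  ext i; simp [toReal]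

theorem toReal_zsmul (c : ℤ) (x : Fin m → ℚ) : toReal ((c : ℚ) • x) = c • toReal x := by
  ext i; simp [toReal]

theorem toReal_zero : toReal (0 : Fin m → ℚ) = 0 := by
  ext i; simp [toReal]

theorem toReal_sum {ι : Type*} (t : Finset ι) (f : ι → Fin m → ℚ) :
    toReal (∑ i ∈ t, f i) = ∑ i ∈ t, toReal (f i) := by
  ext k; simp [toReal]

theorem toReal_injective : Function.Injective (toReal (m := m)) := by
  intro x y h
  funext i
  have := congrArg (fun v : EuclideanSpace ℝ (Fin m) => v i) h
  simpa [toReal] using this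

theorem nrm_sub_le (x y z : Fin m → ℚ) : nrm (x - z) ≤ nrm (x - y) + nrm (y - z) := by
  rw [nrm, nrm, nrm, toReal_sub, toReal_sub, toReal_sub]
  exact norm_sub_le_norm_sub_add_norm_sub _ _ _

theorem nrm_sub_comm (x y : Fin m → ℚ) : nrm (x - y) = nrm (y - x) := by
  rw [nrm, nrm, toReal_sub, toReal_sub, norm_sub_rev]

end Plane

end CVPP

namespace CVPP

open Finset

/-! ### Blocks of a basis -/

section Flagged

/-- The flagged indices in the interval `[j, n)`, in increasing order. -/
def flagged (F : ℕ → Bool) (n j : ℕ) : List ℕ := (List.range' j (n - j)).filter F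

/-- The end of the block that starts at `j`: the `(h + 1)`-st flagged index after `j`, or `n`
if there is none. -/
def blockEnd (F : ℕ → Bool) (h n j : ℕ) : ℕ := (flagged F n (j + 1)).getD h n

variable {F : ℕ → Bool} {h n : ℕ}

theorem flagged_self : flagged F n n = [] := by simp [flagged]

theorem flagged_of_lt {j : ℕ} (hj : j < n) :
    flagged F n j = if F j then j :: flagged F n (j + 1) else flagged F n (j + 1) := by
  obtain ⟨k, rfl⟩ : ∃ k, n = j + 1 + k := ⟨n - (j + 1), by omega⟩
  have h1 : j + 1 + k - j = k + 1 := by omega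
  have h2 : j + 1 + k - (j + 1) = k := by omega
  rw [flagged, flagged, h1, h2, List.range'_succ, List.filter_cons]

theorem mem_flagged {j i : ℕ} : i ∈ flagged F n j ↔ (j ≤ i ∧ i < n) ∧ F i = true := by
  rw [flagged, List.mem_filter, List.mem_range'_1]
  constructor
  · rintro ⟨h1, h2⟩; exact ⟨by omega, h2⟩
  · rintro ⟨h1, h2⟩; exact ⟨by omega, h2⟩

/-- If some quantity grows by a factor `G` from each flagged index to later ones, then it grows
by `G ^ r` over `r` flagged indices. -/
theorem flagged_getD {w : ℕ → ℝ} {G : ℝ} (hG : 0 ≤ G)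
    (hw : ∀ i k, i < k → k < n → F i = true → F k = true → G * w i ≤ w k) (j : ℕ) (hj : j ≤ n) :
    ∀ c : ℝ, (∀ i, j ≤ i → i < n → F i = true → c ≤ w i) → ∀ r,
      (flagged F n j).getD r n = n ∨ (j ≤ (flagged F n j).getD r n ∧
        (flagged F n j).getD r n < n ∧ F ((flagged F n j).getD r n) = true ∧
        G ^ r * c ≤ w ((flagged F n j).getD r n)) := by
  induction hj using Nat.decreasingInduction with
  | self => intro c _ r; left; simp [flagged_self]
  | of_succ j hj ih =>
    intro c hc r
    rw [flagged_of_lt hj]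
    split_ifs with hF
    · cases r with
      | zero => right; simpa [hF, hj] using hc j le_rfl hj hF
      | succ r =>
        rw [List.getD_cons_succ]
        rcases ih (G * c) (fun i hi hin hFi => le_trans
          (mul_le_mul_of_nonneg_left (hc j le_rfl hj hF) hG) (hw j i hi hin hF hFi)) r with h | h
        · exact Or.inl h
        · refine Or.inr ⟨by omega, h.2.1, h.2.2.1, ?_⟩
          rw [pow_succ, mul_assoc]
          exact h.2.2.2
    · rcases ih c (fun i hi hin hFi => hc i (by omega) hin hFi) r with h | h
      · exact Or.inl h
      · exact Or.inr ⟨by omega, h.2⟩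

theorem blockEnd_bounds {j : ℕ} (hj : j < n) :
    j < blockEnd F h n j ∧ blockEnd F h n j ≤ n := by
  rw [blockEnd, List.getD_eq_getElem?_getD]
  by_cases hh : h < (flagged F n (j + 1)).length
  · rw [List.getElem?_eq_getElem hh, Option.getD_some]
    have := (mem_flagged.1 (List.getElem_mem hh)).1
    omega
  · rw [List.getElem?_eq_none (by omega), Option.getD_none]
    omega

/-- The blocks have total length at most `n * (h + 1) - h`: passing a flagged index replaces the
end of its block by the index itself in the window of the next `h + 1` flagged indices, so the sum
of the block lengths telescopes. -/
theorem sum_blocks (hn : 1 ≤ n) (h0 : F 0 = true) :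
    ((flagged F n 0).map fun i => blockEnd F h n i - i).sum + h ≤ n * (h + 1) := by
  -- `W j` is the sum of the first `h + 1` flagged indices from `j` on, filled up by `n`.
  let W : ℕ → ℕ := fun j => ∑ r ∈ range (h + 1), (flagged F n j).getD r n
  have key : ∀ j ≤ n, ((flagged F n j).map fun i => blockEnd F h n i - i).sum + W j =
      n * (h + 1) := by
    intro j hj
    induction hj using Nat.decreasingInduction with
    | self => simp [W, flagged_self, mul_comm]
    | of_succ j hj ih =>
      by_cases hF : F j = true
      · have h1 : W j + blockEnd F h n j = j + W (j + 1) := by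
          simp only [W]
          rw [flagged_of_lt hj, if_pos hF, sum_range_succ', sum_range_succ]
          simp only [List.getD_cons_succ, List.getD_cons_zero, blockEnd]
          ring
        have h2 := blockEnd_bounds (F := F) (h := h) hj
        rw [flagged_of_lt hj, if_pos hF, List.map_cons, List.sum_cons]
        omega
      · have h1 : flagged F n j = flagged F n (j + 1) := by rw [flagged_of_lt hj, if_neg hF]
        simp only [W] at ih ⊢
        rw [h1]
        exact ih
  have h1 : h ≤ W 0 := by
    simp only [W]
    rw [flagged_of_lt hn, if_pos h0, sum_range_succ']
    calc h = ∑ r ∈ range h, 1 := by simp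
      _ ≤ ∑ r ∈ range h, (0 :: flagged F n 1).getD (r + 1) n := by
        refine sum_le_sum fun r _ => ?_
        rw [List.getD_cons_succ]
        have := (blockEnd_bounds (F := F) (h := r) hn).1
        rw [blockEnd] at this
        exact this
      _ ≤ _ := Nat.le_add_right _ _
  have := key 0 (Nat.zero_le n)
  omega

end Flagged

section Leader
variable {m : ℕ}

/-- The last index up to `j` at which a new block starts: a block starts at `0` and whenever the
length of the Gram-Schmidt vector exceeds that at the start of the previous block by more than a
factor `G`. -/
noncomputable def leader (G : ℝ) (u : ℕ → Fin m → ℚ) : ℕ → ℕ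
  | 0 => 0
  | j + 1 => open Classical in
    if G * nrm (u (leader G u j)) < nrm (u (j + 1)) then j + 1 else leader G u j

open Classical in
/-- Whether a block starts at `j`. -/
noncomputable def isLeader (G : ℝ) (u : ℕ → Fin m → ℚ) (j : ℕ) : Bool :=
  decide (leader G u j = j)

variable {G : ℝ} {u : ℕ → Fin m → ℚ}

theorem isLeader_iff {j : ℕ} : isLeader G u j = true ↔ leader G u j = j := by simp [isLeader]

theorem isLeader_zero : isLeader G u 0 = true := isLeader_iff.2 rfl

theorem leader_le (j : ℕ) : leader G u j ≤ j := by
  induction j with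
  | zero => exact le_rfl
  | succ j ih => rw [leader]; split_ifs <;> omega

theorem leader_leader (j : ℕ) : leader G u (leader G u j) = leader G u j := by
  induction j with
  | zero => rfl
  | succ j ih =>
    by_cases h : G * nrm (u (leader G u j)) < nrm (u (j + 1))
    · have h1 : leader G u (j + 1) = j + 1 := by rw [leader, if_pos h]
      rw [h1, h1]
    · have h1 : leader G u (j + 1) = leader G u j := by rw [leader, if_neg h]
      rw [h1, ih]

/-- The Gram-Schmidt vectors of a block are at most `G` times as long as the first one. -/
theorem nrm_le_leader (hG : 1 ≤ G) (j : ℕ) : nrm (u j) ≤ G * nrm (u (leader G u j)) := by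
  cases j with
  | zero => exact le_mul_of_one_le_left (nrm_nonneg _) hG
  | succ j =>
    rw [leader]
    split_ifs with h
    · exact le_mul_of_one_le_left (nrm_nonneg _) hG
    · exact not_lt.1 h

theorem nrm_leader_mono (hG : 1 ≤ G) : Monotone fun j => nrm (u (leader G u j)) := by
  refine monotone_nat_of_le_succ fun j => ?_
  rw [leader]
  split_ifs with h
  · exact (le_mul_of_one_le_left (nrm_nonneg _) hG).trans h.le
  · exact le_rfl

/-- The Gram-Schmidt vectors at the starts of the blocks grow by factors of at least `G`. -/
theorem isLeader_growth (hG : 1 ≤ G) {i k : ℕ} (hik : i < k) (hi : isLeader G u i = true)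
    (hk : isLeader G u k = true) : G * nrm (u i) ≤ nrm (u k) := by
  obtain ⟨k, rfl⟩ : ∃ k', k = k' + 1 := ⟨k - 1, by omega⟩
  rw [isLeader_iff] at hi hk
  rw [leader] at hk
  split_ifs at hk with h
  · refine le_trans ?_ h.le
    refine mul_le_mul_of_nonneg_left ?_ (by linarith)
    have := nrm_leader_mono (u := u) hG (show i ≤ k by omega)
    simp only [hi] at this
    exact this
  · have := leader_le (G := G) (u := u) k
    omega

theorem blockEnd_leader (hG : 1 ≤ G) {h n i : ℕ} (hi : i < n) (hF : isLeader G u i = true) :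
    blockEnd (isLeader G u) h n i = n ∨ (blockEnd (isLeader G u) h n i < n ∧
      isLeader G u (blockEnd (isLeader G u) h n i) = true ∧
      G ^ h * nrm (u i) ≤ nrm (u (blockEnd (isLeader G u) h n i))) := by
  rcases flagged_getD (F := isLeader G u) (n := n) (w := fun j => nrm (u j)) (by linarith)
    (fun i k hik _ hi hk => isLeader_growth hG hik hi hk) (i + 1) hi (nrm (u i))
    (fun k hk _ hFk => le_trans (le_mul_of_one_le_left (nrm_nonneg _) hG)
      (isLeader_growth hG (by omega) hF hFk)) h with h1 | h1
  · exact Or.inl h1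
  · exact Or.inr ⟨h1.2.1, h1.2.2.1, h1.2.2.2⟩

end Leader

/-! ### Quality of the output -/

section Quality
variable {m n : ℕ} {b u : ℕ → Fin m → ℚ}

/-- Squared length of the component of `x` along `u j`. -/
noncomputable def comp (u : ℕ → Fin m → ℚ) (x : Fin m → ℚ) (j : ℕ) : ℝ :=
  (coef u j x : ℝ) ^ 2 * nrm (u j) ^ 2

theorem comp_nonneg (x : Fin m → ℚ) (j : ℕ) : 0 ≤ comp u x j := by unfold comp; positivity

theorem IsGS.nrm_sq_proj (H : IsGS n b u) {lo hi : ℕ} (hhi : hi ≤ n) (x : Fin m → ℚ) :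
    nrm (proj u lo hi x) ^ 2 = ∑ l ∈ Ico lo hi, comp u x l := by
  rw [nrm_sq, H.sq_proj hhi]
  push_cast
  exact sum_congr rfl fun l _ => by rw [comp, nrm_sq]

theorem IsGS.nrm_sq_eq (H : IsGS n b u) {hi : ℕ} (hhi : hi ≤ n) (x : Fin m → ℚ) :
    nrm x ^ 2 = ∑ l ∈ Ico 0 hi, comp u x l + nrm (x - proj u 0 hi x) ^ 2 := by
  rw [← H.nrm_sq_proj hhi, nrm_sq, nrm_sq, nrm_sq, H.sq_eq (lo := 0) hhi x, H.sq_proj hhi]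
  push_cast
  rfl

theorem IsGS.nrm_proj_le (H : IsGS n b u) {lo hi : ℕ} (hhi : hi ≤ n) (x : Fin m → ℚ) :
    nrm (proj u lo hi x) ≤ nrm (proj u 0 n x) := by
  refine le_of_sq_le_sq ?_ (nrm_nonneg _)
  rw [H.nrm_sq_proj hhi, H.nrm_sq_proj le_rfl]
  exact sum_le_sum_of_subset_of_nonneg (Ico_subset_Ico (Nat.zero_le _) hhi)
    fun l _ _ => comp_nonneg _ _

/-- If `S` differs from `y` by a combination of the first `e` basis vectors and is reduced with
respect to the first `i` of them, which are short compared to `y`, then the length of `S` is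
controlled by that of its part in the block `[i, e)`. -/
theorem IsGS.nrm_sq_le (H : IsGS n b u) {i e : ℕ} (hie : i ≤ e) (hen : e ≤ n) (hn : 1 ≤ n)
    (hlt : i < n ∨ e = n) {S y : Fin m → ℚ} {z : ℕ → ℤ} (hz : S - y = comb b 0 e z) {Γ : ℝ}
    (hΓ : 1 ≤ Γ) (hred : ∀ l < i, |coef u l S| ≤ 1 / 2)
    (hshort : ∀ l < i, nrm (u l) ^ 2 ≤ 4 * Γ * nrm (proj u 0 n y) ^ 2)
    (hblock : nrm (proj u i e S) ^ 2 ≤ Γ * (e - i) * nrm (proj u i e y) ^ 2) :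
    nrm S ^ 2 ≤ n * Γ * nrm y ^ 2 := by
  -- `S` and `y` have the same components along `u l` for `l ≥ e`, and orthogonal to all `u l`.
  have hrest : S - proj u 0 e S = y - proj u 0 e y := by
    have h1 : proj u 0 e (S - y) = S - y := by rw [hz, H.proj_comb_self le_rfl hen]
    rw [map_sub] at h1
    rw [sub_eq_sub_iff_sub_eq_sub]
    exact h1.symm
  have hS := H.nrm_sq_eq hen S
  have hy := H.nrm_sq_eq hen y
  rw [hrest] at hS
  have hyn := H.nrm_sq_eq le_rfl y
  rw [H.nrm_sq_proj le_rfl] at hshort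
  rw [H.nrm_sq_proj hen, H.nrm_sq_proj hen] at hblock
  have s1 := sum_Ico_consecutive (comp u S) (Nat.zero_le i) hie
  have s2 := sum_Ico_consecutive (comp u y) (Nat.zero_le i) hie
  have s3 := sum_Ico_consecutive (comp u y) (Nat.zero_le e) hen
  have hS0 : ∑ l ∈ Ico 0 i, comp u S l ≤ i * (Γ * ∑ l ∈ Ico 0 n, comp u y l) := by
    calc ∑ l ∈ Ico 0 i, comp u S l ≤ ∑ l ∈ Ico 0 i, Γ * ∑ l ∈ Ico 0 n, comp u y l := by
          refine sum_le_sum fun l hl => ?_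
          have hl' := (mem_Ico.1 hl).2
          have h1 : (coef u l S : ℝ) ^ 2 ≤ 1 / 4 := by
            have h2 : |(coef u l S : ℝ)| ≤ 1 / 2 := by
              have h3 : ((|coef u l S| : ℚ) : ℝ) ≤ ((1 / 2 : ℚ) : ℝ) := Rat.cast_le.2 (hred l hl')
              push_cast at h3
              exact h3
            rw [← sq_abs]
            nlinarith [abs_nonneg (coef u l S : ℝ)]
          have h2 := hshort l hl'
          rw [comp]
          nlinarith [sq_nonneg (nrm (u l))]
      _ = _ := by simp
  have p0 : 0 ≤ ∑ l ∈ Ico 0 i, comp u y l := sum_nonneg fun l _ => comp_nonneg _ _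
  have p1 : 0 ≤ ∑ l ∈ Ico i e, comp u y l := sum_nonneg fun l _ => comp_nonneg _ _
  have p2 : 0 ≤ ∑ l ∈ Ico e n, comp u y l := sum_nonneg fun l _ => comp_nonneg _ _
  have p3 := sq_nonneg (nrm (y - proj u 0 n y))
  have hin : (i : ℝ) ≤ n := by exact_mod_cast hie.trans hen
  have hen' : (e : ℝ) ≤ n := by exact_mod_cast hen
  have hn' : (1 : ℝ) ≤ n := by exact_mod_cast hn
  set a0 := ∑ l ∈ Ico 0 i, comp u y l
  set a1 := ∑ l ∈ Ico i e, comp u y l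
  set a2 := ∑ l ∈ Ico e n, comp u y l
  set ρ := nrm (y - proj u 0 n y) ^ 2
  -- The components of `y` from `e` on are counted once for `S` itself and at most `i < n` times
  -- for the bounds of the rounded coordinates.
  have hA2 : i * Γ * a2 + a2 ≤ n * Γ * a2 := by
    rcases hlt with h | h
    · have h1 : (i : ℝ) + 1 ≤ n := by exact_mod_cast h
      have h2 : i * Γ + 1 ≤ n * Γ := by nlinarith
      nlinarith [mul_le_mul_of_nonneg_right h2 p2]
    · have : a2 = 0 := by simp [a2, h]
      simp [this]
  have hA0 : i * Γ * a0 ≤ n * Γ * a0 := by gcongr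
  have hA1 : e * Γ * a1 ≤ n * Γ * a1 := by gcongr
  have hρ : ρ ≤ n * Γ * ρ := le_mul_of_one_le_left p3 (by nlinarith)
  have hsum : ∑ l ∈ Ico 0 n, comp u y l = a0 + a1 + a2 := by rw [← s3, ← s2]
  have hR : nrm (y - proj u 0 e y) ^ 2 = a2 + ρ := by
    rw [hsum] at hyn
    rw [← s2] at hy
    linarith
  rw [hS, hyn, ← s1, hR, hsum]
  rw [hsum] at hS0
  nlinarith

end Quality

end CVPP

namespace CVPP

open Finset

section Reduction
variable {m n : ℕ} {b u : ℕ → Fin m → ℚ}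

theorem nrm_lt_of_near {v τ p : Fin m → ℚ} {r : ℝ} (h1 : nrm (τ - v) < r / 2)
    (h2 : nrm (τ - p) < r / 2) : nrm (v - p) < r := by
  have := nrm_sub_le v τ p
  rw [nrm_sub_comm v τ] at this
  linarith

/-- `S` agrees with `y` up to an integral combination of the first `e` basis vectors. -/
def Agree (b : ℕ → Fin m → ℚ) (e : ℕ) (S y : Fin m → ℚ) : Prop := ∃ z, S - y = comb b 0 e z

theorem Agree.reduce {i : ℕ} {S y : Fin m → ℚ} (h : Agree b i S y) :
    Agree b i (reduce b u 0 i S) y := by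
  obtain ⟨z, hz⟩ := h
  obtain ⟨w, hw⟩ := reduce_eq_sub_comb (b := b) (u := u) (lo := 0) (hi := i) S
  exact ⟨z - w, by rw [hw, sub_right_comm, hz, comb_sub]⟩

/-- Correctness of the reduction. The vectors `S i` are residuals of the target `t`: `S n` comes
from plain rounding, and `S i`, for the start `i` of a block, from solving the block `[i, e i)` for
the residual `S (e i)` by the vector `v i`, and rounding with respect to the first `i` vectors. If
the solver keeps its promise, one of the residuals is short. -/
theorem IsGS.exists_short_residual (H : IsGS n b u) (hn : 1 ≤ n) {α g : ℕ → ℝ} {h e : ℕ → ℕ}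
    (hα_pos : ∀ n, 1 ≤ n → 0 < α n)
    (hα_le : ∀ n, 1 ≤ n → α n ≤ 1 / 2)
    (hα_anti : ∀ m n, 1 ≤ m → m ≤ n → α n ≤ α m)
    (hg_one : ∀ n, 1 ≤ n → 1 ≤ g n)
    (hg_mono : ∀ m n, 1 ≤ m → m ≤ n → g m ≤ g n)
    (hh_mono : ∀ m n, 1 ≤ m → m ≤ n → h m ≤ h n)
    (hgh : ∀ n, 1 ≤ n → g n ^ ((h n : ℤ) - 1) ≤ Real.sqrt (n : ℝ))
    {S v : ℕ → Fin m → ℚ} {t c : Fin m → ℚ}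
    (hmin : ∀ i e z, i < e → e ≤ n → proj u i e (comb b i e z) ≠ 0 →
      nrm (u i) ≤ nrm (proj u i e (comb b i e z)))
    (he : ∀ i < n, isLeader (g n) u i = true → i < e i ∧ e i ≤ n ∧ (e i = n ∨
      (e i < n ∧ isLeader (g n) u (e i) = true ∧ g n ^ h n * nrm (u i) ≤ nrm (u (e i)))))
    (hSn : S n = reduce b u 0 n t)
    (hS : ∀ i < n, isLeader (g n) u i = true →
      S i = reduce b u 0 i (S (e i) + (reduce b u i (e i) (v i) - v i)))
    (hv : ∀ i < n, isLeader (g n) u i = true → ∀ z,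
      nrm (proj u i (e i) (S (e i)) - proj u i (e i) (comb b i (e i) z)) <
        α (e i - i) * nrm (u i) →
      ∃ z', v i = proj u i (e i) (comb b i (e i) z') ∧
        nrm (proj u i (e i) (S (e i)) - v i) ≤ g (e i - i) ^ h (e i - i) / (2 * α (e i - i)) *
          nrm (proj u i (e i) (S (e i)) - proj u i (e i) (comb b i (e i) z)))
    (hc : ∃ z, c = comb b 0 n z) :
    ∃ i, (i = n ∨ (i < n ∧ isLeader (g n) u i = true)) ∧
      nrm (S i) ≤ g n * Real.sqrt n / (2 * α n) * nrm (t - c) := by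
  set y := t - c with hy
  set d := nrm (proj u 0 n y) with hd
  have hα := hα_pos n hn
  have hG := hg_one n hn
  have hGH : 1 ≤ g n ^ h n := one_le_pow₀ hG
  set Γ : ℝ := (g n / (2 * α n)) ^ 2 with hΓdef
  have hq : 1 ≤ g n / (2 * α n) := by
    rw [le_div_iff₀ (by positivity)]
    linarith [hα_le n hn]
  have hΓ : 1 ≤ Γ := one_le_pow₀ hq
  -- A residual that agrees with `y` up to the end of the block at `i`.
  have step : ∀ i < n, isLeader (g n) u i = true → Agree b (e i) (S (e i)) y →
      d < α (e i - i) * nrm (u i) → ∃ z',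
        reduce b u i (e i) (v i) - v i = -comb b i (e i) z' ∧
        nrm (proj u i (e i) (S (e i)) - v i) ≤
          g (e i - i) ^ h (e i - i) / (2 * α (e i - i)) * nrm (proj u i (e i) y) ∧
        v i = proj u i (e i) (comb b i (e i) z') ∧
        ∃ z, S (e i) - y = comb b 0 i z + comb b i (e i) z ∧
          proj u i (e i) (S (e i)) - proj u i (e i) (comb b i (e i) z) = proj u i (e i) y := by
    intro i hi hF hag hlt
    obtain ⟨hie, hen, -⟩ := he i hi hF
    obtain ⟨z, hz⟩ := hag
    rw [← comb_split (Nat.zero_le i) hie.le] at hz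
    have h1 : proj u i (e i) (S (e i)) - proj u i (e i) (comb b i (e i) z) =
        proj u i (e i) y := by
      have h2 : S (e i) - comb b i (e i) z = y + comb b 0 i z := by
        rw [sub_eq_iff_eq_add] at hz ⊢
        rw [hz]
        abel
      rw [← map_sub, h2, map_add, H.proj_comb_eq_zero hen, add_zero]
    obtain ⟨z', hz1, hz2⟩ := hv i hi hF z (by
      rw [h1]; exact (H.nrm_proj_le hen y).trans_lt hlt)
    rw [h1] at hz2
    refine ⟨z', ?_, hz2, hz1, z, hz, h1⟩
    have h3 := H.reduce_exact (r := v i) (z := z') (lo := i) hen fun j hj1 hj2 => by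
      rw [hz1, H.coef_proj hen (by omega), if_pos ⟨hj1, hj2⟩]
    rw [h3]
    abel
  have finish : ∀ x : Fin m → ℚ, nrm x ^ 2 ≤ n * Γ * nrm y ^ 2 →
      nrm x ≤ g n * Real.sqrt n / (2 * α n) * nrm y := by
    intro x hx
    refine le_of_sq_le_sq (hx.trans (le_of_eq ?_)) (mul_nonneg (div_nonneg (mul_nonneg
      (by linarith) (Real.sqrt_nonneg _)) (by positivity)) (nrm_nonneg _))
    rw [hΓdef, mul_pow, div_pow, div_pow, mul_pow (g n), Real.sq_sqrt (Nat.cast_nonneg n)]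
    ring
  have short : ∀ l, α n * nrm (u (leader (g n) u l)) ≤ d → nrm (u l) ^ 2 ≤ 4 * Γ * d ^ 2 := by
    intro l hl
    have h1 := nrm_le_leader (u := u) hG l
    have h2 : nrm (u l) ≤ g n * (d / α n) := by
      refine h1.trans (mul_le_mul_of_nonneg_left ?_ (by linarith))
      rw [le_div_iff₀ hα]
      linarith
    refine (pow_le_pow_left₀ (nrm_nonneg _) h2 2).trans (le_of_eq ?_)
    rw [hΓdef]
    field_simp
    ring
  have hagn : Agree b n (S n) y := by
    obtain ⟨zc, hzc⟩ := hc
    rw [hSn]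
    exact Agree.reduce ⟨zc, by rw [hy, hzc]; abel⟩
  by_cases hall : ∀ i < n, isLeader (g n) u i = true → α n * nrm (u i) ≤ d
  · -- All Gram-Schmidt vectors are short, and rounding suffices.
    refine ⟨n, Or.inl rfl, finish _ ?_⟩
    obtain ⟨z, hz⟩ := hagn
    refine H.nrm_sq_le (i := n) (e := n) le_rfl le_rfl hn (Or.inr rfl) hz hΓ
      (fun l hl => by rw [hSn]; exact H.abs_coef_reduce le_rfl (Nat.zero_le l) hl t)
      (fun l hl => short l ?_) (by simp [proj_apply, nrm, toReal_zero])
    exact hall _ ((leader_le l).trans_lt hl) (isLeader_iff.2 (leader_leader l))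
  · push Not at hall
    classical
    have hspec := Nat.find_spec hall
    set i := Nat.find hall with hi_def
    obtain ⟨hi, hF, hlt⟩ := hspec
    have hbefore : ∀ l < i, isLeader (g n) u l = true → α n * nrm (u l) ≤ d := by
      intro l hl hFl
      by_contra hcon
      exact Nat.find_min hall hl ⟨by omega, hFl, not_le.1 hcon⟩
    have hsz : ∀ k < n, isLeader (g n) u k = true → 1 ≤ e k - k ∧ e k - k ≤ n := by
      intro k hk hFk
      have := he k hk hFk
      omega
    have hαk : ∀ k < n, isLeader (g n) u k = true → α n ≤ α (e k - k) := fun k hk hFk =>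
      hα_anti _ _ (hsz k hk hFk).1 (hsz k hk hFk).2
    -- In blocks with a sufficiently long first vector the solver finds the unique closest vector.
    have exact_block : ∀ j ≤ n, ∀ k, n - j ≤ k → k < n → isLeader (g n) u k = true →
        g n ^ h n * nrm (u i) ≤ nrm (u k) → Agree b k (S k) y := by
      intro j
      induction j with
      | zero => intro _ k h1 h2; omega
      | succ j ih =>
        intro hj k hk1 hk hFk hlong
        obtain ⟨hke, hen, hnext⟩ := he k hk hFk
        have hik : nrm (u i) ≤ nrm (u k) :=
          (le_mul_of_one_le_left (nrm_nonneg _) hGH).trans hlong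
        have hag : Agree b (e k) (S (e k)) y := by
          rcases hnext with h1 | ⟨h1, h2, h3⟩
          · rw [h1]; exact hagn
          · refine ih (by omega) (e k) (by omega) h1 h2 (hlong.trans ?_)
            exact (le_mul_of_one_le_left (nrm_nonneg _) hGH).trans h3
        have hαn := hαk k hk hFk
        obtain ⟨hs1, hs2⟩ := hsz k hk hFk
        have hdk : d < α (e k - k) * nrm (u k) :=
          hlt.trans_le (mul_le_mul hαn hik (nrm_nonneg _) (hα.le.trans hαn))
        obtain ⟨z', hz1, hz2, hz3, z, hz4, hz5⟩ := step k hk hFk hag hdk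
        have hpd : nrm (proj u k (e k) y) ≤ d := H.nrm_proj_le hen y
        have hγ : nrm (proj u k (e k) (S (e k)) - v k) < nrm (u k) / 2 := by
          have hgk : g (e k - k) ^ h (e k - k) ≤ g n ^ h n :=
            (pow_le_pow_left₀ (by linarith [hg_one _ hs1]) (hg_mono _ _ hs1 hs2) _).trans
              (pow_le_pow_right₀ hG (hh_mono _ _ hs1 hs2))
          have hαkpos : 0 < α (e k - k) := hα_pos _ hs1
          calc nrm (proj u k (e k) (S (e k)) - v k)
              ≤ g n ^ h n / (2 * α (e k - k)) * d := by
                refine hz2.trans (mul_le_mul (by gcongr) hpd (nrm_nonneg _) (by positivity))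
            _ < g n ^ h n / (2 * α (e k - k)) * (α n * nrm (u i)) := by
                exact mul_lt_mul_of_pos_left hlt (by positivity)
            _ = α n / α (e k - k) * (g n ^ h n * nrm (u i)) / 2 := by
                field_simp
            _ ≤ 1 * nrm (u k) / 2 := by
                have h1 : α n / α (e k - k) ≤ 1 := (div_le_one hαkpos).2 hαn
                have h2 := nrm_nonneg (u i)
                gcongr
            _ = nrm (u k) / 2 := by rw [one_mul]
        have hγ' : nrm (proj u k (e k) (S (e k)) - proj u k (e k) (comb b k (e k) z)) <
            nrm (u k) / 2 := by
          rw [hz5]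
          refine hpd.trans_lt (hlt.trans_le ?_)
          have h1 := hα_le n hn
          have h2 := nrm_nonneg (u i)
          nlinarith
        have hz0 : comb b k (e k) (z' - z) = 0 := by
          refine H.comb_eq_zero hen ?_
          by_contra hne
          have h1 := hmin k (e k) (z' - z) hke hen hne
          have h2 := nrm_lt_of_near hγ hγ'
          rw [hz3, ← map_sub, comb_sub] at h2
          linarith
        rw [hS k hk hFk]
        refine Agree.reduce ⟨z, ?_⟩
        rw [← comb_sub, sub_eq_zero] at hz0
        rw [hz1, hz0, add_sub_right_comm, hz4]
        abel
    obtain ⟨hie, hen, hnext⟩ := he i hi hF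
    have hag : Agree b (e i) (S (e i)) y := by
      rcases hnext with h1 | ⟨h1, h2, h3⟩
      · rw [h1]; exact hagn
      · exact exact_block n le_rfl (e i) (by omega) h1 h2 h3
    have hαn := hαk i hi hF
    obtain ⟨hs1, hs2⟩ := hsz i hi hF
    obtain ⟨z', hz1, hz2, hz3, z, hz4, hz5⟩ := step i hi hF hag
      (hlt.trans_le (mul_le_mul_of_nonneg_right hαn (nrm_nonneg _)))
    have hSi := hS i hi hF
    rw [hz1] at hSi
    obtain ⟨w, hw⟩ := reduce_eq_sub_comb (b := b) (u := u) (lo := 0) (hi := i)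
      (S (e i) + -comb b i (e i) z')
    have hdiff : ∃ z, S i - y = comb b 0 (e i) z := by
      obtain ⟨z1, hz1⟩ := comb_extend (b := b) (le_refl 0) hie.le w
      obtain ⟨z2, hz2⟩ := comb_extend (b := b) (Nat.zero_le i) (le_refl (e i)) z'
      obtain ⟨z3, hz3⟩ := hag
      refine ⟨z3 - z2 - z1, ?_⟩
      rw [hSi, hw, ← comb_sub, ← comb_sub, ← hz1, ← hz2, ← hz3]
      abel
    obtain ⟨z0, hz0⟩ := hdiff
    refine ⟨i, Or.inr ⟨hi, hF⟩, finish _ ?_⟩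
    refine H.nrm_sq_le hie.le hen hn (Or.inl hi) hz0 hΓ
      (fun l hl => by rw [hSi]; exact H.abs_coef_reduce hi.le (Nat.zero_le l) hl _)
      (fun l hl => short l (hbefore _ ((leader_le l).trans_lt hl)
        (isLeader_iff.2 (leader_leader l)))) ?_
    have hproj : proj u i (e i) (S i) = proj u i (e i) (S (e i)) - v i := by
      rw [hSi, hw, map_sub, H.proj_comb_eq_zero hen, sub_zero, map_add, map_neg, hz3,
        sub_eq_add_neg]
    rw [hproj]
    -- `g ^ (h - 1) ≤ √n` bounds the approximation factor of the solver.
    have hγ : (g (e i - i) ^ h (e i - i) / (2 * α (e i - i))) ^ 2 ≤ Γ * (e i - i) := by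
      have hg1 := hg_one _ hs1
      have hgk : g (e i - i) ^ h (e i - i) ≤ g n * Real.sqrt ((e i - i : ℕ) : ℝ) := by
        have h1 : g (e i - i) ^ h (e i - i) =
            g (e i - i) * g (e i - i) ^ ((h (e i - i) : ℤ) - 1) := by
          rw [zpow_sub_one₀ (by linarith), zpow_natCast]
          field_simp
        rw [h1]
        exact mul_le_mul (hg_mono _ _ hs1 hs2) (hgh _ hs1) (zpow_nonneg (by linarith) _)
          (by linarith)
      have hαkpos : 0 < α (e i - i) := hα_pos _ hs1
      have h2 : g (e i - i) ^ h (e i - i) / (2 * α (e i - i)) ≤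
          g n * Real.sqrt ((e i - i : ℕ) : ℝ) / (2 * α n) := by
        have : 0 ≤ g n * Real.sqrt ((e i - i : ℕ) : ℝ) :=
          mul_nonneg (by linarith) (Real.sqrt_nonneg _)
        gcongr
      have h3 : (0 : ℝ) ≤ g (e i - i) ^ h (e i - i) / (2 * α (e i - i)) := by positivity
      refine (pow_le_pow_left₀ h3 h2 2).trans (le_of_eq ?_)
      rw [hΓdef, div_pow, div_pow, mul_pow, Real.sq_sqrt (Nat.cast_nonneg _), Nat.cast_sub hie.le]
      ring
    calc nrm (proj u i (e i) (S (e i)) - v i) ^ 2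
        ≤ (g (e i - i) ^ h (e i - i) / (2 * α (e i - i)) * nrm (proj u i (e i) y)) ^ 2 :=
          pow_le_pow_left₀ (nrm_nonneg _) hz2 2
      _ = (g (e i - i) ^ h (e i - i) / (2 * α (e i - i))) ^ 2 * nrm (proj u i (e i) y) ^ 2 :=
          mul_pow _ _ _
      _ ≤ _ := mul_le_mul_of_nonneg_right hγ (sq_nonneg _)

end Reduction

end CVPP

namespace CVPP

open Finset Submodule InnerProductSpace

/-! ### Rational Gram-Schmidt orthogonalisation -/

section RatGS
variable {m n : ℕ}

/-- Gram-Schmidt orthogonalisation of a sequence of rational vectors. -/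
def gs (b : ℕ → Fin m → ℚ) (j : ℕ) : Fin m → ℚ :=
  b j - ∑ k : Fin j, ((b j ⬝ᵥ gs b k) / (gs b k ⬝ᵥ gs b k)) • gs b k
termination_by j

theorem gs_eq (b : ℕ → Fin m → ℚ) (j : ℕ) :
    gs b j = b j - ∑ k ∈ range j, coef (gs b) k (b j) • gs b k := by
  rw [gs, Finset.sum_range]
  rfl

theorem sum_Iio_fin {M : Type*} [AddCommMonoid M] {j : ℕ} (hj : j < n) (f : ℕ → M) :
    ∑ i ∈ Iio (⟨j, hj⟩ : Fin n), f i = ∑ i ∈ range j, f i := by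
  refine Finset.sum_nbij (fun i => i.1) ?_ ?_ ?_ ?_
  · intro i hi; simpa using (Fin.lt_def.1 (mem_Iio.1 hi))
  · intro a _ b _ h; exact Fin.ext h
  · intro i hi
    simp at hi
    exact ⟨⟨i, by omega⟩, by simpa using hi, rfl⟩
  · intro i hi; rfl

theorem coef_cast (u : ℕ → Fin m → ℚ) (j : ℕ) (x : Fin m → ℚ) :
    (coef u j x : ℝ) = inner ℝ (toReal x) (toReal (u j)) / ‖toReal (u j)‖ ^ 2 := by
  have := nrm_sq (u j)
  rw [nrm] at this
  rw [inner_toReal, this, coef]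
  push_cast
  rfl

theorem toReal_gs {b : ℕ → Fin m → ℚ} (j : Fin n) :
    toReal (gs b j) = gramSchmidt ℝ (fun i : Fin n => toReal (b i)) j := by
  obtain ⟨j, hj⟩ := j
  induction j using Nat.strong_induction_on with
  | _ j ih =>
    rw [gramSchmidt_def, gs_eq, toReal_sub, toReal_sum, ← sum_Iio_fin hj]
    congr 1
    refine sum_congr rfl fun i hi => ?_
    have hi' : (i : ℕ) < j := Fin.lt_def.1 (mem_Iio.1 hi)
    rw [starProjection_singleton, ← ih i hi' i.2, toReal_smul, coef_cast, real_inner_comm]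
    rfl

theorem isGS_gs {b : ℕ → Fin m → ℚ} (hb : LinearIndependent ℝ fun i : Fin n => toReal (b i)) :
    IsGS n b (gs b) where
  pos j hj := by
    have h1 := gramSchmidt_ne_zero (⟨j, hj⟩ : Fin n) hb
    rw [← toReal_gs] at h1
    have h2 : (0 : ℝ) < nrm (gs b j) ^ 2 := pow_pos (norm_pos_iff.2 h1) 2
    rw [nrm_sq] at h2
    exact_mod_cast h2
  orth j hj k hk hjk := by
    have h1 := gramSchmidt_orthogonal ℝ (fun i : Fin n => toReal (b i))
      (a := ⟨j, hj⟩) (b := ⟨k, hk⟩) (by simpa [Fin.ext_iff] using hjk)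
    rw [← toReal_gs, ← toReal_gs, inner_toReal] at h1
    exact_mod_cast h1
  expand j hj := by
    conv_rhs => enter [1]; rw [gs_eq]
    rw [sub_add_cancel]

theorem toReal_comb_mem {b : ℕ → Fin m → ℚ} {lo hi : ℕ} (hhi : hi ≤ n) (z : ℕ → ℤ) :
    toReal (comb b lo hi z) ∈ span ℤ (Set.range fun i : Fin n => toReal (b i)) := by
  rw [comb, toReal_sum]
  refine sum_mem fun k hk => ?_
  rw [toReal_zsmul]
  exact smul_mem _ _ (subset_span ⟨⟨k, by have := (mem_Ico.1 hk).2; omega⟩, rfl⟩)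

theorem exists_comb_of_mem {b : ℕ → Fin m → ℚ} {x : EuclideanSpace ℝ (Fin m)}
    (hx : x ∈ span ℤ (Set.range fun i : Fin n => toReal (b i))) :
    ∃ z, x = toReal (comb b 0 n z) := by
  obtain ⟨z, rfl⟩ := (mem_span_range_iff_exists_fun ℤ).1 hx
  refine ⟨fun k => if h : k < n then z ⟨k, h⟩ else 0, ?_⟩
  rw [comb, toReal_sum, Nat.Ico_zero_eq_range, Finset.sum_range]
  exact sum_congr rfl fun k _ => by rw [toReal_zsmul, dif_pos k.2]

/-- A nonzero projection `w` of a lattice vector `x`, orthogonal to the first `i` basis vectors, is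
at least as long as the `i`-th Gram-Schmidt vector. -/
theorem IsHKZ.nrm_gs_le_proj {b : ℕ → Fin m → ℚ}
    (hb : LinearIndependent ℝ fun i : Fin n => toReal (b i))
    (h : IsHKZ n fun i : Fin n => toReal (b i)) {i : ℕ} (hi : i < n) {x w : Fin m → ℚ}
    (hx : toReal x ∈ span ℤ (Set.range fun i : Fin n => toReal (b i)))
    (hw : x - w = proj (gs b) 0 i x) (hw0 : w ≠ 0) : nrm (gs b i) ≤ nrm w := by
  have H := isGS_gs hb
  rw [nrm, nrm, toReal_gs ⟨i, hi⟩]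
  refine h.norm_gramSchmidt_le ⟨i, hi⟩ hx ?_ ?_ ?_
  · rw [← toReal_sub, hw, proj_apply, toReal_sum]
    refine sum_mem fun k hk => ?_
    have hk' : k < i := (mem_Ico.1 hk).2
    rw [toReal_smul]
    refine smul_mem _ _ ?_
    rw [toReal_gs ⟨k, hk'.trans hi⟩]
    refine span_mono (Set.image_mono fun l hl => ?_) (gramSchmidt_mem_span ℝ _ le_rfl)
    exact lt_of_le_of_lt (show l ≤ _ from hl) (by simpa using hk')
  · intro k hk
    have hk' : (k : ℕ) < i := Fin.lt_def.1 hk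
    have hw' : w = x - proj (gs b) 0 i x := by rw [← hw]; abel
    rw [inner_toReal, hw']
    -- `b k` lies in the span of the first `i` Gram-Schmidt vectors.
    have h1 : b k ⬝ᵥ (x - proj (gs b) 0 i x) = 0 := by
      rw [← H.proj_basis hk' hi.le, dotProduct_comm, H.dot_proj hi.le]
      refine sum_eq_zero fun l hl => ?_
      have := mem_Ico.1 hl
      rw [coef_sub, H.coef_proj hi.le (by omega), if_pos this, sub_self, zero_mul, zero_mul]
    rw [h1, Rat.cast_zero]
  · intro h0
    exact hw0 (toReal_injective (h0.trans toReal_zero.symm))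

theorem IsHKZ.nrm_gs_le {b : ℕ → Fin m → ℚ}
    (hb : LinearIndependent ℝ fun i : Fin n => toReal (b i))
    (h : IsHKZ n fun i : Fin n => toReal (b i)) {i e : ℕ} (hie : i < e) (hen : e ≤ n)
    (z : ℕ → ℤ) (hw0 : proj (gs b) i e (comb b i e z) ≠ 0) :
    nrm (gs b i) ≤ nrm (proj (gs b) i e (comb b i e z)) := by
  have H := isGS_gs hb
  refine h.nrm_gs_le_proj hb (by omega) (toReal_comb_mem (lo := i) hen z) ?_ hw0
  conv_lhs => enter [1]; rw [← H.proj_comb_self le_rfl hen]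
  rw [proj_apply, proj_apply, proj_apply, ← sum_Ico_consecutive _ (Nat.zero_le i) hie.le,
    add_sub_cancel_right]

theorem abs_coef_le_of_isHKZ {b : ℕ → Fin m → ℚ} (h : IsHKZ n fun i : Fin n => toReal (b i))
    {i j : ℕ} (hi : i < n) (hij : j < i) : |coef (gs b) j (b i)| ≤ 1 / 2 := by
  have h1 := h.abs_gsCoeff_le (i := ⟨i, hi⟩) (j := ⟨j, hij.trans hi⟩) hij
  rw [gsCoeff, ← toReal_gs, ← coef_cast] at h1
  have h2 : ((|coef (gs b) j (b i)| : ℚ) : ℝ) ≤ ((1 / 2 : ℚ) : ℝ) := by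
    push_cast
    exact h1
  exact Rat.cast_le.1 h2

/-! ### Projected blocks -/

variable {b u : ℕ → Fin m → ℚ} {lo hi : ℕ}

theorem IsGS.mem_span_block (H : IsGS n b u) (hhi : hi ≤ n) {l : ℕ} (h1 : lo ≤ l) (h2 : l < hi) :
    toReal (u l) ∈
      span ℝ (Set.range fun k : Fin (hi - lo) => toReal (proj u lo hi (b (lo + k)))) := by
  induction l using Nat.strong_induction_on with
  | _ l ih =>
    have h3 : proj u lo hi (b l) = u l + ∑ k ∈ Ico lo l, coef u k (b l) • u k := by
      rw [proj_apply, ← sum_Ico_consecutive _ (show lo ≤ l + 1 by omega) (show l + 1 ≤ hi by omega),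
        sum_Ico_succ_top h1, H.coef_basis_self (by omega), one_smul,
        sum_eq_zero (s := Ico (l + 1) hi), add_zero, add_comm]
      intro k hk
      have := mem_Ico.1 hk
      rw [H.coef_basis_lt (by omega) (by omega), zero_smul]
    have h4 : toReal (u l) = toReal (proj u lo hi (b l)) -
        ∑ k ∈ Ico lo l, (coef u k (b l) : ℝ) • toReal (u k) := by
      rw [h3, toReal_add, toReal_sum]
      simp only [toReal_smul]
      abel
    rw [h4]
    refine sub_mem (subset_span ⟨⟨l - lo, by omega⟩, ?_⟩) (sum_mem fun k hk => ?_)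
    · simp only
      rw [Nat.add_sub_cancel' h1]
    · have := mem_Ico.1 hk
      exact smul_mem _ _ (ih k (by omega) (by omega) (by omega))

theorem IsGS.toReal_proj_mem (H : IsGS n b u) (hhi : hi ≤ n) (x : Fin m → ℚ) :
    toReal (proj u lo hi x) ∈
      span ℝ (Set.range fun k : Fin (hi - lo) => toReal (proj u lo hi (b (lo + k)))) := by
  rw [proj_apply, toReal_sum]
  refine sum_mem fun l hl => ?_
  have := mem_Ico.1 hl
  rw [toReal_smul]
  exact smul_mem _ _ (H.mem_span_block hhi this.1 this.2)

theorem IsGS.linearIndependent (H : IsGS n b u) :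
    LinearIndependent ℝ fun i : Fin n => toReal (u i) := by
  refine linearIndependent_of_ne_zero_of_inner_eq_zero (fun i h => ?_) fun i j hij => ?_
  · have h1 := H.pos i i.2
    have h2 := nrm_sq (u i)
    rw [nrm, h, norm_zero] at h2
    have h3 : (0 : ℝ) < ((u i ⬝ᵥ u i : ℚ) : ℝ) := by exact_mod_cast h1
    rw [← h2] at h3
    norm_num at h3
  · change inner ℝ (toReal (u i)) (toReal (u j)) = 0
    rw [inner_toReal, H.orth i i.2 j j.2 (fun h => hij (Fin.ext h)), Rat.cast_zero]

theorem IsGS.linearIndependent_block (H : IsGS n b u) (hhi : hi ≤ n) :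
    LinearIndependent ℝ fun k : Fin (hi - lo) => toReal (proj u lo hi (b (lo + k))) := by
  rw [linearIndependent_iff_card_eq_finrank_span]
  refine le_antisymm ?_ (finrank_range_le_card _)
  have h1 : LinearIndependent ℝ fun k : Fin (hi - lo) => toReal (u (lo + k)) :=
    H.linearIndependent.comp (fun k : Fin (hi - lo) => (⟨lo + k, by omega⟩ : Fin n))
      (fun x y h => by simpa [Fin.ext_iff] using h)
  have h2 : span ℝ (Set.range fun k : Fin (hi - lo) => toReal (u (lo + k))) ≤
      span ℝ (Set.range fun k : Fin (hi - lo) => toReal (proj u lo hi (b (lo + k)))) := by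
    rw [span_le]
    rintro _ ⟨k, rfl⟩
    exact H.mem_span_block hhi (by omega) (by omega)
  have : FiniteDimensional ℝ
      (span ℝ (Set.range fun k : Fin (hi - lo) => toReal (proj u lo hi (b (lo + k))))) :=
    FiniteDimensional.span_of_finite ℝ (Set.finite_range _)
  have h3 := Submodule.finrank_mono h2
  rw [finrank_span_eq_card h1] at h3
  exact h3

/-- The basis of the block `[lo, hi)`, projected orthogonally to the first `lo` basis vectors. -/
def blockBasis (H : IsGS n b u) (h1 : lo < hi) (h2 : hi ≤ n) : LatticeBasis where
  rank := hi - lo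
  dim := m
  vec k := proj u lo hi (b (lo + k))
  rank_pos := by omega
  indep := H.linearIndependent_block h2

theorem mem_blockBasis_lattice (H : IsGS n b u) (h1 : lo < hi) (h2 : hi ≤ n)
    (x : EuclideanSpace ℝ (Fin m)) : x ∈ (blockBasis H h1 h2).lattice ↔
      ∃ z, x = toReal (proj u lo hi (comb b lo hi z)) := by
  have key : ∀ z : ℕ → ℤ, toReal (proj u lo hi (comb b lo hi z)) =
      ∑ k : Fin (hi - lo), z (lo + k) • toReal (proj u lo hi (b (lo + k))) := by
    intro z
    rw [comb, map_sum, toReal_sum, sum_Ico_eq_sum_range, Finset.sum_range]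
    exact sum_congr rfl fun k _ => by rw [map_smul, toReal_zsmul]
  have hdef : x ∈ (blockBasis H h1 h2).lattice ↔ x ∈ span ℤ
      (Set.range fun k : Fin (hi - lo) => toReal (proj u lo hi (b (lo + k)))) := Iff.rfl
  rw [hdef, mem_span_range_iff_exists_fun]
  constructor
  · rintro ⟨c, rfl⟩
    refine ⟨fun j => if h : j - lo < hi - lo then c ⟨j - lo, h⟩ else 0, ?_⟩
    rw [key]
    refine sum_congr rfl fun k _ => ?_
    have : lo + (k : ℕ) - lo = k := by omega
    simp [this]
  · rintro ⟨z, rfl⟩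
    exact ⟨fun k => z (lo + k), (key z).symm⟩

/-- The minimum of a block in terms of projected combinations of the basis vectors. -/
theorem nrm_le_lambda1_block (H : IsGS n b u) (h1 : lo < hi) (h2 : hi ≤ n) {r : ℝ}
    (hmin : ∀ z, proj u lo hi (comb b lo hi z) ≠ 0 → r ≤ nrm (proj u lo hi (comb b lo hi z))) :
    r ≤ lambda1 (blockBasis H h1 h2).lattice := by
  refine le_lambda1 ⟨_, subset_span ⟨⟨0, (blockBasis H h1 h2).rank_pos⟩, rfl⟩,
    (blockBasis H h1 h2).indep.ne_zero _⟩ fun x hx hx0 => ?_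
  obtain ⟨z, rfl⟩ := (mem_blockBasis_lattice H h1 h2 x).1 hx
  exact hmin z fun h => hx0 (by rw [h]; exact toReal_zero)

theorem distTo_block_le (H : IsGS n b u) (h1 : lo < hi) (h2 : hi ≤ n) (t : Fin m → ℚ)
    (z : ℕ → ℤ) : (blockBasis H h1 h2).distTo t ≤ nrm (t - proj u lo hi (comb b lo hi z)) := by
  rw [nrm, toReal_sub, ← dist_eq_norm]
  exact Metric.infDist_le_dist_of_mem ((mem_blockBasis_lattice H h1 h2 _).2 ⟨z, rfl⟩)

end RatGS

end CVPP

namespace CVPP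

open Finset Submodule InnerProductSpace

/-! ### Denominators and sizes of Gram-Schmidt vectors -/

section Den
variable {m n : ℕ} {b u : ℕ → Fin m → ℚ}

theorem abs_apply_le {x : Fin m → ℚ} {R : ℚ} (hR : 0 ≤ R) (h : x ⬝ᵥ x ≤ R ^ 2) (k : Fin m) :
    |x k| ≤ R := by
  refine abs_le_of_sq_le_sq ?_ hR
  refine le_trans ?_ h
  rw [dotProduct, sq]
  exact single_le_sum (f := fun i => x i * x i) (fun i _ => mul_self_nonneg _) (mem_univ k)

theorem dot_self_le {x : Fin m → ℚ} {R : ℚ} (h : ∀ k, |x k| ≤ R) : x ⬝ᵥ x ≤ m * R ^ 2 := by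
  calc x ⬝ᵥ x = ∑ k, x k ^ 2 := by simp [dotProduct, sq]
    _ ≤ ∑ _k : Fin m, R ^ 2 := sum_le_sum fun k _ => by
        rw [← sq_abs]
        exact pow_le_pow_left₀ (abs_nonneg _) (h k) 2
    _ = _ := by simp

theorem IsGS.eq_zero_of_comb (H : IsGS n b u) {z : ℕ → ℤ} {j : ℕ} (hj : j ≤ n)
    (h : comb b 0 j z = 0) : ∀ l < j, z l = 0 := by
  induction j with
  | zero => intro l hl; omega
  | succ j ih =>
    have h1 : comb b 0 (j + 1) z = comb b 0 j z + (z j : ℚ) • b j := by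
      rw [comb, sum_Ico_succ_top (Nat.zero_le j)]; rfl
    have h2 : coef u j (comb b 0 (j + 1) z) = z j := by
      rw [h1, coef_add, H.coef_comb_ge hj le_rfl, coef_smul, H.coef_basis_self hj, zero_add,
        mul_one]
    rw [h] at h2
    have h3 : z j = 0 := by
      have : coef u j (0 : Fin m → ℚ) = 0 := by simp [coef]
      rw [this] at h2
      exact_mod_cast h2.symm
    intro l hl
    rcases Nat.lt_or_ge l j with h4 | h4
    · refine ih (by omega) ?_ l h4
      rw [h1, h3] at h
      simpa using h
    · rwa [show l = j by omega]

theorem IsGS.dot_basis (H : IsGS n b u) {j p : ℕ} (hj : j < n) (hp : p < j) :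
    b p ⬝ᵥ u j = 0 := by
  rw [H.dot_smul hj, H.coef_basis_lt hj hp, zero_mul]

theorem IsGS.dot_self_le_basis (H : IsGS n b u) {j : ℕ} (hj : j < n) :
    u j ⬝ᵥ u j ≤ b j ⬝ᵥ b j := by
  have h := H.sq_eq (lo := j) (hi := j + 1) hj (b j)
  rw [Nat.Ico_succ_singleton, sum_singleton, H.coef_basis_self hj, one_pow, one_mul] at h
  rw [h]
  have : 0 ≤ (b j - proj u j (j + 1) (b j)) ⬝ᵥ (b j - proj u j (j + 1) (b j)) :=
    sum_nonneg fun i _ => mul_self_nonneg _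
  linarith

/-- The Gram-Schmidt vector is the basis vector minus a combination of the previous ones; the
coefficients are not the Gram-Schmidt coefficients. -/
theorem IsGS.exists_combination (H : IsGS n b u) {j : ℕ} (hj : j < n) :
    ∃ x : Fin j → ℚ, u j = b j - ∑ l, x l • b l := by
  have key : ∀ j < n, b j - u j ∈ span ℚ (Set.range fun l : Fin j => b l) := by
    intro j
    induction j using Nat.strong_induction_on with
    | _ j ih =>
      intro hj
      rw [sub_eq_iff_eq_add'.2 (H.expand j hj)]
      refine sum_mem fun k hk => smul_mem _ _ ?_
      have hk' := mem_range.1 hk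
      have h1 := ih k hk' (by omega)
      have h2 : span ℚ (Set.range fun l : Fin k => b l) ≤
          span ℚ (Set.range fun l : Fin j => b l) := by
        refine span_mono ?_
        rintro _ ⟨l, rfl⟩
        exact ⟨⟨l, by omega⟩, rfl⟩
      have h3 : b k ∈ span ℚ (Set.range fun l : Fin j => b l) := subset_span ⟨⟨k, hk'⟩, rfl⟩
      have := sub_mem h3 (h2 h1)
      rwa [sub_sub_cancel] at this
  obtain ⟨x, hx⟩ := (mem_span_range_iff_exists_fun ℚ).1 (key j hj)
  exact ⟨x, by rw [hx, sub_sub_cancel]⟩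

/-- By Cramer's rule, the determinant of the Gram matrix of the previous basis vectors is a
denominator of the Gram-Schmidt coefficients. -/
theorem IsGS.exists_den (H : IsGS n b u) {D M : ℕ} (hD : 0 < D)
    (hden : ∀ j < n, ∀ k, IsDen D (b j k)) (hM : ∀ j < n, ∀ k, |b j k| ≤ M) {j : ℕ} (hj : j < n) :
    ∃ d : ℕ, 0 < d ∧ d ≤ j.factorial * (m * (D * M) ^ 2) ^ j ∧ ∀ k, IsDen (D * d) (u j k) := by
  have hB : ∀ l k, ∃ z : ℤ, l < n → (D : ℚ) * b l k = z := by
    intro l k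
    by_cases h : l < n
    · obtain ⟨z, hz⟩ := hden l h k
      exact ⟨z, fun _ => hz⟩
    · exact ⟨0, fun h' => absurd h' h⟩
  choose B hB using hB
  have hDq : (D : ℚ) ≠ 0 := by positivity
  let G : Matrix (Fin j) (Fin j) ℤ := fun p q => ∑ r, B p r * B q r
  have hdot : ∀ p < n, ∀ q < n, ((∑ r, B p r * B q r : ℤ) : ℚ) = (D : ℚ) ^ 2 * (b p ⬝ᵥ b q) := by
    intro p hp q hq
    push_cast
    rw [dotProduct, mul_sum]
    exact sum_congr rfl fun r _ => by rw [← hB p r hp, ← hB q r hq]; ring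
  -- A linear relation between the rows of the Gram matrix is one between the basis vectors.
  have hdet : G.det ≠ 0 := by
    intro h0
    obtain ⟨y, hy0, hy⟩ := Matrix.exists_vecMul_eq_zero_iff.2 h0
    set z : ℕ → ℤ := fun l => if h : l < j then y ⟨l, h⟩ else 0 with hz
    have hcomb : comb b 0 j z = ∑ l : Fin j, (y l : ℚ) • b l := by
      rw [comb, Nat.Ico_zero_eq_range, Finset.sum_range]
      exact sum_congr rfl fun l _ => by simp [hz]
    have h1 : ∀ p : Fin j, comb b 0 j z ⬝ᵥ b p = 0 := by
      intro p
      have h2 : ((Matrix.vecMul y G p : ℤ) : ℚ) = (D : ℚ) ^ 2 * (comb b 0 j z ⬝ᵥ b p) := by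
        rw [hcomb, sum_dotProduct, mul_sum, Matrix.vecMul, dotProduct]
        push_cast
        refine sum_congr rfl fun l _ => ?_
        rw [smul_dotProduct, smul_eq_mul, mul_left_comm, ← hdot l (by omega) p (by omega)]
      rw [hy] at h2
      simpa [hDq] using h2.symm
    have h2 : comb b 0 j z ⬝ᵥ comb b 0 j z = 0 := by
      conv_lhs => enter [2]; rw [hcomb]
      rw [dotProduct_sum]
      exact sum_eq_zero fun p _ => by rw [dotProduct_smul, h1 p, smul_zero]
    have h3 := H.eq_zero_of_comb hj.le (dotProduct_self_eq_zero.1 h2)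
    refine hy0 (funext fun l => ?_)
    have := h3 l l.2
    simpa [hz] using this
  obtain ⟨x, hx⟩ := H.exists_combination hj
  -- The normal equations for the coefficients `x`.
  have hnormal : ∀ p : Fin j, ∑ l : Fin j, x l * (G l p : ℚ) =
      ((∑ r, B j r * B p r : ℤ) : ℚ) := by
    intro p
    have h1 := H.dot_basis hj p.2
    rw [hx, dotProduct_sub, dotProduct_sum, sub_eq_zero] at h1
    rw [hdot j hj p (by omega), dotProduct_comm, h1, mul_sum]
    refine sum_congr rfl fun l _ => ?_
    rw [dotProduct_smul, smul_eq_mul, hdot l (by omega) p (by omega), dotProduct_comm (b p)]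
    ring
  have hxden : ∀ l, IsDen G.det.natAbs (x l) := by
    intro l
    have h1 : (G.det : ℚ) * x l =
        ((∑ p : Fin j, (∑ r, B j r * B p r) * G.adjugate p l : ℤ) : ℚ) := by
      simp only [Int.cast_sum, Int.cast_mul]
      have h2 : ∀ q : Fin j, ∑ p : Fin j, (G q p : ℚ) * (G.adjugate p l : ℚ) =
          if q = l then (G.det : ℚ) else 0 := by
        intro q
        have h3 := congrFun (congrFun (Matrix.mul_adjugate G) q) l
        rw [Matrix.mul_apply, Matrix.smul_apply, Matrix.one_apply] at h3
        have h4 := congrArg (Int.cast : ℤ → ℚ) h3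
        rw [Int.cast_sum] at h4
        simp only [Int.cast_mul] at h4
        rw [h4]
        split_ifs <;> simp
      calc (G.det : ℚ) * x l = ∑ q, x q * (if q = l then (G.det : ℚ) else 0) := by
            simp [mul_comm]
        _ = ∑ q, ∑ p, x q * (G q p : ℚ) * (G.adjugate p l : ℚ) := by
            refine sum_congr rfl fun q _ => ?_
            rw [← h2 q, mul_sum]
            exact sum_congr rfl fun p _ => by ring
        _ = ∑ p, (∑ q, x q * (G q p : ℚ)) * (G.adjugate p l : ℚ) := by
            rw [sum_comm]
            exact sum_congr rfl fun p _ => by rw [sum_mul]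
        _ = _ := by
            refine sum_congr rfl fun p _ => ?_
            rw [hnormal p]
            simp only [Int.cast_sum, Int.cast_mul]
    rcases Int.natAbs_eq G.det with h2 | h2
    · refine ⟨∑ p : Fin j, (∑ r, B j r * B p r) * G.adjugate p l, ?_⟩
      rw [← h1, ← Int.cast_natCast, ← h2]
    · refine ⟨-∑ p : Fin j, (∑ r, B j r * B p r) * G.adjugate p l, ?_⟩
      rw [Int.cast_neg, ← h1, ← neg_mul, ← Int.cast_natCast, ← Int.cast_neg]
      congr 2
      omega
  refine ⟨G.det.natAbs, Int.natAbs_pos.2 hdet, ?_, fun k => ?_⟩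
  · have h1 : ∀ p q, |G p q| ≤ ((m * (D * M) ^ 2 : ℕ) : ℤ) := by
      intro p q
      have hBle : ∀ l < n, ∀ r, |B l r| ≤ ((D * M : ℕ) : ℤ) := by
        intro l hl r
        have : ((|B l r| : ℤ) : ℚ) ≤ (((D * M : ℕ) : ℤ) : ℚ) := by
          push_cast
          rw [← hB l r hl, abs_mul, Nat.abs_cast]
          exact mul_le_mul_of_nonneg_left (hM l hl r) (by positivity)
        exact_mod_cast this
      calc |G p q| ≤ ∑ r, |B p r * B q r| := abs_sum_le_sum_abs _ _
        _ ≤ ∑ _r : Fin m, ((D * M : ℕ) : ℤ) ^ 2 := sum_le_sum fun r _ => by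
            rw [abs_mul, sq]
            exact mul_le_mul (hBle p (by omega) r) (hBle q (by omega) r) (abs_nonneg _)
              (by positivity)
        _ = _ := by simp
    have h2 := Matrix.det_le (A := G) (abv := AbsoluteValue.abs) h1
    rw [Fintype.card_fin, nsmul_eq_mul] at h2
    have h3 : ((G.det.natAbs : ℕ) : ℤ) ≤ ((j.factorial * (m * (D * M) ^ 2) ^ j : ℕ) : ℤ) := by
      rw [Int.natCast_natAbs]
      push_cast at h2 ⊢
      exact h2
    exact_mod_cast h3
  · rw [hx, Pi.sub_apply, Finset.sum_apply]
    refine IsDen.sub ((hden j hj k).of_dvd (dvd_mul_right _ _)) (IsDen.sum fun l _ => ?_)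
    rw [Pi.smul_apply, smul_eq_mul, mul_comm D]
    exact (hxden l).mul (hden l (by omega) k)

/-- Size bounds, in terms of `N`, for a basis and its Gram-Schmidt orthogonalisation: `D` is a
common denominator of the basis, and `Q` is one of the Gram-Schmidt vectors and of the
projections to them. -/
structure GSBound (N n : ℕ) (b u : ℕ → Fin m → ℚ) (D Q : ℕ) : Prop extends IsGS n b u where
  n_le : n ≤ N
  m_le : m ≤ N
  D_pos : 0 < D
  D_le : D ≤ 2 ^ N
  den_b : ∀ j < n, ∀ k, IsDen D (b j k)
  abs_b : ∀ j < n, ∀ k, |b j k| ≤ 2 ^ N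
  Q_pos : 0 < Q
  Q_le : Q ≤ 2 ^ (27 * (N + 1) ^ 4)
  den_u : ∀ j < n, ∀ k, IsDen Q (u j k)
  abs_u : ∀ j < n, ∀ k, |u j k| ≤ 2 ^ (2 * N)
  abs_coef : ∀ j < n, ∀ l < n, |coef u l (b j)| ≤ 1
  den_proj : ∀ (E : ℕ) (x : Fin m → ℚ) (lo hi : ℕ), hi ≤ n → (∀ k, IsDen E (x k)) →
    ∀ k, IsDen (E * Q) (proj u lo hi x k)

theorem dot_den {x y : Fin m → ℚ} {D E : ℕ} (hx : ∀ k, IsDen D (x k)) (hy : ∀ k, IsDen E (y k)) :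
    IsDen (D * E) (x ⬝ᵥ y) := IsDen.sum fun k _ => (hx k).mul (hy k)

/-- The bounds for the Gram-Schmidt vectors follow from those for the basis. -/
theorem IsGS.exists_bound (H : IsGS n b u) {N D : ℕ} (hn : n ≤ N) (hm : m ≤ N) (hD : 0 < D)
    (hDN : D ≤ 2 ^ N) (hden : ∀ j < n, ∀ k, IsDen D (b j k))
    (hM : ∀ j < n, ∀ k, |b j k| ≤ 2 ^ N) (hμ : ∀ j < n, ∀ l < n, |coef u l (b j)| ≤ 1) :
    ∃ Q, GSBound N n b u D Q := by
  have hN2 : N ≤ 2 ^ N := Nat.lt_two_pow_self.le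
  have hd : ∀ j, ∃ d : ℕ, 0 < d ∧ d ≤ 2 ^ (6 * (N + 1) ^ 2) ∧
      (j < n → ∀ k, IsDen (D * d) (u j k)) := by
    intro j
    by_cases hj : j < n
    · obtain ⟨d, hd0, hd1, hd2⟩ := H.exists_den (M := 2 ^ N) hD hden
        (fun j hj k => by exact_mod_cast hM j hj k) hj
      refine ⟨d, hd0, hd1.trans ?_, fun _ => hd2⟩
      have h1 : j.factorial ≤ 2 ^ (N * j) := by
        refine (Nat.factorial_le_pow j).trans ?_
        rw [pow_mul]
        exact Nat.pow_le_pow_left (by omega) j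
      have h2 : m * (D * 2 ^ N) ^ 2 ≤ 2 ^ (5 * N) := by
        calc m * (D * 2 ^ N) ^ 2 ≤ 2 ^ N * (2 ^ N * 2 ^ N) ^ 2 := by gcongr; omega
          _ = 2 ^ (5 * N) := by ring
      calc j.factorial * (m * (D * 2 ^ N) ^ 2) ^ j ≤ 2 ^ (N * j) * (2 ^ (5 * N)) ^ j := by gcongr
        _ = 2 ^ (6 * (N * j)) := by ring
        _ ≤ _ := Nat.pow_le_pow_right (by norm_num) (by nlinarith)
    · exact ⟨1, one_pos, Nat.one_le_two_pow, fun h => absurd h hj⟩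
  choose d hd0 hd1 hd2 using hd
  have hone : ∀ k, 1 ≤ (N + 1) ^ k := fun k => Nat.one_le_pow _ _ (by omega)
  -- `Du` is a common denominator of the Gram-Schmidt vectors.
  obtain ⟨Du, hDu⟩ : ∃ Du : ℕ, Du = D * ∏ j ∈ range n, d j := ⟨_, rfl⟩
  have hDu0 : 0 < Du := hDu ▸ Nat.mul_pos hD (prod_pos fun j _ => hd0 j)
  have hDu1 : Du ≤ 2 ^ (6 * (N + 1) ^ 3) := by
    have h1 : ∏ j ∈ range n, d j ≤ (2 ^ (6 * (N + 1) ^ 2)) ^ n := by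
      refine (prod_le_prod' fun j _ => hd1 j).trans ?_
      simp
    calc Du ≤ 2 ^ N * (2 ^ (6 * (N + 1) ^ 2)) ^ n := hDu ▸ Nat.mul_le_mul hDN h1
      _ = 2 ^ (N + 6 * (N + 1) ^ 2 * n) := by rw [← pow_mul, ← pow_add]
      _ ≤ _ := Nat.pow_le_pow_right (by norm_num) (by
          have h2 : 6 * (N + 1) ^ 2 * n ≤ 6 * (N + 1) ^ 2 * N := Nat.mul_le_mul_left _ hn
          have h3 : 6 * (N + 1) ^ 3 = 6 * (N + 1) ^ 2 * N + 6 * (N + 1) ^ 2 := by ring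
          nlinarith)
  have hdu : ∀ j < n, ∀ k, IsDen Du (u j k) := fun j hj k => (hd2 j hj k).of_dvd
    (hDu ▸ Nat.mul_dvd_mul_left D (dvd_prod_of_mem d (mem_range.2 hj)))
  have huu : ∀ j < n, u j ⬝ᵥ u j ≤ 2 ^ (3 * N) := by
    intro j hj
    refine (H.dot_self_le_basis hj).trans ((dot_self_le (hM j hj)).trans ?_)
    have h1 : (m : ℚ) ≤ 2 ^ N := by exact_mod_cast hm.trans hN2
    calc (m : ℚ) * (2 ^ N) ^ 2 ≤ 2 ^ N * (2 ^ N) ^ 2 := by gcongr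
      _ = 2 ^ (3 * N) := by ring
  have hv : ∀ j, ∃ v : ℕ, 0 < v ∧ v ≤ 2 ^ (15 * (N + 1) ^ 3) ∧
      (j < n → IsDen v (u j ⬝ᵥ u j)⁻¹) := by
    intro j
    by_cases hj : j < n
    · obtain ⟨z, hz⟩ := dot_den (hdu j hj) (hdu j hj)
      have hpos := H.pos j hj
      have hzpos : (0 : ℚ) < z := by rw [← hz]; positivity
      have hz0 : 0 < z := by exact_mod_cast hzpos
      have hcast : ((z.natAbs : ℕ) : ℚ) = z := by
        rw [Nat.cast_natAbs, abs_of_pos hz0]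
      refine ⟨z.natAbs, by omega, ?_, fun _ => ⟨Du * Du, ?_⟩⟩
      · have h1 : ((z.natAbs : ℕ) : ℚ) ≤ ((2 ^ (15 * (N + 1) ^ 3) : ℕ) : ℚ) := by
          rw [hcast, ← hz]
          have h2 : ((Du * Du : ℕ) : ℚ) ≤ ((2 ^ (6 * (N + 1) ^ 3) * 2 ^ (6 * (N + 1) ^ 3) : ℕ) : ℚ) :=
            by exact_mod_cast Nat.mul_le_mul hDu1 hDu1
          calc ((Du * Du : ℕ) : ℚ) * (u j ⬝ᵥ u j)
              ≤ ((2 ^ (6 * (N + 1) ^ 3) * 2 ^ (6 * (N + 1) ^ 3) : ℕ) : ℚ) * 2 ^ (3 * N) :=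
                mul_le_mul h2 (huu j hj) hpos.le (by positivity)
            _ = ((2 ^ (12 * (N + 1) ^ 3 + 3 * N) : ℕ) : ℚ) := by push_cast; ring
            _ ≤ _ := by
                have h3 : 12 * (N + 1) ^ 3 + 3 * N ≤ 15 * (N + 1) ^ 3 := by
                  have : N + 1 ≤ (N + 1) ^ 3 := Nat.le_self_pow (by norm_num) _
                  omega
                exact_mod_cast Nat.pow_le_pow_right (by norm_num) h3
        exact_mod_cast h1
      · rw [hcast, ← hz]
        push_cast
        field_simp
    · exact ⟨1, one_pos, Nat.one_le_two_pow, fun h => absurd h hj⟩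
  choose v hv0 hv1 hv2 using hv
  -- `V` is a common denominator of the inverses of their squared lengths.
  obtain ⟨V, hV⟩ : ∃ V : ℕ, V = ∏ j ∈ range n, v j := ⟨_, rfl⟩
  have hV0 : 0 < V := hV ▸ prod_pos fun j _ => hv0 j
  have hV1 : V ≤ 2 ^ (15 * (N + 1) ^ 4) := by
    calc V ≤ (2 ^ (15 * (N + 1) ^ 3)) ^ n := by
          rw [hV]
          refine (prod_le_prod' fun j _ => hv1 j).trans ?_
          simp
      _ = 2 ^ (15 * (N + 1) ^ 3 * n) := by rw [← pow_mul]
      _ ≤ _ := Nat.pow_le_pow_right (by norm_num) (by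
          calc 15 * (N + 1) ^ 3 * n ≤ 15 * (N + 1) ^ 3 * (N + 1) := Nat.mul_le_mul_left _ (by omega)
            _ = _ := by ring)
  refine ⟨Du * V * Du, H, hn, hm, hD, hDN, hden, hM,
    Nat.mul_pos (Nat.mul_pos hDu0 hV0) hDu0, ?_, ?_, ?_, hμ, ?_⟩
  · have h1 : (N + 1) ^ 3 ≤ (N + 1) ^ 4 := Nat.pow_le_pow_right (by omega) (by norm_num)
    refine (Nat.mul_le_mul (Nat.mul_le_mul hDu1 hV1) hDu1).trans ?_
    rw [← pow_add, ← pow_add]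
    exact Nat.pow_le_pow_right (by norm_num) (by omega)
  · exact fun j hj k => (hdu j hj k).of_dvd (dvd_mul_left _ _)
  · intro j hj k
    refine abs_apply_le (by positivity) ((huu j hj).trans ?_) k
    rw [← pow_mul]
    exact pow_le_pow_right₀ (by norm_num) (by omega)
  · intro E x lo hi hhi hx k
    rw [proj_apply, Finset.sum_apply]
    refine IsDen.sum fun l hl => ?_
    have hl' : l < n := by have := (mem_Ico.1 hl).2; omega
    rw [Pi.smul_apply, smul_eq_mul, coef, div_eq_mul_inv]
    have h1 := ((dot_den hx (hdu l hl')).mul (hv2 l hl')).mul (hdu l hl' k)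
    refine h1.of_dvd ?_
    rw [mul_assoc E, mul_assoc E]
    exact Nat.mul_dvd_mul_left E (Nat.mul_dvd_mul_right
      (Nat.mul_dvd_mul_left Du (hV ▸ dvd_prod_of_mem v (mem_range.2 hl'))) Du)

end Den

end CVPP

namespace CVPP

open Finset Submodule InnerProductSpace

/-! ### Size bounds for HKZ bases -/

section HKZBound

theorem LatticeBasis.exists_int_comb (B : LatticeBasis) {x : Fin B.dim → ℚ}
    (hx : toReal x ∈ B.lattice) : ∃ c : Fin B.rank → ℤ, x = ∑ i, (c i : ℚ) • B.vec i := by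
  obtain ⟨c, hc⟩ := (mem_span_range_iff_exists_fun ℤ).1 hx
  refine ⟨c, toReal_injective ?_⟩
  rw [toReal_sum, ← hc]
  exact sum_congr rfl fun i _ => (toReal_zsmul _ _).symm

theorem LatticeBasis.sum_size_le (B : LatticeBasis) :
    ∑ i, (encVec (B.vec i)).size + B.rank + 1 = B.enc.size := by
  rw [LatticeBasis.enc, encList_size, List.length_ofFn, List.map_ofFn, List.sum_ofFn]
  rfl

theorem LatticeBasis.size_vec_le (B : LatticeBasis) (i : Fin B.rank) :
    (encVec (B.vec i)).size ≤ B.enc.size := by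
  have h1 := B.sum_size_le
  have h2 := single_le_sum (f := fun i => (encVec (B.vec i)).size) (fun _ _ => Nat.zero_le _)
    (mem_univ i)
  omega

theorem LatticeBasis.rank_le (B : LatticeBasis) : B.rank ≤ B.enc.size := by
  have := B.sum_size_le
  omega

theorem LatticeBasis.dim_le (B : LatticeBasis) : B.dim ≤ B.enc.size :=
  (dim_le_encVec_size _).trans (B.size_vec_le ⟨0, B.rank_pos⟩)

/-- HKZ bases have polynomial size: by minimality, each Gram-Schmidt vector is at most as long as
the longest vector of any basis of the lattice. -/
theorem exists_gsBound_of_isHKZ (B : LatticeBasis) {b : ℕ → Fin B.dim → ℚ}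
    (hb : LinearIndependent ℝ fun i : Fin B.rank => toReal (b i))
    (hspan : span ℤ (Set.range fun i : Fin B.rank => toReal (b i)) = B.lattice)
    (h : IsHKZ B.rank fun i : Fin B.rank => toReal (b i)) :
    ∃ D Q, GSBound (2 * B.enc.size) B.rank b (gs b) D Q := by
  have H := isGS_gs hb
  set s := B.enc.size with hs
  have hmem : ∀ j < B.rank, toReal (b j) ∈ B.lattice := fun j hj => by
    rw [← hspan]
    exact subset_span ⟨⟨j, hj⟩, rfl⟩
  have hs2 : s ≤ 2 ^ s := Nat.lt_two_pow_self.le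
  have hμ : ∀ j < B.rank, ∀ l < B.rank, |coef (gs b) l (b j)| ≤ 1 := by
    intro j hj l hl
    rcases lt_trichotomy l j with h1 | h1 | h1
    · exact (abs_coef_le_of_isHKZ h hj h1).trans (by norm_num)
    · rw [h1, H.coef_basis_self hj, abs_one]
    · rw [H.coef_basis_lt hl h1, abs_zero]
      exact zero_le_one
  have hvec : ∀ i, B.vec i ⬝ᵥ B.vec i ≤ 2 ^ (3 * s) := by
    intro i
    have h1 : ∀ k, |B.vec i k| ≤ 2 ^ s := fun k => (abs_vec_le _ k).trans
      (pow_le_pow_right₀ (by norm_num) (B.size_vec_le i))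
    have h2 : (B.dim : ℚ) ≤ 2 ^ s := by exact_mod_cast B.dim_le.trans hs2
    calc B.vec i ⬝ᵥ B.vec i ≤ B.dim * (2 ^ s) ^ 2 := dot_self_le h1
      _ ≤ 2 ^ s * (2 ^ s) ^ 2 := by gcongr
      _ = _ := by ring
  have hu : ∀ j < B.rank, gs b j ⬝ᵥ gs b j ≤ 2 ^ (3 * s) := by
    intro j hj
    -- Some input vector has a nonzero projection orthogonal to the first `j` basis vectors.
    obtain ⟨i, hi⟩ : ∃ i, B.vec i - proj (gs b) 0 j (B.vec i) ≠ 0 := by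
      by_contra hcon
      push Not at hcon
      have h1 : ∀ i, coef (gs b) j (B.vec i) = 0 := by
        intro i
        rw [sub_eq_zero.1 (hcon i), H.coef_proj hj.le hj, if_neg (by omega)]
      obtain ⟨c, hc⟩ := B.exists_int_comb (hmem j hj)
      have h2 : coef (gs b) j (b j) = 0 := by
        rw [hc, coef, sum_dotProduct, Finset.sum_div]
        refine sum_eq_zero fun i _ => ?_
        have := h1 i
        rw [coef] at this
        rw [smul_dotProduct, smul_eq_mul, mul_div_assoc, this, mul_zero]
      rw [H.coef_basis_self hj] at h2
      exact one_ne_zero h2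
    have h1 := h.nrm_gs_le_proj hb hj (x := B.vec i) (by rw [hspan]; exact subset_span ⟨i, rfl⟩)
      (sub_sub_cancel _ _) hi
    have h2 := pow_le_pow_left₀ (nrm_nonneg _) h1 2
    rw [nrm_sq, nrm_sq, Rat.cast_le] at h2
    refine h2.trans (le_trans ?_ (hvec i))
    have h3 := H.sq_eq (lo := 0) hj.le (B.vec i)
    have h4 : 0 ≤ ∑ l ∈ Ico 0 j, coef (gs b) l (B.vec i) ^ 2 * (gs b l ⬝ᵥ gs b l) :=
      sum_nonneg fun l _ => mul_nonneg (sq_nonneg _) (sum_nonneg fun _ _ => mul_self_nonneg _)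
    linarith
  have hbb : ∀ j < B.rank, b j ⬝ᵥ b j ≤ 2 ^ (4 * s) := by
    intro j hj
    rw [← H.proj_basis (Nat.lt_succ_self j) hj, H.sq_proj hj]
    have h1 : ∀ l ∈ Ico 0 (j + 1), coef (gs b) l (b j) ^ 2 * (gs b l ⬝ᵥ gs b l) ≤ 2 ^ (3 * s) := by
      intro l hl
      have hl' : l < B.rank := by have := (mem_Ico.1 hl).2; omega
      refine le_trans (mul_le_of_le_one_left (H.pos l hl').le ?_) (hu l hl')
      rw [← sq_abs]
      exact pow_le_one₀ (abs_nonneg _) (hμ j hj l hl')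
    refine (sum_le_card_nsmul _ _ _ h1).trans ?_
    rw [Nat.card_Ico, nsmul_eq_mul]
    have h2 : ((j + 1 - 0 : ℕ) : ℚ) ≤ 2 ^ s := by
      have : j + 1 - 0 ≤ 2 ^ s := by have := B.rank_le; omega
      exact_mod_cast this
    calc ((j + 1 - 0 : ℕ) : ℚ) * 2 ^ (3 * s) ≤ 2 ^ s * 2 ^ (3 * s) := by gcongr
      _ = _ := by ring
  refine ⟨∏ i, vecDen (B.vec i), H.exists_bound (by have := B.rank_le; omega)
    (by have := B.dim_le; omega) (prod_pos fun i _ => vecDen_pos _) ?_ (fun j hj k => ?_)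
    (fun j hj k => ?_) hμ⟩
  · refine (prod_le_prod' fun i _ => vecDen_le (B.vec i)).trans ?_
    rw [prod_pow_eq_pow_sum]
    exact Nat.pow_le_pow_right (by norm_num) (by have := B.sum_size_le; omega)
  · obtain ⟨c, hc⟩ := B.exists_int_comb (hmem j hj)
    rw [hc, Finset.sum_apply]
    refine IsDen.sum fun i _ => ?_
    exact ((isDen_vecDen (B.vec i) k).of_dvd
      (dvd_prod_of_mem (fun i => vecDen (B.vec i)) (mem_univ i))).intMul (c i)
  · refine abs_apply_le (by positivity) ((hbb j hj).trans (le_of_eq ?_)) k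
    rw [← pow_mul]
    congr 1
    ring

end HKZBound

/-! ### Sizes of projections and of reduced vectors -/

section Tame
variable {m n N D Q : ℕ} {b u : ℕ → Fin m → ℚ}

/-- Common denominator `E`, and Gram-Schmidt coefficients and squared distance to the span of the
Gram-Schmidt vectors at most `2 ^ P`. Reduction changes these quantities in a controlled way. -/
structure Tame (u : ℕ → Fin m → ℚ) (n E P : ℕ) (x : Fin m → ℚ) : Prop where
  den : ∀ k, IsDen E (x k)
  coef_le : ∀ l < n, |coef u l x| ≤ 2 ^ P
  rest_le : (x - proj u 0 n x) ⬝ᵥ (x - proj u 0 n x) ≤ 2 ^ P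

theorem GSBound.dot_u_le (hB : GSBound N n b u D Q) {j : ℕ} (hj : j < n) :
    u j ⬝ᵥ u j ≤ 2 ^ (5 * N) := by
  have h1 : (m : ℚ) ≤ 2 ^ N := by exact_mod_cast hB.m_le.trans Nat.lt_two_pow_self.le
  calc u j ⬝ᵥ u j ≤ m * (2 ^ (2 * N)) ^ 2 := dot_self_le (hB.abs_u j hj)
    _ ≤ 2 ^ N * (2 ^ (2 * N)) ^ 2 := by gcongr
    _ = 2 ^ (5 * N) := by ring

theorem GSBound.inv_dot_u_le (hB : GSBound N n b u D Q) {j : ℕ} (hj : j < n) :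
    (u j ⬝ᵥ u j)⁻¹ ≤ 2 ^ (54 * (N + 1) ^ 4) := by
  obtain ⟨z, hz⟩ := dot_den (hB.den_u j hj) (hB.den_u j hj)
  have hpos := hB.pos j hj
  have hQ : (0 : ℚ) < ((Q * Q : ℕ) : ℚ) := by exact_mod_cast Nat.mul_pos hB.Q_pos hB.Q_pos
  have hz0 : (0 : ℚ) < z := by rw [← hz]; exact mul_pos hQ hpos
  have hz1 : (1 : ℚ) ≤ z := by exact_mod_cast (show (0 : ℤ) < z by exact_mod_cast hz0)
  have h1 : (u j ⬝ᵥ u j)⁻¹ ≤ ((Q * Q : ℕ) : ℚ) := by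
    rw [inv_le_iff_one_le_mul₀ hpos, hz]
    exact hz1
  have h2 : Q * Q ≤ 2 ^ (54 * (N + 1) ^ 4) := by
    refine (Nat.mul_le_mul hB.Q_le hB.Q_le).trans (le_of_eq ?_)
    rw [← pow_add]
    congr 1
    omega
  exact h1.trans (by exact_mod_cast h2)

theorem Tame.size_le {E P : ℕ} {x : Fin m → ℚ} (h : Tame u n E P x) (hB : GSBound N n b u D Q)
    (hE : 0 < E) (hEP : E ≤ 2 ^ P) : (encVec x).size ≤ N * (3 * P + 6 * N + 8) + 1 := by
  have h1 : x ⬝ᵥ x ≤ (((2 ^ (6 * N + P + 1) : ℕ) : ℚ)) ^ 2 := by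
    rw [hB.sq_eq (lo := 0) le_rfl x]
    have h2 : ∀ l ∈ Ico 0 n, coef u l x ^ 2 * (u l ⬝ᵥ u l) ≤ 2 ^ (2 * P + 5 * N) := by
      intro l hl
      have hl' := (mem_Ico.1 hl).2
      rw [pow_add]
      refine mul_le_mul ?_ (hB.dot_u_le hl') (hB.pos l hl').le (by positivity)
      rw [← sq_abs, mul_comm 2 P, pow_mul]
      exact pow_le_pow_left₀ (abs_nonneg _) (h.coef_le l hl') 2
    have h3 := sum_le_card_nsmul _ _ _ h2
    rw [Nat.card_Ico, nsmul_eq_mul] at h3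
    have h4 : ((n - 0 : ℕ) : ℚ) ≤ 2 ^ N := by
      have : n - 0 ≤ 2 ^ N := by have := hB.n_le; have := (Nat.lt_two_pow_self (n := N)); omega
      exact_mod_cast this
    have h5 : ((n - 0 : ℕ) : ℚ) * 2 ^ (2 * P + 5 * N) ≤ 2 ^ (6 * N + 2 * P) := by
      calc ((n - 0 : ℕ) : ℚ) * 2 ^ (2 * P + 5 * N) ≤ 2 ^ N * 2 ^ (2 * P + 5 * N) := by gcongr
        _ = _ := by rw [← pow_add]; congr 1; omega
    have h6 : (2 : ℚ) ^ P ≤ 2 ^ (6 * N + 2 * P) := pow_le_pow_right₀ (by norm_num) (by omega)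
    have h7 : (2 : ℚ) ^ (6 * N + 2 * P) * 2 ≤ ((2 ^ (6 * N + P + 1) : ℕ) : ℚ) ^ 2 := by
      push_cast
      rw [← pow_mul, ← pow_succ]
      exact pow_le_pow_right₀ (by norm_num) (by omega)
    have := h.rest_le
    linarith
  have h2 := encVec_size_le hE h.den fun k => abs_apply_le (Nat.cast_nonneg _) h1 k
  have h3 : E.size ≤ P + 1 := by
    rw [Nat.size_le]
    exact hEP.trans_lt (Nat.pow_lt_pow_right (by norm_num) (Nat.lt_succ_self P))
  have h4 : (2 ^ (6 * N + P + 1)).size = 6 * N + P + 2 := by rw [Nat.size_pow]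
  rw [h4] at h2
  refine h2.trans (Nat.succ_le_succ (Nat.mul_le_mul hB.m_le ?_))
  omega

/-- The size of a vector bounds its Gram-Schmidt coefficients, as the Gram-Schmidt vectors are not
too short. -/
theorem tame_of_size_le (hB : GSBound N n b u D Q) {L : ℕ} {x : Fin m → ℚ}
    (hL : (encVec x).size ≤ L) :
    Tame u n (vecDen x) (2 * L + 3 * N + 54 * (N + 1) ^ 4) x := by
  have hx : ∀ k, |x k| ≤ 2 ^ L := fun k =>
    (abs_vec_le x k).trans (pow_le_pow_right₀ (by norm_num) hL)
  have hm : (m : ℚ) ≤ 2 ^ N := by exact_mod_cast hB.m_le.trans Nat.lt_two_pow_self.le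
  refine ⟨isDen_vecDen x, fun l hl => ?_, ?_⟩
  · have h1 : |x ⬝ᵥ u l| ≤ 2 ^ (L + 3 * N) := by
      calc |x ⬝ᵥ u l| ≤ ∑ k, |x k * u l k| := abs_sum_le_sum_abs _ _
        _ ≤ ∑ _k : Fin m, (2 : ℚ) ^ L * 2 ^ (2 * N) := sum_le_sum fun k _ => by
            rw [abs_mul]
            exact mul_le_mul (hx k) (hB.abs_u l hl k) (abs_nonneg _) (by positivity)
        _ = m * (2 ^ L * 2 ^ (2 * N)) := by simp
        _ ≤ 2 ^ N * (2 ^ L * 2 ^ (2 * N)) := by gcongr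
        _ = _ := by ring
    rw [coef, div_eq_mul_inv, abs_mul, abs_of_pos (inv_pos.2 (hB.pos l hl))]
    calc |x ⬝ᵥ u l| * (u l ⬝ᵥ u l)⁻¹ ≤ 2 ^ (L + 3 * N) * 2 ^ (54 * (N + 1) ^ 4) :=
          mul_le_mul h1 (hB.inv_dot_u_le hl) (inv_nonneg.2 (hB.pos l hl).le) (by positivity)
      _ = 2 ^ (L + 3 * N + 54 * (N + 1) ^ 4) := by rw [← pow_add]
      _ ≤ _ := pow_le_pow_right₀ (by norm_num) (by omega)
  · have h1 := hB.sq_eq (lo := 0) le_rfl x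
    have h2 : 0 ≤ ∑ l ∈ Ico 0 n, coef u l x ^ 2 * (u l ⬝ᵥ u l) :=
      sum_nonneg fun l _ => mul_nonneg (sq_nonneg _) (sum_nonneg fun _ _ => mul_self_nonneg _)
    have h3 : x ⬝ᵥ x ≤ 2 ^ N * (2 ^ L) ^ 2 := (dot_self_le hx).trans (by gcongr)
    have h4 : (2 : ℚ) ^ N * (2 ^ L) ^ 2 = 2 ^ (N + 2 * L) := by ring
    have h5 : (2 : ℚ) ^ (N + 2 * L) ≤ 2 ^ (2 * L + 3 * N + 54 * (N + 1) ^ 4) :=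
      pow_le_pow_right₀ (by norm_num) (by omega)
    linarith

theorem IsGS.proj_proj (H : IsGS n b u) {lo hi : ℕ} (hhi : hi ≤ n) (x : Fin m → ℚ) :
    proj u 0 n (proj u lo hi x) = proj u lo hi x := by
  rw [proj_apply u 0 n]
  have h2 : ∀ l ∈ Ico 0 n, coef u l (proj u lo hi x) • u l =
      if l ∈ Ico lo hi then coef u l x • u l else 0 := by
    intro l hl
    rw [H.coef_proj hhi (mem_Ico.1 hl).2]
    by_cases h3 : lo ≤ l ∧ l < hi
    · rw [if_pos h3, if_pos (mem_Ico.2 h3)]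
    · rw [if_neg h3, if_neg fun h4 => h3 (mem_Ico.1 h4), zero_smul]
  rw [sum_congr rfl h2, ← sum_filter, proj_apply]
  refine sum_congr (Finset.ext fun l => ?_) fun _ _ => rfl
  simp only [mem_filter, mem_Ico]
  omega

theorem Tame.proj (hB : GSBound N n b u D Q) {E P : ℕ} {x : Fin m → ℚ} (h : Tame u n E P x)
    {lo hi : ℕ} (hhi : hi ≤ n) : Tame u n (E * Q) P (proj u lo hi x) := by
  refine ⟨hB.den_proj E x lo hi hhi h.den, fun l hl => ?_, ?_⟩
  · rw [hB.coef_proj hhi hl]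
    split_ifs
    · exact h.coef_le l hl
    · rw [abs_zero]; positivity
  · rw [hB.proj_proj hhi, sub_self, dotProduct_zero]
    positivity

/-- Subtracting lattice vectors does not change the part orthogonal to the lattice. -/
theorem comb_sub_proj (H : IsGS n b u) {lo hi : ℕ} (hhi : hi ≤ n) (x : Fin m → ℚ) (z : ℕ → ℤ) :
    (x - comb b lo hi z) - proj u 0 n (x - comb b lo hi z) = x - proj u 0 n x := by
  rw [map_sub, H.proj_comb_self hhi le_rfl]
  abel

theorem IsDen.comb {E : ℕ} (hden : ∀ j < n, ∀ k, IsDen E (b j k)) {lo hi : ℕ} (hhi : hi ≤ n)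
    (z : ℕ → ℤ) (k : Fin m) : IsDen E (comb b lo hi z k) := by
  rw [CVPP.comb, Finset.sum_apply]
  refine IsDen.sum fun l hl => ?_
  exact (hden l (by have := (mem_Ico.1 hl).2; omega) k).intMul (z l)

/-- Each rounding step at most doubles the Gram-Schmidt coefficients, up to a constant. -/
theorem Tame.reduce (hB : GSBound N n b u D Q) {E : ℕ} (hE : D ∣ E) {lo : ℕ} :
    ∀ {hi : ℕ} (_ : hi ≤ n) {P : ℕ} {x : Fin m → ℚ}, Tame u n E P x →
      Tame u n E (P + 2 * hi) (reduce b u lo hi x) := by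
  intro hi
  induction hi with
  | zero => intro _ P x h; exact h
  | succ k ih =>
    intro hk P x h
    rw [CVPP.reduce]
    split_ifs with hlo
    · have h1 : Tame u n E (P + 2) (x - (nearest (coef u k x) : ℚ) • b k) := by
        have hcomb : (nearest (coef u k x) : ℚ) • b k =
            comb b k (k + 1) fun _ => nearest (coef u k x) := by
          rw [comb, Nat.Ico_succ_singleton, sum_singleton]
        have hP : (1 : ℚ) ≤ 2 ^ P := one_le_pow₀ (by norm_num)
        have hP2 : (2 : ℚ) ^ (P + 2) = 4 * 2 ^ P := by ring
        refine ⟨fun j => ?_, fun l hl => ?_, ?_⟩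
        · rw [hcomb]
          exact (h.den j).sub (IsDen.comb (fun j hj k => (hB.den_b j hj k).of_dvd hE) hk _ _)
        · rw [coef_sub, coef_smul, hP2]
          have h1 := h.coef_le l hl
          have h2 := h.coef_le k hk
          have h3 := abs_sub_nearest (coef u k x)
          have h4 := hB.abs_coef k hk l hl
          have h5 : |(nearest (coef u k x) : ℚ)| ≤ 2 * 2 ^ P := by
            have h6 := abs_sub_abs_le_abs_sub (nearest (coef u k x) : ℚ) (coef u k x)
            rw [abs_sub_comm] at h6
            linarith
          have h6 : |(nearest (coef u k x) : ℚ) * coef u l (b k)| ≤ 2 * 2 ^ P := by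
            rw [abs_mul]
            exact (mul_le_of_le_one_right (abs_nonneg _) h4).trans h5
          have h7 := abs_sub (coef u l x) ((nearest (coef u k x) : ℚ) * coef u l (b k))
          linarith
        · rw [hcomb, comb_sub_proj hB.toIsGS hk]
          exact h.rest_le.trans (pow_le_pow_right₀ (by norm_num) (by omega))
      have h2 := ih (by omega) h1
      rwa [show P + 2 + 2 * k = P + 2 * (k + 1) by ring] at h2
    · exact ⟨h.den, fun l hl => (h.coef_le l hl).trans
        (pow_le_pow_right₀ (by norm_num) (by omega)),
        h.rest_le.trans (pow_le_pow_right₀ (by norm_num) (by omega))⟩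

/-- Bound for the size of projections and of reduced vectors. -/
def sizeBound (N L : ℕ) : ℕ := N * (3 * (2 * L + 5 * N + 54 * (N + 1) ^ 4) + 6 * N + 8) + 1

theorem GSBound.size_proj_le (hB : GSBound N n b u D Q) {x : Fin m → ℚ} {lo hi : ℕ}
    (hhi : hi ≤ n) : (encVec (proj u lo hi x)).size ≤ sizeBound N (encVec x).size := by
  refine (((tame_of_size_le hB le_rfl).proj hB hhi).size_le hB
    (Nat.mul_pos (vecDen_pos x) hB.Q_pos) ?_).trans ?_
  · refine (Nat.mul_le_mul (vecDen_le x) hB.Q_le).trans ?_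
    rw [← pow_add]
    exact Nat.pow_le_pow_right (by norm_num) (by omega)
  · exact Nat.succ_le_succ (Nat.mul_le_mul_left _ (by omega))

theorem GSBound.size_reduce_le (hB : GSBound N n b u D Q) {x : Fin m → ℚ} {lo hi : ℕ}
    (hhi : hi ≤ n) : (encVec (reduce b u lo hi x)).size ≤ sizeBound N (encVec x).size := by
  have h1 := tame_of_size_le hB (le_refl (encVec x).size)
  have h2 : Tame u n (vecDen x * D) (2 * (encVec x).size + 3 * N + 54 * (N + 1) ^ 4) x :=
    ⟨fun k => (h1.den k).of_dvd (dvd_mul_right _ _), h1.coef_le, h1.rest_le⟩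
  refine ((h2.reduce hB (dvd_mul_left _ _) hhi).size_le hB
    (Nat.mul_pos (vecDen_pos x) hB.D_pos) ?_).trans ?_
  · refine (Nat.mul_le_mul (vecDen_le x) hB.D_le).trans ?_
    rw [← pow_add]
    exact Nat.pow_le_pow_right (by norm_num) (by omega)
  · have := hB.n_le
    exact Nat.succ_le_succ (Nat.mul_le_mul_left _ (by omega))

theorem GSBound.size_b_le (hB : GSBound N n b u D Q) {j : ℕ} (hj : j < n) :
    (encVec (b j)).size ≤ N * (3 * N + 7) + 1 := by
  have h1 := encVec_size_le (M := 2 ^ N) hB.D_pos (hB.den_b j hj)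
    fun k => by exact_mod_cast hB.abs_b j hj k
  have h2 : D.size ≤ N + 1 := by
    rw [Nat.size_le]
    exact hB.D_le.trans_lt (Nat.pow_lt_pow_right (by norm_num) (Nat.lt_succ_self N))
  rw [Nat.size_pow] at h1
  exact h1.trans (Nat.succ_le_succ (Nat.mul_le_mul hB.m_le (by omega)))

end Tame

end CVPP

namespace CVPP

open Finset

/-! ### Programs on a table of Gram-Schmidt vectors -/

theorem PB.pow {ι : Type} {s k : ι → ℕ} (hk : PB s k) (r : ℕ) : PB s (fun i => k i ^ r) := by
  induction r with
  | zero => simpa using PB.const 1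
  | succ r ih => simpa only [pow_succ] using ih.mul hk

theorem PB.sizeBound {ι : Type} {s N L : ι → ℕ} (hN : PB s N) (hL : PB s L) :
    PB s (fun i => sizeBound (N i) (L i)) :=
  (hN.mul ((((PB.const 3).mul ((((PB.const 2).mul hL).add ((PB.const 5).mul hN)).add
    ((PB.const 54).mul ((hN.add (PB.const 1)).pow 4)))).add ((PB.const 6).mul hN)).add
    (PB.const 8))).add (PB.const 1)

section Bounds
variable {m n n' N D Q : ℕ} {b u : ℕ → Fin m → ℚ}

theorem IsGS.mono (H : IsGS n b u) (h : n' ≤ n) : IsGS n' b u :=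
  ⟨fun j hj => H.pos j (hj.trans_le h),
    fun j hj k hk => H.orth j (hj.trans_le h) k (hk.trans_le h),
    fun j hj => H.expand j (hj.trans_le h)⟩

theorem GSBound.mono (hB : GSBound N n b u D Q) (h : n' ≤ n) : GSBound N n' b u D Q where
  toIsGS := hB.toIsGS.mono h
  n_le := h.trans hB.n_le
  m_le := hB.m_le
  D_pos := hB.D_pos
  D_le := hB.D_le
  den_b j hj := hB.den_b j (hj.trans_le h)
  abs_b j hj := hB.abs_b j (hj.trans_le h)
  Q_pos := hB.Q_pos
  Q_le := hB.Q_le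
  den_u j hj := hB.den_u j (hj.trans_le h)
  abs_u j hj := hB.abs_u j (hj.trans_le h)
  abs_coef j hj l hl := hB.abs_coef j (hj.trans_le h) l (hl.trans_le h)
  den_proj E x lo hi hhi := hB.den_proj E x lo hi (hhi.trans h)

theorem GSBound.size_u_le (hB : GSBound N n b u D Q) {j : ℕ} (hj : j < n) :
    (encVec (u j)).size ≤ N * (54 * (N + 1) ^ 4 + 2 * N + 7) + 1 := by
  have h1 := encVec_size_le (M := 2 ^ (2 * N)) hB.Q_pos (hB.den_u j hj)
    fun k => by exact_mod_cast hB.abs_u j hj k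
  have h2 : Q.size ≤ 27 * (N + 1) ^ 4 + 1 := by
    rw [Nat.size_le]
    exact hB.Q_le.trans_lt (Nat.pow_lt_pow_right (by norm_num) (Nat.lt_succ_self _))
  rw [Nat.size_pow] at h1
  exact h1.trans (Nat.succ_le_succ (Nat.mul_le_mul hB.m_le (by omega)))

/-- Entry of the table: the index, the basis vector and the Gram-Schmidt vector. -/
def item (b u : ℕ → Fin m → ℚ) (j : ℕ) : Data :=
  .pair (.int j) (.pair (encVec (b j)) (encVec (u j)))

/-- Table of the first `n` basis vectors and Gram-Schmidt vectors, in descending order. -/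
def table (n : ℕ) (b u : ℕ → Fin m → ℚ) : List Data := ((List.range n).map (item b u)).reverse

theorem table_succ (n : ℕ) (b u : ℕ → Fin m → ℚ) :
    table (n + 1) b u = item b u n :: table n b u := by
  simp [table, List.range_succ]

theorem length_table : (table n b u).length = n := by simp [table]

theorem getElem_table {r : ℕ} (hr : r < (table n b u).length) :
    (table n b u)[r] = item b u (n - 1 - r) := by
  simp [table, List.getElem_reverse]

theorem size_int_le {j : ℕ} (h : j ≤ N) : (Data.int (j : ℤ)).size ≤ N + 1 := by
  have h1 : j.size ≤ j := by
    rw [Nat.size_le]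
    exact Nat.lt_two_pow_self
  simp only [Data.size, Int.natAbs_natCast]
  omega

theorem GSBound.size_table_le (hB : GSBound N n b u D Q) {j : ℕ} (hj : j ≤ n) :
    (encList (table j b u)).size ≤
      N * (N + 1 + ((N * (3 * N + 7) + 1) + (N * (54 * (N + 1) ^ 4 + 2 * N + 7) + 1) + 1) + 1 + 1)
        + 1 := by
  refine (encList_size_le _ (N + 1 + ((N * (3 * N + 7) + 1) +
    (N * (54 * (N + 1) ^ 4 + 2 * N + 7) + 1) + 1) + 1) ?_).trans ?_
  · intro x hx
    rw [table, List.mem_reverse, List.mem_map] at hx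
    obtain ⟨k, hk, rfl⟩ := hx
    have hk' : k < n := (List.mem_range.1 hk).trans_le hj
    have h1 := hB.size_b_le hk'
    have h2 := hB.size_u_le hk'
    have h3 := size_int_le (hk'.le.trans hB.n_le)
    change (Data.int (k : ℤ)).size + ((encVec (b k)).size + (encVec (u k)).size + 1) + 1 ≤ _
    omega
  · rw [length_table]
    exact Nat.succ_le_succ (Nat.mul_le_mul_right _ (hj.trans hB.n_le))

end Bounds

section TableProg
variable {ι : Type} {s : ι → ℕ} {a : ι → Data} {m n : ι → ℕ} {b u : ∀ i, ℕ → Fin (m i) → ℚ}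

/-- A fold over the table, from the last index down to the first: the state `St i j` is reached
after the indices from `j` on have been treated. -/
theorem PT.foldDown {St : ι → ℕ → Data}
    (hT : PT s a (fun i => encList (table (n i) (b i) (u i))))
    (h0 : PT s a (fun i => St i (n i))) {K : ι → ℕ} (hK : PB s K)
    (hsz : ∀ i, ∀ j ≤ n i, (St i j).size ≤ K i)
    (hstep : ∀ a' : (Σ i, Fin (n i)) → Data,
      (∀ c, PT s a c → PT (fun k : Σ i, Fin (n i) => s k.1) a' (fun k => c k.1)) →
      PT (fun k => s k.1) a' (fun k => .int ((k.2 : ℕ) : ℤ)) →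
      PT (fun k => s k.1) a' (fun k => encVec (b k.1 k.2)) →
      PT (fun k => s k.1) a' (fun k => encVec (u k.1 k.2)) →
      PT (fun k => s k.1) a' (fun k => St k.1 (k.2 + 1)) →
      PT (fun k => s k.1) a' (fun k => St k.1 k.2)) :
    PT s a (fun i => St i 0) := by
  have key := PT.fold (St := fun i r => St i (n i - r)) hT (by simpa using h0) hK
    (fun i j _ => hsz i _ (Nat.sub_le _ _)) ?_
  · simpa [length_table] using key
  · intro a' hc hl hSt
    let ψ : (Σ i, Fin (n i)) → Σ i, Fin (table (n i) (b i) (u i)).length := fun k =>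
      ⟨k.1, ⟨n k.1 - 1 - k.2, by rw [length_table]; have := k.2.2; omega⟩⟩
    let φ : (Σ i, Fin (table (n i) (b i) (u i)).length) → Σ i, Fin (n i) := fun k =>
      ⟨k.1, ⟨n k.1 - 1 - k.2, by
        have := lt_of_lt_of_eq k.2.2 length_table
        omega⟩⟩
    have hφ : ∀ k, ψ (φ k) = k := by
      rintro ⟨i, r, hr⟩
      have hr' := hr
      rw [length_table] at hr'
      simp only [ψ, φ, Sigma.mk.injEq, heq_eq_eq, Fin.mk.injEq, true_and]
      omega
    have hitem := (hl.reindex ψ).congr (c := fun k => item (b k.1) (u k.1) k.2) fun k => by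
      refine (getElem_table (ψ k).2.2).trans ?_
      change item _ _ (n k.1 - 1 - (n k.1 - 1 - k.2)) = _
      congr 1
      have := k.2.2
      omega
    have h1 := hstep (fun k => a' (ψ k)) (fun c h => (hc c h).reindex ψ) hitem.fst
      hitem.snd.fst hitem.snd.snd ((hSt.reindex ψ).congr fun k => by
        change St k.1 (n k.1 - (n k.1 - 1 - k.2)) = _
        congr 1
        have := k.2.2
        omega)
    have h2 := h1.reindex φ
    simp only [hφ] at h2
    exact h2.congr fun k => by
      change St k.1 (n k.1 - 1 - k.2) = St k.1 (n k.1 - (k.2 + 1))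
      congr 1
      omega

/-- A table of Gram-Schmidt vectors can be computed in polynomial time, and its entries have
polynomially bounded size. -/
structure PTTable (s : ι → ℕ) (a : ι → Data) (n : ι → ℕ) (b u : ∀ i, ℕ → Fin (m i) → ℚ) :
    Prop where
  table : PT s a (fun i => encList (table (n i) (b i) (u i)))
  bound : ∃ N, PB s N ∧ ∀ i, ∃ D Q, GSBound (N i) (n i) (b i) (u i) D Q

theorem PTTable.lift {κ : Type} (hT : PTTable s a n b u) (φ : κ → ι) {a' : κ → Data}
    (hc : ∀ c, PT s a c → PT (fun k => s (φ k)) a' (fun k => c (φ k))) :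
    PTTable (fun k => s (φ k)) a' (fun k => n (φ k)) (fun k => b (φ k)) (fun k => u (φ k)) := by
  obtain ⟨N, hN, hB⟩ := hT.bound
  exact ⟨hc _ hT.table, fun k => N (φ k), hN.reindex φ, fun k => hB (φ k)⟩

variable {lo hi : ι → ℕ} {x : ∀ i, Fin (m i) → ℚ}

theorem PT.proj (hT : PTTable s a n b u) (hhi : ∀ i, hi i ≤ n i)
    (hlo' : PT s a (fun i => .int (lo i))) (hhi' : PT s a (fun i => .int (hi i)))
    (hx : PT s a (fun i => encVec (x i))) :
    PT s a (fun i => encVec (proj (u i) (lo i) (hi i) (x i))) := by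
  obtain ⟨N, hN, hB⟩ := hT.bound
  refine (PT.foldDown (St := fun i j => encVec (CVPP.proj (u i) (max (lo i) j) (hi i) (x i)))
    hT.table ?_ (hN.sizeBound hx.size_right) ?_ ?_).congr fun i => by
      rw [Nat.max_zero]
  · refine hx.vecZero.congr fun i => ?_
    rw [proj_apply, Ico_eq_empty (by have := hhi i; omega), sum_empty]
  · intro i j hj
    obtain ⟨D, Q, h⟩ := hB i
    exact h.size_proj_le (hhi i)
  · intro a' hc hj hb hu hSt
    have hx' := hc _ hx
    have hcoef := (hx'.dot hu).ratDiv (hu.dot hu) fun k => by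
      obtain ⟨D, Q, h⟩ := hB k.1
      exact (h.pos k.2 k.2.2).le
    refine (PT.ite (((hc _ hlo').intLe hj).boolAnd (hj.intLt (hc _ hhi'))) (hcoef.axpy hSt hu)
      hSt).congr fun k => ?_
    obtain ⟨i, j, hjn⟩ := k
    simp only [Nat.cast_le, Nat.cast_lt, Bool.and_eq_true, decide_eq_true_eq]
    split_ifs with h
    · rw [max_eq_right h.1, max_eq_right (by omega)]
      congr 1
      rw [proj_apply, proj_apply, sum_eq_sum_Ico_succ_bot h.2, add_comm]
      rfl
    · by_cases h1 : lo i ≤ j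
      · rw [proj_apply, proj_apply, Ico_eq_empty (by omega), Ico_eq_empty (by omega)]
      · rw [max_eq_left (by omega), max_eq_left (by omega)]

/-- Rounding at `lo` is the last step of rounding from `hi - 1` down to `lo`. -/
theorem reduce_eq_step {m : ℕ} {b u : ℕ → Fin m → ℚ} {lo : ℕ} : ∀ {hi : ℕ} (_ : lo < hi)
    (r : Fin m → ℚ), reduce b u lo hi r = reduce b u (lo + 1) hi r -
      (nearest (coef u lo (reduce b u (lo + 1) hi r)) : ℚ) • b lo
  | hi + 1, h, r => by
    rcases Nat.lt_or_ge lo hi with h1 | h1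
    · rw [reduce, if_pos h1.le, reduce_eq_step h1, reduce, if_pos (Nat.succ_le_of_lt h1)]
    · obtain rfl : lo = hi := by omega
      rw [reduce, if_pos le_rfl, reduce_of_le le_rfl, reduce_of_le le_rfl]

theorem PT.reduce (hT : PTTable s a n b u) (hhi : ∀ i, hi i ≤ n i)
    (hlo' : PT s a (fun i => .int (lo i))) (hhi' : PT s a (fun i => .int (hi i)))
    (hx : PT s a (fun i => encVec (x i))) :
    PT s a (fun i => encVec (reduce (b i) (u i) (lo i) (hi i) (x i))) := by
  obtain ⟨N, hN, hB⟩ := hT.bound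
  refine (PT.foldDown
    (St := fun i j => encVec (CVPP.reduce (b i) (u i) (max (lo i) j) (hi i) (x i)))
    hT.table ?_ (hN.sizeBound hx.size_right) ?_ ?_).congr fun i => by
      rw [Nat.max_zero]
  · refine hx.congr fun i => ?_
    rw [reduce_of_le (by have := hhi i; omega)]
  · intro i j hj
    obtain ⟨D, Q, h⟩ := hB i
    exact h.size_reduce_le (hhi i)
  · intro a' hc hj hb hu hSt
    have hcoef := ((hSt.dot hu).ratDiv (hu.dot hu) fun k => by
      obtain ⟨D, Q, h⟩ := hB k.1
      exact (h.pos k.2 k.2.2).le).nearest.ratNeg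
    refine (PT.ite (((hc _ hlo').intLe hj).boolAnd (hj.intLt (hc _ hhi'))) (hcoef.axpy hSt hb)
      hSt).congr fun k => ?_
    obtain ⟨i, j, hjn⟩ := k
    simp only [Nat.cast_le, Nat.cast_lt, Bool.and_eq_true, decide_eq_true_eq]
    split_ifs with h
    · rw [max_eq_right h.1, max_eq_right (by omega), reduce_eq_step h.2, neg_smul,
        ← sub_eq_add_neg]
      rfl
    · by_cases h1 : lo i ≤ j
      · rw [reduce_of_le (by omega), reduce_of_le (by omega)]
      · rw [max_eq_left (by omega), max_eq_left (by omega)]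

/-- The Gram-Schmidt vectors can be computed in polynomial time. -/
theorem PT.gsTable {b : ∀ i, ℕ → Fin (m i) → ℚ}
    (hb : PT s a (fun i => encList (List.ofFn fun j : Fin (n i) => encVec (b i j))))
    (hbound : ∃ N, PB s N ∧ ∀ i, ∃ D Q, GSBound (N i) (n i) (b i) (gs (b i)) D Q) :
    PTTable s a n b (fun i => gs (b i)) ∧ PT s a (fun i => .int (n i)) := by
  obtain ⟨N, hN, hB⟩ := hbound
  have h1 := PT.fold
    (St := fun i j => .pair (.int j) (encList (CVPP.table j (b i) (gs (b i))))) hb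
    (K := fun i => N i + 1 + (N i * (N i + 1 + ((N i * (3 * N i + 7) + 1) +
      (N i * (54 * (N i + 1) ^ 4 + 2 * N i + 7) + 1) + 1) + 1 + 1) + 1) + 1)
    ((PT.const hb.size_left (.pair (.int 0) (.int 0))).congr fun i => rfl) ?_ ?_ ?_
  · simp only [List.length_ofFn] at h1
    exact ⟨⟨h1.snd, N, hN, hB⟩, h1.fst⟩
  · have h54 := (PB.const 54).mul ((hN.add (PB.const 1)).pow 4)
    have hA := (hN.mul (((PB.const 3).mul hN).add (PB.const 7))).add (PB.const 1)
    have hC := (hN.mul ((h54.add ((PB.const 2).mul hN)).add (PB.const 7))).add (PB.const 1)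
    have hN1 := hN.add (PB.const 1)
    exact (hN1.add ((hN.mul (((hN1.add ((hA.add hC).add (PB.const 1))).add (PB.const 1)).add
      (PB.const 1))).add (PB.const 1))).add (PB.const 1)
  · intro i j hj
    rw [List.length_ofFn] at hj
    obtain ⟨D, Q, h⟩ := hB i
    have h2 := h.size_table_le hj
    have h3 := size_int_le (hj.trans h.n_le)
    rw [Data.size]
    omega
  · intro a' hc hl hSt
    have hlt : ∀ k : Σ i, Fin (List.ofFn fun j : Fin (n i) => encVec (b i j)).length,
        (k.2 : ℕ) < n k.1 := fun k => lt_of_lt_of_eq k.2.2 List.length_ofFn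
    have hbj : PT (fun k : Σ i, Fin (List.ofFn fun j : Fin (n i) => encVec (b i j)).length =>
        s k.1) a' (fun k => encVec (b k.1 k.2)) := hl.congr fun k => by
      change (List.ofFn _)[(k.2 : ℕ)] = _
      rw [List.getElem_ofFn]
    have hT : PTTable (fun k : Σ i, Fin (List.ofFn fun j : Fin (n i) => encVec (b i j)).length =>
        s k.1) a' (fun k => k.2) (fun k => b k.1) (fun k => gs (b k.1)) := by
      refine ⟨hSt.snd, fun k => N k.1, hN.reindex _, fun k => ?_⟩
      obtain ⟨D, Q, h⟩ := hB k.1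
      exact ⟨D, Q, h.mono (hlt k).le⟩
    have hzero : PT (fun k : Σ i, Fin (List.ofFn fun j : Fin (n i) => encVec (b i j)).length =>
        s k.1) a' (fun _ => .int ((0 : ℕ) : ℤ)) := PT.const hbj.size_left _
    -- The Gram-Schmidt vector is `b j` minus its projection to the previous ones.
    have hu := hbj.vecSub (PT.proj hT (fun _ => le_rfl) hzero hSt.fst hbj)
    have hone := PT.const hbj.size_left (.int 1)
    refine ((hSt.fst.intAdd hone).pair ((hSt.fst.pair (hbj.pair hu)).pair hSt.snd)).congr
      fun k => ?_
    rw [table_succ, encList, item, gs_eq (b k.1) k.2, proj_apply, Nat.Ico_zero_eq_range,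
      Nat.cast_succ]

end TableProg

end CVPP

namespace CVPP

open Finset Submodule InnerProductSpace

/-! ### Signed HKZ bases -/

section Sign
variable {m n : ℕ}

/-- Update of the sign flag by one coordinate. -/
def signStep (f : Bool) (x : ℚ) : Bool := if 0 < x then true else if x < 0 then false else f

/-- Whether the last nonzero coordinate of a vector is positive. -/
def signFlag (v : Fin m → ℚ) : Bool := (List.ofFn v).foldl signStep false

theorem foldl_signStep_neg (l : List ℚ) (f : Bool) :
    (l.map Neg.neg).foldl signStep (!f) = !(l.foldl signStep f) := by
  induction l generalizing f with
  | nil => rfl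
  | cons x l ih =>
    have h : signStep (!f) (-x) = !(signStep f x) := by
      rcases lt_trichotomy x 0 with h | rfl | h
      · simp [signStep, h, h.le.not_gt]
      · simp [signStep]
      · simp [signStep, h, h.le.not_gt]
    rw [List.map_cons, List.foldl_cons, List.foldl_cons, h, ih]

theorem foldl_signStep_congr {l : List ℚ} (hl : ∃ x ∈ l, x ≠ 0) (f f' : Bool) :
    l.foldl signStep f = l.foldl signStep f' := by
  induction l generalizing f f' with
  | nil => simp at hl
  | cons x l ih =>
    rw [List.foldl_cons, List.foldl_cons]
    by_cases h : ∃ y ∈ l, y ≠ 0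
    · exact ih h _ _
    · have hx : x ≠ 0 := by
        obtain ⟨y, hy, hy0⟩ := hl
        rcases List.mem_cons.1 hy with rfl | hy
        · exact hy0
        · exact absurd ⟨y, hy, hy0⟩ h
      have : signStep f x = signStep f' x := by
        rcases lt_or_gt_of_ne hx with h | h
        · simp [signStep, h, h.le.not_gt]
        · simp [signStep, h]
      rw [this]

theorem signFlag_neg {v : Fin m → ℚ} (hv : v ≠ 0) : signFlag (-v) = !signFlag v := by
  obtain ⟨k, hk⟩ := Function.ne_iff.1 hv
  have h1 : List.ofFn (-v) = (List.ofFn v).map Neg.neg := by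
    rw [List.map_ofFn]
    rfl
  rw [signFlag, signFlag, h1, ← foldl_signStep_neg]
  refine foldl_signStep_congr ⟨-v k, ?_, neg_ne_zero.2 hk⟩ _ _
  exact List.mem_map.2 ⟨v k, List.mem_ofFn.2 ⟨k, rfl⟩, rfl⟩

theorem PT.signFlag {ι : Type} {s : ι → ℕ} {a : ι → Data} {m : ι → ℕ} {v : ∀ i, Fin (m i) → ℚ}
    (hv : PT s a (fun i => encVec (v i))) : PT s a (fun i => encBool (signFlag (v i))) := by
  simp only [encVec_eq] at hv
  refine (PT.fold (K := fun _ => 2)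
    (St := fun i j => encBool (((List.ofFn (v i)).take j).foldl signStep false)) hv
    ((PT.const hv.size_left (.int 0)).congr fun i => rfl) (PB.const 2) ?_ ?_).congr fun i => ?_
  · intro i j _
    cases ((List.ofFn (v i)).take j).foldl signStep false <;> simp [encBool, Data.size]
  · intro a' hc hl hSt
    have hx : PT (fun k : Σ i, Fin (List.ofFn fun j => encRat (v i j)).length => s k.1) a'
        (fun k => encRat (v k.1 ⟨k.2, lt_of_lt_of_eq k.2.2 List.length_ofFn⟩)) :=
      hl.congr fun k => by
        change (List.ofFn _)[(k.2 : ℕ)] = _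
        rw [List.getElem_ofFn]
    have h0 := PT.ratConst hx.size_left 0
    have h1 := PT.const hx.size_left (encBool true)
    have h2 := PT.const hx.size_left (encBool false)
    refine (PT.ite (h0.ratLt hx) h1 (PT.ite (hx.ratLt h0) h2 hSt)).congr fun k => ?_
    have hk : (k.2 : ℕ) < (List.ofFn (v k.1)).length :=
      lt_of_lt_of_eq k.2.2 (by rw [List.length_ofFn, List.length_ofFn])
    rw [List.take_succ_eq_append_getElem hk, List.foldl_append, List.foldl_cons, List.foldl_nil,
      List.getElem_ofFn, signStep]
    simp only [decide_eq_true_eq]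
    split_ifs <;> rfl
  · rw [CVPP.signFlag, List.take_of_length_le (by simp)]

/-- The blocks depend on the lengths of the Gram-Schmidt vectors only. -/
theorem leader_congr {G : ℝ} {u u' : ℕ → Fin m → ℚ} (j : ℕ)
    (h : ∀ k ≤ j, nrm (u k) = nrm (u' k)) : leader G u j = leader G u' j := by
  induction j with
  | zero => rfl
  | succ j ih =>
    rw [leader, leader, ih fun k hk => h k (by omega), h (j + 1) le_rfl,
      h (leader G u' j) ((leader_le j).trans (by omega))]

/-- The signs of the vectors of an HKZ basis can be chosen such that they tell at which indices
blocks start. -/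
theorem exists_signed_isHKZ (G : ℝ) (B : LatticeBasis) : ∃ b : ℕ → Fin B.dim → ℚ,
    LinearIndependent ℝ (fun i : Fin B.rank => toReal (b i)) ∧
    span ℤ (Set.range fun i : Fin B.rank => toReal (b i)) = B.lattice ∧
    IsHKZ B.rank (fun i : Fin B.rank => toReal (b i)) ∧
    ∀ j < B.rank, signFlag (b j) = isLeader G (gs b) j := by
  obtain ⟨c, hc1, hc2⟩ := exists_isHKZ B.rank _ B.indep
  have hrat : ∀ i : Fin B.rank, ∃ v : Fin B.dim → ℚ, c i = toReal v := by
    intro i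
    have h1 : c i ∈ span ℤ (Set.range fun i => toReal (B.vec i)) := by
      rw [← hc1]
      exact subset_span ⟨i, rfl⟩
    obtain ⟨z, hz⟩ := (mem_span_range_iff_exists_fun ℤ).1 h1
    refine ⟨∑ i, (z i : ℚ) • B.vec i, ?_⟩
    rw [toReal_sum, ← hz]
    exact sum_congr rfl fun i _ => (toReal_zsmul _ _).symm
  choose v hv using hrat
  have hcv : c = fun i => toReal (v i) := funext hv
  rw [hcv] at hc1 hc2
  have hcl := linearIndependent_of_span_eq B.indep hc1
  let b₀ : ℕ → Fin B.dim → ℚ := fun j => if h : j < B.rank then v ⟨j, h⟩ else 0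
  have hb₀ : ∀ i : Fin B.rank, b₀ i = v i := fun i => dif_pos i.2
  -- The sign is changed where it does not agree with the flag.
  let ε : ℕ → ℤˣ := fun j => if signFlag (b₀ j) = isLeader G (gs b₀) j then 1 else -1
  let b : ℕ → Fin B.dim → ℚ := fun j => ((ε j : ℤ) : ℚ) • b₀ j
  have hb : (fun i : Fin B.rank => toReal (b i)) = fun i : Fin B.rank => ε i • toReal (v i) := by
    funext i
    rw [← hb₀, Units.smul_def]
    exact toReal_zsmul _ _
  have hspan : span ℤ (Set.range fun i : Fin B.rank => toReal (b i)) = B.lattice := by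
    rw [hb, span_units_smul (fun i : Fin B.rank => ε i) fun i => toReal (v i)]
    exact hc1
  refine ⟨b, linearIndependent_of_span_eq B.indep hspan, hspan, ?_, fun j hj => ?_⟩
  · rw [hb]
    exact hc2.units_smul fun i => ε i
  · have hnrm : ∀ k < B.rank, nrm (gs b k) = nrm (gs b₀ k) := by
      intro k hk
      rw [nrm, nrm, toReal_gs ⟨k, hk⟩, toReal_gs ⟨k, hk⟩, hb,
        gramSchmidt_units_smul (fun i : Fin B.rank => ε i) (fun i => toReal (v i)) ⟨k, hk⟩]
      simp only [hb₀]
      rcases Int.units_eq_one_or (ε k) with h | h <;> simp [h]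
    have hlead : isLeader G (gs b) j = isLeader G (gs b₀) j := by
      rw [isLeader, isLeader, leader_congr j fun k hk => hnrm k (by omega)]
    have hne : b₀ j ≠ 0 := by
      rw [hb₀ ⟨j, hj⟩]
      intro h0
      exact hcl.ne_zero ⟨j, hj⟩ (by rw [h0]; exact toReal_zero)
    rw [hlead]
    by_cases h : signFlag (b₀ j) = isLeader G (gs b₀) j
    · have : b j = b₀ j := by simp [b, ε, h]
      rw [this, h]
    · have : b j = -b₀ j := by simp [b, ε, h]
      rw [this, signFlag_neg hne]
      cases h1 : signFlag (b₀ j) <;> cases h2 : isLeader G (gs b₀) j <;> simp_all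

end Sign

/-! ### The residuals of a target -/

section Residual
variable {m n N D Q : ℕ} {b u : ℕ → Fin m → ℚ} {e : ℕ → ℕ}
  {o : ℕ → (Fin m → ℚ) → Fin m → ℚ} {t : Fin m → ℚ}

/-- Residuals of the target `t`: the residual at `n` comes from plain rounding, and the one at the
start `i` of a block `[i, e i)` is obtained from the residual at `e i`, by solving the block
by `o i` and rounding with respect to the first `i` basis vectors. -/
def residual (b u : ℕ → Fin m → ℚ) (n : ℕ) (e : ℕ → ℕ) (o : ℕ → (Fin m → ℚ) → Fin m → ℚ)
    (t : Fin m → ℚ) (i : ℕ) : Fin m → ℚ :=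
  if _h : i < n ∧ i < e i then
    reduce b u 0 i (residual b u n e o t (e i) +
      (reduce b u i (e i) (o i (proj u i (e i) (residual b u n e o t (e i)))) -
        o i (proj u i (e i) (residual b u n e o t (e i)))))
  else reduce b u 0 n t
termination_by n - i

theorem residual_self : residual b u n e o t n = reduce b u 0 n t := by
  rw [residual, dif_neg (by omega)]

theorem residual_of_lt {i : ℕ} (h1 : i < n) (h2 : i < e i) : residual b u n e o t i =
    reduce b u 0 i (residual b u n e o t (e i) +
      (reduce b u i (e i) (o i (proj u i (e i) (residual b u n e o t (e i)))) -
        o i (proj u i (e i) (residual b u n e o t (e i))))) := by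
  rw [residual, dif_pos ⟨h1, h2⟩]

/-- Residuals differ from the target by lattice vectors, whatever the solver for the blocks does. -/
theorem residual_eq_sub_comb (he : ∀ i < n, i < e i ∧ e i ≤ n) {i : ℕ} (hi : i ≤ n) :
    ∃ z, residual b u n e o t i = t - comb b 0 n z := by
  induction hk : n - i using Nat.strong_induction_on generalizing i with
  | _ k ih =>
    rcases hi.eq_or_lt with rfl | hi'
    · rw [residual_self]
      exact reduce_eq_sub_comb t
    · obtain ⟨h1, h2⟩ := he i hi'
      rw [residual_of_lt hi' h1]
      obtain ⟨z1, hz1⟩ := ih (n - e i) (by omega) h2 rfl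
      rw [hz1]
      set v := o i (proj u i (e i) (t - comb b 0 n z1))
      obtain ⟨z2, hz2⟩ := reduce_eq_sub_comb (b := b) (u := u) (lo := i) (hi := e i) v
      rw [hz2]
      obtain ⟨z3, hz3⟩ := reduce_eq_sub_comb (b := b) (u := u) (lo := 0) (hi := i)
        (t - comb b 0 n z1 + (v - comb b i (e i) z2 - v))
      rw [hz3]
      obtain ⟨w2, hw2⟩ := comb_extend (b := b) (Nat.zero_le i) h2 z2
      obtain ⟨w3, hw3⟩ := comb_extend (b := b) (le_refl 0) hi z3
      refine ⟨z1 + w2 + w3, ?_⟩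
      rw [hw2, hw3, ← comb_add, ← comb_add]
      abel

theorem abs_coef_residual_le_half (H : IsGS n b u) (he : ∀ i < n, i < e i ∧ e i ≤ n) {i l : ℕ}
    (hi : i ≤ n) (hl : l < i) : |coef u l (residual b u n e o t i)| ≤ 1 / 2 := by
  rcases hi.eq_or_lt with rfl | hi'
  · rw [residual_self]
    exact H.abs_coef_reduce le_rfl (Nat.zero_le l) hl t
  · rw [residual_of_lt hi' (he i hi').1]
    exact H.abs_coef_reduce hi (Nat.zero_le l) hl _

/-- The coefficients of the residuals stay bounded, since each of them is changed by at most one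
block before it is rounded. -/
theorem abs_coef_residual_le (H : IsGS n b u) (he : ∀ i < n, i < e i ∧ e i ≤ n) {V : ℚ}
    {F : ℕ → Bool} (hF : ∀ i < n, F i = true → e i = n ∨ F (e i) = true)
    (hV : ∀ i < n, F i = true → ∀ l < n,
      |coef u l (o i (proj u i (e i) (residual b u n e o t (e i))))| ≤ V) (hV0 : 0 ≤ V)
    {i : ℕ} (hi : i = n ∨ i < n ∧ F i = true) {l : ℕ} (hl : l < n) :
    |coef u l (residual b u n e o t i)| ≤ 1 + V := by
  induction hk : n - i using Nat.strong_induction_on generalizing i with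
  | _ k ih =>
    rcases hi with rfl | ⟨hi, hFi⟩
    · exact (abs_coef_residual_le_half H he le_rfl hl).trans (by linarith)
    · obtain ⟨h1, h2⟩ := he i hi
      rcases Nat.lt_or_ge l i with hli | hli
      · exact (abs_coef_residual_le_half H he hi.le hli).trans (by linarith)
      · rw [residual_of_lt hi h1, H.coef_reduce_ge hl hli, coef_add, coef_sub]
        rcases Nat.lt_or_ge l (e i) with hle | hle
        · have h3 := abs_coef_residual_le_half (o := o) (t := t) H he h2 hle
          have h4 := H.abs_coef_reduce h2 hli hle
            (o i (proj u i (e i) (residual b u n e o t (e i))))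
          have h5 := hV i hi hFi l hl
          rw [abs_le] at *
          constructor <;> linarith [h3.1, h3.2, h4.1, h4.2, h5.1, h5.2]
        · rw [H.coef_reduce_ge hl hle, sub_self, add_zero]
          refine ih (n - e i) (by omega) ?_ rfl
          rcases hF i hi hFi with h3 | h3
          · exact Or.inl h3
          · exact h2.eq_or_lt.imp id fun h4 => ⟨h4, h3⟩

theorem isDen_residual (hB : GSBound N n b u D Q) (he : ∀ i < n, i < e i ∧ e i ≤ n) {i : ℕ}
    (hi : i ≤ n) (k : Fin m) : IsDen (vecDen t * D) (residual b u n e o t i k) := by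
  obtain ⟨z, hz⟩ := residual_eq_sub_comb (b := b) (u := u) (o := o) (t := t) he hi
  rw [hz]
  exact ((isDen_vecDen t k).of_dvd (dvd_mul_right _ _)).sub
    ((IsDen.comb hB.den_b le_rfl z k).of_dvd (dvd_mul_left _ _))

/-- The targets for the blocks have polynomial size, whatever the solver for the blocks does. -/
theorem size_proj_residual_le (hB : GSBound N n b u D Q) (he : ∀ i < n, i < e i ∧ e i ≤ n) {i : ℕ}
    (hi : i < n) : (encVec (proj u i (e i) (residual b u n e o t (e i)))).size ≤
      N * (3 * ((encVec t).size + N + 27 * (N + 1) ^ 4) + 6 * N + 8) + 1 := by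
  obtain ⟨h1, h2⟩ := he i hi
  have hone : ∀ P, (1 : ℚ) ≤ 2 ^ P := fun P => one_le_pow₀ (by norm_num)
  have key : Tame u n (vecDen t * D * Q) ((encVec t).size + N + 27 * (N + 1) ^ 4)
      (proj u i (e i) (residual b u n e o t (e i))) := by
    refine ⟨fun k => hB.den_proj _ _ _ _ h2 (isDen_residual hB he h2) k, fun l hl => ?_, ?_⟩
    · rw [hB.coef_proj h2 hl]
      split_ifs with h
      · refine (abs_coef_residual_le_half hB.toIsGS he h2 h.2).trans (le_trans ?_ (hone _))
        norm_num
      · rw [abs_zero]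
        positivity
    · rw [hB.proj_proj h2, sub_self, dotProduct_zero]
      positivity
  refine key.size_le hB (Nat.mul_pos (Nat.mul_pos (vecDen_pos t) hB.D_pos) hB.Q_pos) ?_
  refine (Nat.mul_le_mul (Nat.mul_le_mul (vecDen_le t) hB.D_le) hB.Q_le).trans ?_
  rw [← pow_add, ← pow_add]

/-- If the solver for the blocks returns vectors of polynomial size, then so do the residuals. -/
theorem size_residual_le (hB : GSBound N n b u D Q) (he : ∀ i < n, i < e i ∧ e i ≤ n)
    {F : ℕ → Bool} (hF : ∀ i < n, F i = true → e i = n ∨ F (e i) = true) {L : ℕ}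
    (hL : ∀ i < n, F i = true →
      (encVec (o i (proj u i (e i) (residual b u n e o t (e i))))).size ≤ L)
    {i : ℕ} (hi : i = n ∨ i < n ∧ F i = true) : (encVec (residual b u n e o t i)).size ≤
      N * (3 * (2 * (L + (encVec t).size) + 4 * N + 54 * (N + 1) ^ 4 + 1) + 6 * N + 8) + 1 := by
  set P := 2 * (L + (encVec t).size) + 4 * N + 54 * (N + 1) ^ 4 + 1 with hP
  have hi' : i ≤ n := by omega
  have key : Tame u n (vecDen t * D) P (residual b u n e o t i) := by
    refine ⟨isDen_residual hB he hi', fun l hl => ?_, ?_⟩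
    · have h1 := abs_coef_residual_le hB.toIsGS he hF (fun i hi hFi l hl =>
        (tame_of_size_le hB (hL i hi hFi)).coef_le l hl) (by positivity) hi hl
      refine h1.trans ?_
      have h2 : (1 : ℚ) ≤ 2 ^ (2 * L + 3 * N + 54 * (N + 1) ^ 4) := one_le_pow₀ (by norm_num)
      calc (1 : ℚ) + 2 ^ (2 * L + 3 * N + 54 * (N + 1) ^ 4) ≤
          2 ^ (2 * L + 3 * N + 54 * (N + 1) ^ 4) * 2 := by linarith
        _ = 2 ^ (2 * L + 3 * N + 54 * (N + 1) ^ 4 + 1) := (pow_succ _ _).symm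
        _ ≤ 2 ^ P := pow_le_pow_right₀ (by norm_num) (by omega)
    · obtain ⟨z, hz⟩ := residual_eq_sub_comb (b := b) (u := u) (o := o) (t := t) he hi'
      rw [hz, comb_sub_proj hB.toIsGS le_rfl]
      exact (tame_of_size_le hB (le_refl (encVec t).size)).rest_le.trans
        (pow_le_pow_right₀ (by norm_num) (by omega))
  refine key.size_le hB (Nat.mul_pos (vecDen_pos t) hB.D_pos) ?_
  refine (Nat.mul_le_mul (vecDen_le t) hB.D_le).trans ?_
  rw [← pow_add]
  exact Nat.pow_le_pow_right (by norm_num) (by omega)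

end Residual

end CVPP

namespace CVPP

open Finset

/-! ### The query program -/

section Query
variable {ι : Type} {s : ι → ℕ} {a d : ι → Data}

theorem encList_tail (l : List Data) : Op.snd.eval (encList l) = encList l.tail := by
  cases l <;> rfl

theorem PT.tail {l : ι → List Data} (hl : PT s a (fun i => encList (l i))) :
    PT s a (fun i => encList (l i).tail) :=
  (hl.op .snd).congr fun i => encList_tail (l i)

/-- Element number `h` of a list, where `h` is given in unary. -/
theorem PT.getD {l p : ι → List Data} (hl : PT s a (fun i => encList (l i)))
    (hp : PT s a (fun i => encList (p i))) (hd : PT s a d) :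
    PT s a (fun i => (l i).getD (p i).length (d i)) := by
  have h1 := PT.fold (St := fun i r => encList ((l i).drop r)) hp (by simpa using hl)
    (hl.size_right) (fun i j _ => encList_size_sublist (List.drop_sublist _ _))
    (fun a' hc _ hSt => hSt.tail.congr fun k => by rw [List.tail_drop])
  have h2 : PT s a (fun i => encBool (decide ((p i).length < (l i).length))) :=
    (h1.op .isPair).congr fun i => by
      by_cases h : (p i).length < (l i).length
      · rw [List.drop_eq_getElem_cons h]
        simp only [h, decide_true]
        rfl
      · rw [List.drop_eq_nil_of_le (by omega)]
        simp only [h, decide_false]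
        rfl
  refine (PT.ite h2 (h1.op .fst) hd).congr fun i => ?_
  rw [List.getD_eq_getElem?_getD]
  by_cases h : (p i).length < (l i).length
  · rw [List.drop_eq_getElem_cons h, List.getElem?_eq_getElem h, Option.getD_some]
    simp only [h, decide_true, if_true]
    rfl
  · rw [List.getElem?_eq_none (by omega), Option.getD_none]
    simp only [h, decide_false, Bool.false_eq_true, if_false]

variable {m : ℕ}

/-- The shortest of the vectors `S n` and `S i`, for the flagged indices `i` in `[j, n)`. -/
def best (S : ℕ → Fin m → ℚ) (F : ℕ → Bool) (n j : ℕ) : Fin m → ℚ :=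
  (flagged F n j).foldr (fun i r => if S i ⬝ᵥ S i < r ⬝ᵥ r then S i else r) (S n)

theorem best_mem (S : ℕ → Fin m → ℚ) (F : ℕ → Bool) (n j : ℕ) :
    ∃ i, (i = n ∨ i < n ∧ F i = true) ∧ best S F n j = S i := by
  have key : ∀ l : List ℕ, (∀ i ∈ l, i < n ∧ F i = true) →
      ∃ i, (i = n ∨ i < n ∧ F i = true) ∧
        l.foldr (fun i r => if S i ⬝ᵥ S i < r ⬝ᵥ r then S i else r) (S n) = S i := by
    intro l
    induction l with
    | nil => exact fun _ => ⟨n, Or.inl rfl, rfl⟩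
    | cons i l ih =>
      intro hl
      rw [List.foldr_cons]
      split_ifs
      · exact ⟨i, Or.inr (hl i (List.mem_cons_self ..)), rfl⟩
      · exact ih fun k hk => hl k (List.mem_cons_of_mem _ hk)
  exact key _ fun i hi => by
    have := mem_flagged.1 hi
    exact ⟨this.1.2, this.2⟩

theorem best_le {S : ℕ → Fin m → ℚ} {F : ℕ → Bool} {n i : ℕ} (hi : i = n ∨ i < n ∧ F i = true) :
    best S F n 0 ⬝ᵥ best S F n 0 ≤ S i ⬝ᵥ S i := by
  have key : ∀ l : List ℕ, (i = n ∨ i ∈ l) → ∀ r,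
      l.foldr (fun i r => if S i ⬝ᵥ S i < r ⬝ᵥ r then S i else r) (S n) = r →
      r ⬝ᵥ r ≤ S i ⬝ᵥ S i := by
    intro l
    induction l with
    | nil =>
      rintro (rfl | h) r rfl
      · exact le_rfl
      · simp at h
    | cons k l ih =>
      intro hl r hr
      rw [List.foldr_cons] at hr
      have h1 : (i = n ∨ i ∈ l) ∨ i = k := by
        rcases hl with h | h
        · exact Or.inl (Or.inl h)
        · rcases List.mem_cons.1 h with h | h
          · exact Or.inr h
          · exact Or.inl (Or.inr h)
      split_ifs at hr with h
      · subst hr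
        rcases h1 with h1 | rfl
        · exact h.le.trans (ih h1 _ rfl)
        · exact le_rfl
      · subst hr
        rcases h1 with h1 | rfl
        · exact ih h1 _ rfl
        · exact not_lt.1 h
  refine key _ (hi.imp id fun h => ?_) _ rfl
  exact mem_flagged.2 ⟨⟨Nat.zero_le _, h.1⟩, h.2⟩

theorem best_of_lt {S : ℕ → Fin m → ℚ} {F : ℕ → Bool} {n j : ℕ} (hj : j < n) :
    best S F n j = if F j then
      (if S j ⬝ᵥ S j < best S F n (j + 1) ⬝ᵥ best S F n (j + 1) then S j else best S F n (j + 1))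
      else best S F n (j + 1) := by
  rw [best, flagged_of_lt hj]
  split_ifs with h1 h2
  · exact if_pos h2
  · exact if_neg h2
  · rfl

theorem flagged_succ_right (F : ℕ → Bool) (j : ℕ) :
    flagged F (j + 1) 0 = flagged F j 0 ++ if F j then [j] else [] := by
  rw [flagged, flagged, Nat.sub_zero, Nat.sub_zero, List.range'_concat, List.filter_append]
  cases h : F j <;> simp [h]

/-- The part of the advice that concerns the flagged indices below `j`, followed by `h` further
strings. -/
def remaining (F : ℕ → Bool) (adv : ℕ → Data) (pad : Data) (h j : ℕ) : List Data :=
  (flagged F j 0).reverse.map adv ++ List.replicate h pad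

theorem remaining_succ (F : ℕ → Bool) (adv : ℕ → Data) (pad : Data) (h j : ℕ) :
    remaining F adv pad h (j + 1) =
      if F j then adv j :: remaining F adv pad h j else remaining F adv pad h j := by
  rw [remaining, flagged_succ_right]
  split_ifs <;> simp [remaining]

theorem remaining_sublist (F : ℕ → Bool) (adv : ℕ → Data) (pad : Data) (h : ℕ) {j n : ℕ}
    (hj : j ≤ n) : (remaining F adv pad h j).Sublist (remaining F adv pad h n) := by
  induction n, hj using Nat.le_induction with
  | base => exact List.Sublist.refl _
  | succ n _ ih =>
    rw [remaining_succ F adv pad h n]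
    split_ifs
    · exact ih.trans (List.sublist_cons_self _ _)
    · exact ih

/-- The residuals at the flagged indices from `j` on, with these indices. -/
def window (S : ℕ → Fin m → ℚ) (F : ℕ → Bool) (n j : ℕ) : List Data :=
  (flagged F n j).map fun i : ℕ => .pair (.int (i : ℤ)) (encVec (S i))

theorem window_of_lt {S : ℕ → Fin m → ℚ} {F : ℕ → Bool} {n j : ℕ} (hj : j < n) :
    window S F n j = if F j then .pair (.int j) (encVec (S j)) :: window S F n (j + 1)
      else window S F n (j + 1) := by
  rw [window, flagged_of_lt hj]
  split_ifs <;> rfl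

theorem window_getD (S : ℕ → Fin m → ℚ) (F : ℕ → Bool) (h n j : ℕ) :
    (window S F n (j + 1)).getD h (.pair (.int n) (encVec (S n))) =
      .pair (.int (blockEnd F h n j)) (encVec (S (blockEnd F h n j))) := by
  rw [window, blockEnd, List.getD_eq_getElem?_getD, List.getD_eq_getElem?_getD, List.getElem?_map]
  cases (flagged F n (j + 1))[h]? <;> rfl

theorem size_window_le {S : ℕ → Fin m → ℚ} {F : ℕ → Bool} {n j K : ℕ}
    (hK : ∀ i, i < n ∧ F i = true → (encVec (S i)).size ≤ K) :
    (encList (window S F n j)).size ≤ n * (n + 1 + K + 1 + 1) + 1 := by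
  have hlen : (window S F n j).length ≤ n := by
    rw [window, List.length_map, flagged]
    refine (List.length_filter_le _ _).trans ?_
    rw [List.length_range']
    omega
  refine (encList_size_le _ (n + 1 + K + 1) fun x hx => ?_).trans
    (Nat.succ_le_succ (Nat.mul_le_mul_right _ hlen))
  obtain ⟨i, hi, rfl⟩ := List.mem_map.1 hx
  have h1 := mem_flagged.1 hi
  have h2 := hK i ⟨h1.1.2, h1.2⟩
  have h3 := size_int_le h1.1.2.le
  change (Data.int (i : ℤ)).size + (encVec (S i)).size + 1 ≤ _
  omega

end Query

section Main
variable {ι : Type} {s : ι → ℕ} {a : ι → Data} {m n h : ι → ℕ} {b u : ∀ i, ℕ → Fin (m i) → ℚ}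
  {F : ι → ℕ → Bool} {adv : ι → ℕ → Data} {pad : Data} {t : ∀ i, Fin (m i) → ℚ}
  {o : ∀ i, ℕ → (Fin (m i) → ℚ) → Fin (m i) → ℚ}

/-- The indices of the blocks that are solved. -/
abbrev Block (n : ι → ℕ) (F : ι → ℕ → Bool) : Type :=
  {k : Σ i, Fin (n i) // F k.1 k.2 = true}

/-- The shortest residual can be computed in polynomial time. The state of the main loop consists of
the residuals found so far, the advice not used yet, and the shortest residual so far; the advice of
the next block is at the head of the remaining advice exactly when its start is reached. -/
theorem PT.best
    (hT : PTTable s a n b u) (hn : PT s a (fun i => .int (n i)))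
    (hF : ∀ i, ∀ j < n i, CVPP.signFlag (b i j) = F i j)
    (hadv : PT s a (fun i => encList (remaining (F i) (adv i) pad (h i) (n i))))
    (ht : PT s a (fun i => encVec (t i)))
    {S : ∀ i, ℕ → Fin (m i) → ℚ}
    (hS : ∀ i, S i = residual (b i) (u i) (n i) (blockEnd (F i) (h i) (n i)) (o i) (t i))
    {K : ι → ℕ} (hK : PB s K)
    (hSK : ∀ i j, j = n i ∨ j < n i ∧ F i j = true → (encVec (S i j)).size ≤ K i)
    (ho : ∀ (a' : Block n F → Data),
      PT (fun k => s k.1.1) a' (fun k => adv k.1.1 k.1.2) →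
      PT (fun k => s k.1.1) a' (fun k => encVec (CVPP.proj (u k.1.1) k.1.2
        (blockEnd (F k.1.1) (h k.1.1) (n k.1.1) k.1.2)
        (S k.1.1 (blockEnd (F k.1.1) (h k.1.1) (n k.1.1) k.1.2)))) →
      PT (fun k => s k.1.1) a' (fun k => encVec (o k.1.1 k.1.2 (CVPP.proj (u k.1.1) k.1.2
        (blockEnd (F k.1.1) (h k.1.1) (n k.1.1) k.1.2)
        (S k.1.1 (blockEnd (F k.1.1) (h k.1.1) (n k.1.1) k.1.2)))))) :
    PT s a (fun i => encVec (best (S i) (F i) (n i) 0)) := by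
  obtain ⟨N, hN, hB⟩ := hT.bound
  have hnN : ∀ i, n i ≤ N i := fun i => by
    obtain ⟨D, Q, h⟩ := hB i
    exact h.n_le
  have hzero : PT s a (fun _ => .int ((0 : ℕ) : ℤ)) := PT.const hn.size_left _
  have hSn : PT s a (fun i => encVec (S i (n i))) :=
    (PT.reduce hT (fun _ => le_rfl) hzero hn ht).congr fun i => by
      rw [hS, residual_self]
  -- The advice strings that are left over at the end tell `h` in unary.
  have hpads : PT s a (fun i => encList (remaining (F i) (adv i) pad (h i) 0)) := by
    refine PT.foldDown (St := fun i j => encList (remaining (F i) (adv i) pad (h i) j))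
      hT.table hadv hadv.size_right
      (fun i j hj => encList_size_sublist (remaining_sublist _ _ _ _ hj)) ?_
    intro a' hc hj hb hu hSt
    refine (PT.ite hb.signFlag hSt.tail hSt).congr fun k => ?_
    rw [remaining_succ, hF k.1 k.2 k.2.2]
    split_ifs <;> rfl
  have key := PT.foldDown (St := fun i j => .pair (encList (window (S i) (F i) (n i) j))
      (.pair (encList (remaining (F i) (adv i) pad (h i) j))
        (encVec (CVPP.best (S i) (F i) (n i) j))))
    (K := fun i => N i * (N i + 1 + K i + 1 + 1) + 1 +
      ((encList (remaining (F i) (adv i) pad (h i) (n i))).size + K i + 1) + 1)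
    hT.table ?_ ?_ ?_ ?_
  · exact key.snd.snd
  · refine ((PT.const hn.size_left (.int 0)).pair (hadv.pair hSn)).congr fun i => ?_
    rw [window, CVPP.best, flagged_self]
    rfl
  · exact (((hN.mul ((((hN.add (PB.const 1)).add hK).add (PB.const 1)).add (PB.const 1))).add
      (PB.const 1)).add ((hadv.size_right.add hK).add (PB.const 1))).add (PB.const 1)
  · intro i j hj
    have h1 := size_window_le (j := j) (S := S i) (F := F i) fun k hk => hSK i k (Or.inr hk)
    have h2 := encList_size_sublist (remaining_sublist (F i) (adv i) pad (h i) hj)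
    obtain ⟨k, hk, hk'⟩ := best_mem (S i) (F i) (n i) j
    have h3 := hSK i k hk
    rw [← hk'] at h3
    have h4 : n i * (n i + 1 + K i + 1 + 1) ≤ N i * (N i + 1 + K i + 1 + 1) :=
      Nat.mul_le_mul (hnN i) (by have := hnN i; omega)
    rw [Data.size, Data.size]
    omega
  · intro a' hc hj hb hu hSt
    have hflag : PT (fun k : Σ i, Fin (n i) => s k.1) a' (fun k => encBool (F k.1 k.2)) :=
      hb.signFlag.congr fun k => by rw [hF k.1 k.2 k.2.2]
    refine PT.condBool hflag ?_ ?_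
    · -- A block starts at `j`.
      let A : Block n F → Data := fun k => a' k.1
      have lift : ∀ c, PT s a c → PT (fun k : Block n F => s k.1.1) A (fun k => c k.1.1) :=
        fun c h => (hc c h).reindex Subtype.val
      have hT' := hT.lift (fun k : Block n F => k.1.1) lift
      have hj' : PT (fun k : Block n F => s k.1.1) A (fun k => .int ((k.1.2 : ℕ) : ℤ)) :=
        hj.reindex Subtype.val
      have hSt' := hSt.reindex (Subtype.val : Block n F → _)
      have hadv' : PT (fun k : Block n F => s k.1.1) A (fun k => .pair (adv k.1.1 k.1.2)
          (encList (remaining (F k.1.1) (adv k.1.1) pad (h k.1.1) k.1.2))) :=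
        hSt'.snd.fst.congr fun k => by
          rw [remaining_succ, if_pos k.2]
          rfl
      have hend : PT (fun k : Block n F => s k.1.1) A (fun k =>
          .pair (.int (blockEnd (F k.1.1) (h k.1.1) (n k.1.1) k.1.2))
            (encVec (S k.1.1 (blockEnd (F k.1.1) (h k.1.1) (n k.1.1) k.1.2)))) :=
        (PT.getD hSt'.fst (lift _ hpads) ((lift _ hn).pair (lift _ hSn))).congr fun k => by
          rw [← window_getD]
          congr 1
          simp [remaining, flagged_self]
      have hle : ∀ k : Block n F, (k.1.2 : ℕ) < blockEnd (F k.1.1) (h k.1.1) (n k.1.1) k.1.2 ∧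
          blockEnd (F k.1.1) (h k.1.1) (n k.1.1) k.1.2 ≤ n k.1.1 :=
        fun k => blockEnd_bounds k.1.2.2
      have hτ := PT.proj hT' (fun k => (hle k).2) hj' hend.fst hend.snd
      have hv := ho A hadv'.fst hτ
      have hw := PT.reduce hT' (fun k => (hle k).2) hj' hend.fst hv
      have hnew := (PT.reduce hT' (fun k : Block n F => k.1.2.2.le) (lift _ hzero) hj'
        (hend.snd.vecAdd (hw.vecSub hv))).congr (c := fun k => encVec (S k.1.1 k.1.2)) fun k => by
          rw [hS, residual_of_lt k.1.2.2 (hle k).1]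
      have hold := hSt'.snd.snd
      refine (((hj'.pair hnew).pair hSt'.fst).pair (hadv'.snd.pair
        (PT.ite ((hnew.dot hnew).ratLt (hold.dot hold)) hnew hold))).congr fun k => ?_
      have hk : (k.1.2 : ℕ) < n k.1.1 := k.1.2.2
      rw [window_of_lt hk, best_of_lt hk, if_pos k.2, if_pos k.2]
      simp only [decide_eq_true_eq]
      rw [encList, apply_ite encVec]
    · have hSt' := hSt.reindex
        (Subtype.val : {k : Σ i, Fin (n i) // F k.1 k.2 = false} → Σ i, Fin (n i))
      refine hSt'.congr fun k => ?_
      have hk : (k.1.2 : ℕ) < n k.1.1 := k.1.2.2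
      have hFk : ¬(F k.1.1 k.1.2 = true) := by rw [k.2]; exact Bool.false_ne_true
      rw [window_of_lt hk, best_of_lt hk, if_neg hFk, if_neg hFk, remaining_succ, if_neg hFk]

end Main

end CVPP

namespace CVPP

open Finset Submodule

/-! ### The algorithm -/

section Algorithm

/-- An HKZ basis whose signs tell at which indices blocks start. -/
noncomputable def LatticeBasis.hkz (G : ℝ) (B : LatticeBasis) : ℕ → Fin B.dim → ℚ :=
  (exists_signed_isHKZ G B).choose

variable (g : ℕ → ℝ) (h : ℕ → ℕ) (A : PreprocAlg) (B : LatticeBasis)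

theorem LatticeBasis.hkz_spec (G : ℝ) :
    LinearIndependent ℝ (fun i : Fin B.rank => toReal (B.hkz G i)) ∧
    span ℤ (Set.range fun i : Fin B.rank => toReal (B.hkz G i)) = B.lattice ∧
    IsHKZ B.rank (fun i : Fin B.rank => toReal (B.hkz G i)) ∧
    ∀ j < B.rank, signFlag (B.hkz G j) = isLeader G (gs (B.hkz G)) j :=
  (exists_signed_isHKZ G B).choose_spec

theorem LatticeBasis.isGS_hkz (G : ℝ) : IsGS B.rank (B.hkz G) (gs (B.hkz G)) :=
  isGS_gs (B.hkz_spec G).1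

theorem LatticeBasis.exists_gsBound_hkz (G : ℝ) :
    ∃ D Q, GSBound (2 * B.enc.size) B.rank (B.hkz G) (gs (B.hkz G)) D Q :=
  exists_gsBound_of_isHKZ B (B.hkz_spec G).1 (B.hkz_spec G).2.1 (B.hkz_spec G).2.2.1

/-- Whether a block starts at `j`. -/
noncomputable def LatticeBasis.blockStart (j : ℕ) : Bool :=
  isLeader (g B.rank) (gs (B.hkz (g B.rank))) j

/-- The end of the block that starts at `j`. -/
noncomputable def LatticeBasis.blockStop (j : ℕ) : ℕ := blockEnd (B.blockStart g) (h B.rank) B.rank j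

theorem LatticeBasis.blockStop_bounds {j : ℕ} (hj : j < B.rank) :
    j < B.blockStop g h j ∧ B.blockStop g h j ≤ B.rank := blockEnd_bounds hj

theorem LatticeBasis.blockStart_blockStop (hg : 1 ≤ g B.rank) {j : ℕ} (hj : j < B.rank)
    (hF : B.blockStart g j = true) : B.blockStop g h j = B.rank ∨ B.blockStart g (B.blockStop g h j) = true :=
  (blockEnd_leader hg hj hF).imp id fun h => h.2.1

/-- The lattice of integers. -/
def intLattice : LatticeBasis where
  rank := 1
  dim := 1
  vec _ _ := 1
  rank_pos := le_rfl
  indep := by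
    refine linearIndependent_unique_iff.2 fun h0 => ?_
    have h1 := congrFun (toReal_injective (h0.trans toReal_zero.symm)) 0
    exact one_ne_zero h1

/-- The lattice of the block that starts at `j`. -/
noncomputable def LatticeBasis.block (j : ℕ) : LatticeBasis :=
  if hj : j < B.rank then
    blockBasis (B.isGS_hkz (g B.rank)) (B.blockStop_bounds g h hj).1 (B.blockStop_bounds g h hj).2
  else intLattice

/-- The lattices whose advice is used: one for each block, in descending order, and `h` lattices
of rank one, which tell `h` to the query algorithm. -/
noncomputable def LatticeBasis.blocks : List LatticeBasis :=
  (flagged (B.blockStart g) B.rank 0).reverse.map (B.block g h) ++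
    List.replicate (h B.rank) intLattice

theorem LatticeBasis.map_blocks : (B.blocks g h).map A.preprocess =
    remaining (B.blockStart g) (fun j => A.preprocess (B.block g h j)) (A.preprocess intLattice)
      (h B.rank) B.rank := by
  rw [LatticeBasis.blocks, remaining, List.map_append, List.map_map, List.map_replicate]
  rfl

/-- The `h` lattices of rank one use up what `sum_blocks` leaves of the bound. -/
theorem LatticeBasis.sum_rank_blocks :
    ((B.blocks g h).map LatticeBasis.rank).sum ≤ B.rank * (h B.rank + 1) := by
  have h1 := sum_blocks (h := h B.rank) B.rank_pos
    (show B.blockStart g 0 = true from isLeader_zero)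
  rw [LatticeBasis.blocks, List.map_append, List.map_map, List.map_replicate, List.map_reverse,
    List.sum_append, List.sum_reverse, List.sum_replicate]
  have h2 : (flagged (B.blockStart g) B.rank 0).map (LatticeBasis.rank ∘ B.block g h) =
      (flagged (B.blockStart g) B.rank 0).map fun i => B.blockStop g h i - i := by
    refine List.map_congr_left fun i hi => ?_
    have hi' := (mem_flagged.1 hi).1.2
    rw [Function.comp_apply, LatticeBasis.block, dif_pos hi']
    rfl
  rw [h2]
  refine le_trans (le_of_eq ?_) h1
  exact congrArg _ (mul_one (h B.rank))

open Classical in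
/-- The output of the query algorithm. -/
noncomputable def PreprocAlg.answer (B : LatticeBasis) (t : Fin B.dim → ℚ) : Data :=
  if h : ∃ y k, Run A.query (A.queryInput B t) y k then h.choose else .int 0

variable {A B} in
theorem PreprocAlg.answer_eq {t : Fin B.dim → ℚ} {y : Data} {k : ℕ}
    (h : Run A.query (A.queryInput B t) y k) : A.answer B t = y := by
  have h' : ∃ y k, Run A.query (A.queryInput B t) y k := ⟨y, k, h⟩
  rw [PreprocAlg.answer, dif_pos h']
  exact h'.choose_spec.choose_spec.unique h

/-- The vector that the algorithm `A` returns on the block at `j`. -/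
noncomputable def PreprocAlg.solve (j : ℕ) (τ : Fin B.dim → ℚ) : Fin B.dim → ℚ :=
  if hj : j < B.rank then
    decVec B.dim (A.answer
      (blockBasis (B.isGS_hkz (g B.rank)) (B.blockStop_bounds g h hj).1 (B.blockStop_bounds g h hj).2) τ)
  else 0

/-- The residuals of a target. -/
noncomputable def PreprocAlg.resid (t : Fin B.dim → ℚ) : ℕ → Fin B.dim → ℚ :=
  residual (B.hkz (g B.rank)) (gs (B.hkz (g B.rank))) B.rank (B.blockStop g h) (A.solve g h B) t

/-- The preprocessing: the signed HKZ basis and the advice for the blocks. -/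
noncomputable def PreprocAlg.advice : Data :=
  .pair (encList (List.ofFn fun i : Fin B.rank => encVec (B.hkz (g B.rank) i)))
    (encList ((B.blocks g h).map A.preprocess))

/-! ### Correctness -/

/-- One of the residuals is short, since the given algorithm keeps its promise on the blocks. -/
theorem exists_short_resid {α : ℕ → ℝ}
    (hα_pos : ∀ n, 1 ≤ n → 0 < α n)
    (hα_le : ∀ n, 1 ≤ n → α n ≤ 1 / 2)
    (hα_anti : ∀ m n, 1 ≤ m → m ≤ n → α n ≤ α m)
    (hg_one : ∀ n, 1 ≤ n → 1 ≤ g n)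
    (hg_mono : ∀ m n, 1 ≤ m → m ≤ n → g m ≤ g n)
    (hh_mono : ∀ m n, 1 ≤ m → m ≤ n → h m ≤ h n)
    (hgh : ∀ n, 1 ≤ n → g n ^ ((h n : ℤ) - 1) ≤ Real.sqrt (n : ℝ))
    (hA : A.Solves (fun n => g n ^ h n / (2 * α n))
      (fun B t => toReal t ∈ B.space ∧ B.distTo t < α B.rank * lambda1 B.lattice))
    (t : Fin B.dim → ℚ) :
    ∃ i, (i = B.rank ∨ i < B.rank ∧ B.blockStart g i = true) ∧
      nrm (A.resid g h B t i) ≤ g B.rank * Real.sqrt B.rank / (2 * α B.rank) * B.distTo t := by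
  obtain ⟨hli, hspan, hhkz, hflag⟩ := B.hkz_spec (g B.rank)
  have H := B.isGS_hkz (g B.rank)
  have hn := B.rank_pos
  obtain ⟨c, hc, hdist⟩ := exists_closest B.indep (toReal t)
  obtain ⟨z, rfl⟩ := exists_comb_of_mem (n := B.rank) (b := B.hkz (g B.rank)) (x := c)
    (by rw [hspan]; exact hc)
  have hdist' : B.distTo t = nrm (t - comb (B.hkz (g B.rank)) 0 B.rank z) := by
    rw [nrm, toReal_sub]
    exact hdist.symm
  have hmin : ∀ i e z, i < e → e ≤ B.rank →
      proj (gs (B.hkz (g B.rank))) i e (comb (B.hkz (g B.rank)) i e z) ≠ 0 →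
      nrm (gs (B.hkz (g B.rank)) i) ≤
        nrm (proj (gs (B.hkz (g B.rank))) i e (comb (B.hkz (g B.rank)) i e z)) :=
    fun i e z hie hen => hhkz.nrm_gs_le hli hie hen z
  rw [hdist']
  refine H.exists_short_residual hn hα_pos hα_le hα_anti hg_one hg_mono hh_mono hgh
    (e := B.blockStop g h)
    (v := fun i => A.solve g h B i (proj (gs (B.hkz (g B.rank))) i (B.blockStop g h i)
      (A.resid g h B t (B.blockStop g h i)))) hmin ?_ residual_self ?_ ?_ ⟨z, rfl⟩
  · intro i hi hF
    exact ⟨(B.blockStop_bounds g h hi).1, (B.blockStop_bounds g h hi).2,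
      blockEnd_leader (hg_one _ hn) hi hF⟩
  · intro i hi hF
    exact residual_of_lt hi (B.blockStop_bounds g h hi).1
  · intro i hi hF z hz
    obtain ⟨h1, h2⟩ := B.blockStop_bounds g h hi
    set τ := proj (gs (B.hkz (g B.rank))) i (B.blockStop g h i) (A.resid g h B t (B.blockStop g h i)) with hτ
    have hsz : 1 ≤ B.blockStop g h i - i := by omega
    have hd : (blockBasis H h1 h2).distTo τ ≤ _ := distTo_block_le H h1 h2 τ z
    have hlam := nrm_le_lambda1_block H h1 h2 (r := nrm (gs (B.hkz (g B.rank)) i))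
      fun z hz => hmin i _ z h1 h2 hz
    obtain ⟨w, k, hrun, hw, hwd⟩ := hA (blockBasis H h1 h2) τ ⟨H.toReal_proj_mem h2 _,
      hd.trans_lt (hz.trans_le (mul_le_mul_of_nonneg_left hlam (hα_pos _ hsz).le))⟩
    have hsolve : A.solve g h B i τ = w := by
      rw [PreprocAlg.solve, dif_pos hi, PreprocAlg.answer_eq hrun]
      exact decVec_encVec w
    obtain ⟨z', hz'⟩ := (mem_blockBasis_lattice H h1 h2 _).1 hw
    rw [hsolve]
    refine ⟨z', toReal_injective hz', ?_⟩
    refine (congrArg norm (toReal_sub (m := B.dim) τ w)).trans_le (hwd.trans (mul_le_mul_of_nonneg_left hd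
      (div_nonneg (pow_nonneg ?_ _) ?_)))
    · exact zero_le_one.trans (hg_one _ hsz)
    · exact mul_nonneg zero_le_two (hα_pos _ hsz).le

/-! ### Complexity -/

theorem LatticeBasis.blockStart_eq {j : ℕ} (hj : j < B.rank) :
    signFlag (B.hkz (g B.rank) j) = B.blockStart g j := (B.hkz_spec (g B.rank)).2.2.2 j hj

theorem LatticeBasis.size_hkz_le (G : ℝ) {j : ℕ} (hj : j < B.rank) :
    (encVec (B.hkz G j)).size ≤ 2 * B.enc.size * (3 * (2 * B.enc.size) + 7) + 1 := by
  obtain ⟨D, Q, hB⟩ := B.exists_gsBound_hkz G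
  exact hB.size_b_le hj

theorem sizeBound_mono {N L L' : ℕ} (h : L ≤ L') : sizeBound N L ≤ sizeBound N L' := by
  unfold sizeBound
  gcongr

theorem LatticeBasis.size_block_le {j : ℕ} (hj : j < B.rank) :
    (B.block g h j).enc.size ≤ 2 * B.enc.size * (sizeBound (2 * B.enc.size)
      (2 * B.enc.size * (3 * (2 * B.enc.size) + 7) + 1) + 1) + 1 := by
  obtain ⟨D, Q, hB⟩ := B.exists_gsBound_hkz (g B.rank)
  have h12 := B.blockStop_bounds g h hj
  rw [LatticeBasis.block, dif_pos hj, LatticeBasis.enc]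
  refine (encList_size_le _ (sizeBound (2 * B.enc.size)
    (2 * B.enc.size * (3 * (2 * B.enc.size) + 7) + 1)) fun x hx => ?_).trans ?_
  · obtain ⟨k, rfl⟩ := (List.mem_ofFn).1 hx
    have hk : j + k < B.rank := by
      have h1 : (k : ℕ) < B.blockStop g h j - j := k.2
      omega
    exact (hB.size_proj_le h12.2).trans (sizeBound_mono (B.size_hkz_le _ hk))
  · rw [List.length_ofFn]
    refine Nat.succ_le_succ (Nat.mul_le_mul_right _ ?_)
    have h1 := B.rank_le
    change B.blockStop g h j - j ≤ _
    omega

theorem length_flagged_le (F : ℕ → Bool) (n j : ℕ) : (flagged F n j).length ≤ n := by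
  rw [flagged]
  refine (List.length_filter_le _ _).trans ?_
  rw [List.length_range']
  omega

variable {g h A}

/-- The bound of `LatticeBasis.size_hkz_le` is polynomial. -/
theorem PB.hkz {ι : Type} {s N : ι → ℕ} (hN : PB s N) :
    PB s (fun i => 2 * N i * (3 * (2 * N i) + 7) + 1) :=
  ((((PB.const 2).mul hN).mul (((PB.const 3).mul ((PB.const 2).mul hN)).add
    (PB.const 7))).add (PB.const 1))

/-- The bound of `LatticeBasis.size_block_le` is polynomial. -/
theorem PB.block {ι : Type} {s N : ι → ℕ} (hN : PB s N) :
    PB s (fun i => 2 * N i * (CVPP.sizeBound (2 * N i) (2 * N i * (3 * (2 * N i) + 7) + 1) + 1)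
      + 1) :=
  ((((PB.const 2).mul hN).mul ((PB.sizeBound ((PB.const 2).mul hN) hN.hkz).add
    (PB.const 1))).add (PB.const 1))

/-- The advice has polynomial length. -/
theorem pb_advice {p : Polynomial ℕ} (hh : ∀ n, 1 ≤ n → h n < n)
    (hp : ∀ B : LatticeBasis, (A.preprocess B).size ≤ p.eval B.enc.size) :
    PB (fun B : LatticeBasis => B.enc.size) (fun B => (A.advice g h B).size) := by
  have hs : PB (fun B : LatticeBasis => B.enc.size) fun B => B.enc.size := PB.self
  have h1 := (hs.mul (hs.hkz.add (PB.const 1))).add (PB.const 1)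
  have h2 := (((PB.const 2).mul hs).mul (((hs.block.poly p).add
    (PB.const (A.preprocess intLattice).size)).add (PB.const 1))).add (PB.const 1)
  refine ((h1.add h2).add (PB.const 1)).mono fun B => ?_
  have h3 : (encList (List.ofFn fun i : Fin B.rank => encVec (B.hkz (g B.rank) i))).size ≤
      B.enc.size * (2 * B.enc.size * (3 * (2 * B.enc.size) + 7) + 1 + 1) + 1 := by
    refine (encList_size_le _ (2 * B.enc.size * (3 * (2 * B.enc.size) + 7) + 1)
      fun x hx => ?_).trans ?_
    · obtain ⟨k, rfl⟩ := (List.mem_ofFn).1 hx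
      exact B.size_hkz_le _ k.2
    · rw [List.length_ofFn]
      exact Nat.succ_le_succ (Nat.mul_le_mul_right _ B.rank_le)
  have h4 : (encList ((B.blocks g h).map A.preprocess)).size ≤ 2 * B.enc.size *
      (p.eval (2 * B.enc.size * (sizeBound (2 * B.enc.size)
        (2 * B.enc.size * (3 * (2 * B.enc.size) + 7) + 1) + 1) + 1) +
        (A.preprocess intLattice).size + 1) + 1 := by
    refine (encList_size_le _ (p.eval (2 * B.enc.size * (sizeBound (2 * B.enc.size)
        (2 * B.enc.size * (3 * (2 * B.enc.size) + 7) + 1) + 1) + 1) +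
        (A.preprocess intLattice).size) fun x hx => ?_).trans ?_
    · rw [LatticeBasis.blocks, List.map_append, List.mem_append, List.map_map,
        List.map_replicate] at hx
      rcases hx with hx | hx
      · obtain ⟨j, hj, rfl⟩ := List.mem_map.1 hx
        have hj' := (mem_flagged.1 (List.mem_reverse.1 hj)).1.2
        exact (hp _).trans ((eval_mono p (B.size_block_le g h hj')).trans (Nat.le_add_right _ _))
      · rw [List.eq_of_mem_replicate hx]
        exact Nat.le_add_left _ _
    · refine Nat.succ_le_succ (Nat.mul_le_mul_right _ ?_)
      rw [List.length_map, LatticeBasis.blocks, List.length_append, List.length_map,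
        List.length_reverse, List.length_replicate]
      have h5 := length_flagged_le (B.blockStart g) B.rank 0
      have h6 := hh B.rank B.rank_pos
      have h7 := B.rank_le
      omega
  change _ + _ + 1 ≤ _
  exact Nat.succ_le_succ (Nat.add_le_add h3 h4)

/-- The length of a query: a basis and a target. -/
def querySize (k : Σ B : LatticeBasis, (Fin B.dim → ℚ)) : ℕ := k.1.enc.size + (encVec k.2).size

theorem PreprocAlg.exists_run_answer {p : Polynomial ℕ}
    (hp : ∀ (B : LatticeBasis) (t : Fin B.dim → ℚ), toReal t ∈ B.space →
      ∃ (y : Data) (k : ℕ), Run A.query (A.queryInput B t) y k ∧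
        k ≤ p.eval (B.enc.size + (encVec t).size))
    (B : LatticeBasis) (t : Fin B.dim → ℚ) (ht : toReal t ∈ B.space) :
    ∃ k ≤ p.eval (B.enc.size + (encVec t).size),
      Run A.query (.pair (A.preprocess B) (encVec t)) (A.answer B t) k := by
  obtain ⟨y, k, hrun, hk⟩ := hp B t ht
  rw [answer_eq hrun]
  exact ⟨k, hk, hrun⟩

/-- The block algorithm runs in polynomial time on all targets that occur, whether or not they
satisfy its promise, since they lie in the span of the block. -/
theorem PT.solve {κ : Type} {s : κ → ℕ} {a : κ → Data} {B : κ → LatticeBasis} {j : κ → ℕ}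
    {x : ∀ k, Fin (B k).dim → ℚ}
    (hA : A.PolyTime fun B t => toReal t ∈ B.space) (hs : PB s fun k => (B k).enc.size)
    (hj : ∀ k, j k < (B k).rank)
    (hadv : PT s a (fun k => A.preprocess ((B k).block g h (j k))))
    (hx : PT s a (fun k => encVec (CVPP.proj (gs ((B k).hkz (g (B k).rank))) (j k)
      ((B k).blockStop g h (j k)) (x k)))) :
    PT s a (fun k => encVec (A.solve g h (B k) (j k) (CVPP.proj (gs ((B k).hkz (g (B k).rank)))
      (j k) ((B k).blockStop g h (j k)) (x k)))) := by
  obtain ⟨p, -, hp⟩ := hA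
  have hans : PT s a (fun k => A.answer
      (blockBasis ((B k).isGS_hkz (g (B k).rank)) ((B k).blockStop_bounds g h (hj k)).1
        ((B k).blockStop_bounds g h (hj k)).2)
      (CVPP.proj (gs ((B k).hkz (g (B k).rank))) (j k) ((B k).blockStop g h (j k)) (x k))) := by
    refine (hadv.pair hx).trans ⟨A.query, _, (hs.block.add hx.size_right).poly p, fun k => ?_⟩
    have hb : (B k).block g h (j k) = blockBasis ((B k).isGS_hkz (g (B k).rank))
        ((B k).blockStop_bounds g h (hj k)).1 ((B k).blockStop_bounds g h (hj k)).2 := by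
      rw [LatticeBasis.block, dif_pos (hj k)]
    obtain ⟨l, hl, hrun⟩ := PreprocAlg.exists_run_answer hp
      (blockBasis ((B k).isGS_hkz (g (B k).rank)) ((B k).blockStop_bounds g h (hj k)).1
        ((B k).blockStop_bounds g h (hj k)).2)
      (CVPP.proj (gs ((B k).hkz (g (B k).rank))) (j k) ((B k).blockStop g h (j k)) (x k))
      (((B k).isGS_hkz (g (B k).rank)).toReal_proj_mem ((B k).blockStop_bounds g h (hj k)).2 (x k))
    refine ⟨l, hl.trans (eval_mono p (Nat.add_le_add ?_ le_rfl)), ?_⟩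
    · rw [← hb]
      exact (B k).size_block_le g h (hj k)
    · simp only [hb]
      exact hrun
  refine (hx.decVec hans).congr fun k => ?_
  rw [PreprocAlg.solve, dif_pos (hj k)]

/-- One program computes the output, the target minus the shortest residual, in polynomial time. -/
theorem exists_query {p : Polynomial ℕ} (hh : ∀ n, 1 ≤ n → h n < n)
    (hg : ∀ n, 1 ≤ n → 1 ≤ g n) (hA : A.PolyTime fun B t => toReal t ∈ B.space)
    (hp : ∀ B : LatticeBasis, (A.preprocess B).size ≤ p.eval B.enc.size) :
    PT querySize (fun k => .pair (A.advice g h k.1) (encVec k.2))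
      (fun k => encVec (k.2 - best (A.resid g h k.1 k.2) (k.1.blockStart g) k.1.rank 0)) := by
  have hself : PB querySize querySize := PB.self
  have hs : PB querySize (fun k => k.1.enc.size) := hself.mono fun k => Nat.le_add_right _ _
  have hts : PB querySize (fun k => (encVec k.2).size) :=
    hself.mono fun k => Nat.le_add_left _ _
  have hin : PT querySize (fun k => .pair (A.advice g h k.1) (encVec k.2))
      (fun k => .pair (A.advice g h k.1) (encVec k.2)) :=
    PT.refl (((hs.trans ((pb_advice hh hp).reindex Sigma.fst)).add hts).add (PB.const 1))
  have ht := hin.snd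
  have hadv : PT querySize _ (fun k => encList (remaining (k.1.blockStart g)
      (fun j => A.preprocess (k.1.block g h j)) (A.preprocess intLattice) (h k.1.rank)
      k.1.rank)) := hin.fst.snd.congr fun k => by rw [LatticeBasis.map_blocks]
  have hB : ∀ k : Σ B : LatticeBasis, (Fin B.dim → ℚ), ∃ D Q, GSBound (2 * k.1.enc.size)
      k.1.rank (k.1.hkz (g k.1.rank)) (gs (k.1.hkz (g k.1.rank))) D Q :=
    fun k => k.1.exists_gsBound_hkz _
  have hN : PB querySize (fun k => 2 * k.1.enc.size) := (PB.const 2).mul hs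
  obtain ⟨hT, hn⟩ := PT.gsTable (n := fun k : Σ B : LatticeBasis, (Fin B.dim → ℚ) => k.1.rank)
    (b := fun k => k.1.hkz (g k.1.rank)) hin.fst.fst ⟨_, hN, hB⟩
  have hs' := hs.reindex (fun k : Block (fun k : Σ B : LatticeBasis, (Fin B.dim → ℚ) => k.1.rank)
    (fun k => k.1.blockStart g) => k.1.1)
  -- The outputs of the block algorithm have polynomial size.
  obtain ⟨q, hq⟩ : PB (fun k : Block (fun k : Σ B : LatticeBasis, (Fin B.dim → ℚ) => k.1.rank)
      (fun k => k.1.blockStart g) => querySize k.1.1) (fun k => (encVec (A.solve g h k.1.1.1 k.1.2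
        (CVPP.proj (gs (k.1.1.1.hkz (g k.1.1.1.rank))) k.1.2 (k.1.1.1.blockStop g h k.1.2)
          (A.resid g h k.1.1.1 k.1.1.2 (k.1.1.1.blockStop g h k.1.2))))).size) := by
    have h1 := PT.refl (a := fun k : Block (fun k : Σ B : LatticeBasis, (Fin B.dim → ℚ) =>
      k.1.rank) (fun k => k.1.blockStart g) => .pair (A.preprocess (k.1.1.1.block g h k.1.2))
        (encVec (CVPP.proj (gs (k.1.1.1.hkz (g k.1.1.1.rank))) k.1.2 (k.1.1.1.blockStop g h k.1.2)
          (A.resid g h k.1.1.1 k.1.1.2 (k.1.1.1.blockStop g h k.1.2)))))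
      (s := fun k => querySize k.1.1) (by
        have hN' := hN.reindex (fun k : Block (fun k : Σ B : LatticeBasis, (Fin B.dim → ℚ) =>
          k.1.rank) (fun k => k.1.blockStart g) => k.1.1)
        have hts' := hts.reindex (fun k : Block (fun k : Σ B : LatticeBasis, (Fin B.dim → ℚ) =>
          k.1.rank) (fun k => k.1.blockStart g) => k.1.1)
        refine (((hs'.block.poly p).add ((hN'.mul ((((PB.const 3).mul ((hts'.add hN').add
          ((PB.const 27).mul ((hN'.add (PB.const 1)).pow 4)))).add ((PB.const 6).mul hN')).add
          (PB.const 8))).add (PB.const 1))).add (PB.const 1)).mono fun k => ?_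
        obtain ⟨D, Q, hBk⟩ := hB k.1.1
        exact Nat.succ_le_succ (Nat.add_le_add
          ((hp _).trans (eval_mono p (k.1.1.1.size_block_le g h k.1.2.2)))
          (size_proj_residual_le hBk (fun i hi => k.1.1.1.blockStop_bounds g h hi) k.1.2.2)))
    exact (PT.solve hA hs' (fun k => k.1.2.2) h1.fst h1.snd).size_right
  have hL := (hself.poly q)
  refine ht.vecSub (PT.best (h := fun k => h k.1.rank) (F := fun k => k.1.blockStart g)
    (adv := fun k j => A.preprocess (k.1.block g h j)) (pad := A.preprocess intLattice)
    hT hn (fun k j hj => k.1.blockStart_eq g hj) hadv ht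
    (S := fun k => A.resid g h k.1 k.2) (o := fun k => A.solve g h k.1) (fun k => rfl)
    (K := fun k => 2 * k.1.enc.size * (3 * (2 * (q.eval (querySize k) + (encVec k.2).size) +
      4 * (2 * k.1.enc.size) + 54 * (2 * k.1.enc.size + 1) ^ 4 + 1) + 6 * (2 * k.1.enc.size) + 8)
      + 1) ?_ ?_ fun a' hadv hx => ?_)
  · exact (hN.mul ((((PB.const 3).mul (((((PB.const 2).mul (hL.add hts)).add
      ((PB.const 4).mul hN)).add ((PB.const 54).mul ((hN.add (PB.const 1)).pow 4))).add
      (PB.const 1))).add ((PB.const 6).mul hN)).add (PB.const 8))).add (PB.const 1)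
  · intro k j hj
    obtain ⟨D, Q, hBk⟩ := hB k
    have hL : ∀ i < k.1.rank, k.1.blockStart g i = true → (encVec (A.solve g h k.1 i
        (CVPP.proj (gs (k.1.hkz (g k.1.rank))) i (k.1.blockStop g h i)
          (A.resid g h k.1 k.2 (k.1.blockStop g h i))))).size ≤ q.eval (querySize k) :=
      fun i hi hF => hq ⟨⟨k, ⟨i, hi⟩⟩, hF⟩
    exact size_residual_le (o := A.solve g h k.1) (t := k.2) (L := q.eval (querySize k)) hBk
      (fun i hi => k.1.blockStop_bounds g h hi)
      (fun i hi hF => k.1.blockStart_blockStop g h (hg _ k.1.rank_pos) hi hF) hL hj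
  · exact PT.solve hA hs' (fun k => k.1.2.2) hadv hx

end Algorithm

end CVPP

theorem theorem5p2 (α g : ℕ → ℝ) (h : ℕ → ℕ)
    (hα_pos : ∀ n, 1 ≤ n → 0 < α n)
    (hα_le : ∀ n, 1 ≤ n → α n ≤ 1 / 2)
    (hα_anti : ∀ m n, 1 ≤ m → m ≤ n → α n ≤ α m)
    (hg_one : ∀ n, 1 ≤ n → 1 ≤ g n)
    (hg_mono : ∀ m n, 1 ≤ m → m ≤ n → g m ≤ g n)
    (hh_lt : ∀ n, 1 ≤ n → h n < n)
    (hh_mono : ∀ m n, 1 ≤ m → m ≤ n → h m ≤ h n)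
    (hgh : ∀ n, 1 ≤ n → g n ^ ((h n : ℤ) - 1) ≤ Real.sqrt (n : ℝ))
    (A : CVPP.PreprocAlg)
    (hA : A.PolyTimeSolvesPromiseCVPP (fun n => g n ^ h n / (2 * α n))
      (fun B => α B.rank * CVPP.lambda1 B.lattice)) :
    ∃ A' : CVPP.PreprocAlg,
      A'.PolyTimeSolvesCVPP (fun n => g n * Real.sqrt (n : ℝ) / (2 * α n)) ∧
      A'.UsesOnly A (fun n => n * (h n + 1)) := by
  obtain ⟨hpoly, hsolves⟩ := hA
  obtain ⟨p, hp, -⟩ := id hpoly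
  obtain ⟨q, K, ⟨r, hr⟩, hq⟩ := CVPP.exists_query hh_lt hg_one hpoly hp
  obtain ⟨r', hr'⟩ := CVPP.pb_advice (g := g) hh_lt hp
  refine ⟨⟨A.advice g h, q⟩, ⟨⟨r + r', fun B => ?_, fun B t _ => ?_⟩, fun B t _ => ?_⟩,
    fun B => ?_⟩
  · rw [Polynomial.eval_add]
    exact (hr' B).trans (Nat.le_add_left _ _)
  · obtain ⟨k, hk, hrun⟩ := hq ⟨B, t⟩
    refine ⟨_, k, hrun, (hk.trans (hr _)).trans ?_⟩
    rw [Polynomial.eval_add]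
    exact Nat.le_add_right _ _
  · obtain ⟨k, hk, hrun⟩ := hq ⟨B, t⟩
    obtain ⟨hli, hspan, -, -⟩ := B.hkz_spec (g B.rank)
    refine ⟨_, k, hrun, ?_, ?_⟩
    · obtain ⟨i, hi, hbest⟩ := CVPP.best_mem (A.resid g h B t) (B.blockStart g) B.rank 0
      obtain ⟨z, hz⟩ := CVPP.residual_eq_sub_comb (b := B.hkz (g B.rank))
        (u := CVPP.gs (B.hkz (g B.rank))) (o := A.solve g h B) (t := t)
        (fun i hi => B.blockStop_bounds g h hi) (show i ≤ B.rank by omega)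
      have hz' : A.resid g h B t i = t - CVPP.comb (B.hkz (g B.rank)) 0 B.rank z := hz
      simp only
      rw [hbest, hz', sub_sub_cancel, ← hspan]
      exact CVPP.toReal_comb_mem le_rfl z
    · obtain ⟨i, hi, hshort⟩ := CVPP.exists_short_resid g h A B hα_pos hα_le hα_anti hg_one hg_mono
        hh_mono hgh hsolves t
      rw [← CVPP.toReal_sub]
      simp only
      rw [sub_sub_cancel]
      refine le_trans (le_of_sq_le_sq ?_ (CVPP.nrm_nonneg _)) hshort
      change CVPP.nrm _ ^ 2 ≤ _
      rw [CVPP.nrm_sq, CVPP.nrm_sq, Rat.cast_le]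
      exact CVPP.best_le hi
  · obtain ⟨hli, hspan, hhkz, -⟩ := B.hkz_spec (g B.rank)
    exact ⟨fun i => B.hkz (g B.rank) i, B.blocks g h, hli, hspan, hhkz, B.sum_rank_blocks g h, rfl⟩
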